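/- Let $r:\mathbb R\to[0,\infty)$ be a continuous, compactly supported probability density, and let $f:\mathbb R\to\mathbb R$ be a measurable function (the single-site potential) with $c\,\chi_I\le f\le C\,\chi_{[-1,0]}$ for some constants $0<c\le C<\infty$ and some non-trivial interval $I\subseteq[-1,0]$, and such that for some interval $[a,b]\subseteq[-1,0]$ one has $f>0$ a.e. on $[a,b]$ and $f=0$ on $[-1,0]\setminus[a,b]$. Fix $M>0$ with $\operatorname{supp} r\subseteq[-M,M]$. Let $g\in L^\infty(-1,0)$ be real-valued, let $E\in\mathbb R$, let $N$ be a positive integer with $$2+\|g\|_\infty+M\|f\|_\infty+|E|<N\pi ,$$ and let $\mathbb T_N=\mathbb R/(2\pi N\mathbb Z)$ with Lebesgue measure (of total mass $2\pi N$). For $\theta,\lambda\in\mathbb R$ let $u_0(\cdot,\theta,\lambda)$ be the solution on $[-1,0]$ of $-u''+gu+\lambda fu=Eu$ with $u_0(0)=\sin\theta$, $u_0'(0)=\cos\theta$, and let $R_0(\cdot,\theta,\lambda)>0$ and $\varphi_0(\cdot,\theta,\lambda)$ be its Prüfer amplitude and phase: $u_0=R_0\sin\varphi_0$, $u_0'=R_0\cos\varphi_0$,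 with $\varphi_0$ continuous and $\varphi_0(0,\theta,\lambda)=\theta$. Since $\varphi_0(\cdot,\theta+\pi,\lambda)=\varphi_0(\cdot,\theta,\lambda)+\pi$ and $u_0(\cdot,\theta+\pi,\lambda)=-u_0(\cdot,\theta,\lambda)$, the map $\varphi_0(-1,\cdot,\lambda)$ induces a map $\mathbb T_N\to\mathbb T_N$, and $R_0$ and $u_0^2$ are well defined for $\theta\in\mathbb T_N$. For $\beta,\alpha\in\mathbb T_N$ let $\lambda(\beta,\alpha)$ be the (by the choice of $N$ unique) $\lambda\in[-M,M]$ with $\varphi_0(-1,\alpha,\lambda)=\beta$ in $\mathbb T_N$, if it exists. Put $$T_1(\beta,\alpha)=\frac{R_0(-1,\alpha,\lambda(\beta,\alpha))\;r(\lambda(\beta,\alpha))}{\int_{-1}^0 f(x)\,u_0(x,\alpha,\lambda(\beta,\alpha))^2\,dx}$$ if $\lambda(\beta,\alpha)$ exists, and $T_1(\beta,\alpha)=0$ otherwise. Then $$(T_1(g,E)F)(\beta)=\int_{\mathbb T_N}T_1(\beta,\alpha)F(\alpha)\,d\alpha$$ defines a bounded linear operator on the complex Hilbert space $L^2(\mathbb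 T_N)$, and its operator norm is strictly less than one: $\|T_1(g,E)\|_{2,2}<1$. -/

import Mathlib

open MeasureTheory Set
open scoped ENNReal

noncomputable section

namespace PrueferOperator

/-- Distribution density of the coupling constants: a continuous, compactly supported
probability density on the line. -/
structure IsCouplingDensity (r : ℝ → ℝ) : Prop where
  continuous : Continuous r
  nonneg : ∀ x, 0 ≤ r x
  compactSupport : HasCompactSupport r
  integral_eq_one : ∫ x, r x = 1

/-- Assumptions on the single-site potential `f`: it is measurable, `c χ_I ≤ f ≤ C χ_{[-1,0]}` with
`0 < c ≤ C` for some non-trivial interval `I ⊆ [-1,0]` (which may be taken closed), and there is an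
interval `[a,b] ⊆ [-1,0]` with `f > 0` a.e. on `[a,b]` and `f = 0` on `[-1,0] \ [a,b]`. -/
structure IsSingleSitePotential (f : ℝ → ℝ) : Prop where
  aemeasurable : AEMeasurable f
  bounds : ∃ c C p q : ℝ, 0 < c ∧ c ≤ C ∧ p < q ∧ Icc p q ⊆ Icc (-1) 0 ∧
    ∀ x, (Icc p q).indicator (fun _ => c) x ≤ f x ∧ f x ≤ (Icc (-1) 0).indicator (fun _ => C) x
  support : ∃ a b : ℝ, a ≤ b ∧ Icc a b ⊆ Icc (-1) 0 ∧
    (∀ᵐ x, x ∈ Icc a b → 0 < f x) ∧ ∀ x ∈ Icc (-1) 0 \ Icc a b, f x = 0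

/-- The space `L^∞(-1,0)` of real background potentials. -/
abbrev Background : Type := Lp ℝ ∞ (volume.restrict (Ioo (-1 : ℝ) 0))

/-- The function `q = g + lam f - E`, so that `-u'' + g u + lam f u = E u` reads `u'' = q u`. -/
def potential (f : ℝ → ℝ) (g : Background) (E lam : ℝ) (x : ℝ) : ℝ :=
  g x + lam * f x - E

/-- `y = (u, u')` is the solution on `[-1,0]` of `u'' = q u` with `u(c) = sin θ`, `u'(c) = cos θ`.
As `q` is only bounded and measurable, a solution is a `C¹` function `u` whose derivative
is absolutely continuous and satisfies the equation almost everywhere, that is, the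
equation holds in integrated form. -/
structure IsSolution (q : ℝ → ℝ) (c θ : ℝ) (y : ℝ → ℝ × ℝ) : Prop where
  continuousOn : ContinuousOn y (Icc (-1) 0)
  init : y c = (Real.sin θ, Real.cos θ)
  fst_eq : ∀ x ∈ Icc (-1 : ℝ) 0, (y x).1 = (y c).1 + ∫ t in c..x, (y t).2
  snd_eq : ∀ x ∈ Icc (-1 : ℝ) 0, (y x).2 = (y c).2 + ∫ t in c..x, q t * (y t).1

/-- The pair `(u, u')` for the solution of `u'' = q u` with `u(c) = sin θ`, `u'(c) = cos θ`; only
its values on `[-1,0]` are meaningful (and these are unique). -/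
def solution (q : ℝ → ℝ) (c θ : ℝ) : ℝ → ℝ × ℝ :=
  Classical.epsilon (IsSolution q c θ)

/-- The Prüfer amplitude `R = (u² + u'²)^(1/2)`. -/
def amplitude (q : ℝ → ℝ) (c θ x : ℝ) : ℝ :=
  Real.sqrt ((solution q c θ x).1 ^ 2 + (solution q c θ x).2 ^ 2)

/-- `φ` is the Prüfer phase: continuous on `[-1,0]`, `φ(c) = θ`, `u = R sin φ`, `u' = R cos φ`. -/
structure IsPhase (q : ℝ → ℝ) (c θ : ℝ) (φ : ℝ → ℝ) : Prop where
  continuousOn : ContinuousOn φ (Icc (-1) 0)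
  init : φ c = θ
  fst_eq : ∀ x ∈ Icc (-1 : ℝ) 0,
    (solution q c θ x).1 = amplitude q c θ x * Real.sin (φ x)
  snd_eq : ∀ x ∈ Icc (-1 : ℝ) 0,
    (solution q c θ x).2 = amplitude q c θ x * Real.cos (φ x)

/-- The Prüfer phase (meaningful, and unique, on `[-1,0]`). -/
def phase (q : ℝ → ℝ) (c θ : ℝ) : ℝ → ℝ :=
  Classical.epsilon (IsPhase q c θ)

/-- The circle `𝕋_N = ℝ / 2πNℤ`; its volume is Lebesgue measure, of total mass `2πN`. -/
abbrev Circle (N : ℕ+) : Type := AddCircle (2 * Real.pi * ((N : ℕ) : ℝ))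

instance circle_pos (N : ℕ+) : Fact (0 < 2 * Real.pi * ((N : ℕ) : ℝ)) :=
  ⟨mul_pos Real.two_pi_pos (Nat.cast_pos.mpr N.pos)⟩

/-- The representative of a point of `𝕋_N` in `[0, 2πN)`. -/
def rep {N : ℕ+} (α : Circle N) : ℝ :=
  (AddCircle.equivIco (2 * Real.pi * ((N : ℕ) : ℝ)) 0 α : ℝ)

/-- `lam ∈ [-M,M]` and the phase of the solution with phase `α` at `0` is `β` at `-1`, modulo `2πN`:
`φ₀(-1, α, lam, g, E) = β` in `𝕋_N`. (Since `φ₀(·, θ + π) = φ₀(·, θ) + π`, the choice of the real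
representative of `α` does not matter.) -/
def IsCoupling (f : ℝ → ℝ) (M : ℝ) (N : ℕ+) (g : Background) (E : ℝ) (β α : Circle N)
    (lam : ℝ) : Prop :=
  lam ∈ Icc (-M) M ∧ ((phase (potential f g E lam) 0 (rep α) (-1) : ℝ) : Circle N) = β

/-- The coupling constant `lam(β, α, g, E)`, meaningful if it exists. -/
def coupling (f : ℝ → ℝ) (M : ℝ) (N : ℕ+) (g : Background) (E : ℝ) (β α : Circle N) : ℝ :=
  Classical.epsilon (IsCoupling f M N g E β α)

/-- `u₊(x, β, α, g, E) = u₀(x, α, lam(β, α, g, E), g, E)`. -/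
def uPlus (f : ℝ → ℝ) (M : ℝ) (N : ℕ+) (g : Background) (E : ℝ) (β α : Circle N) (x : ℝ) : ℝ :=
  (solution (potential f g E (coupling f M N g E β α)) 0 (rep α) x).1

/-- `R₊(x, β, α, g, E) = R₀(x, α, lam(β, α, g, E), g, E)`. -/
def rPlus (f : ℝ → ℝ) (M : ℝ) (N : ℕ+) (g : Background) (E : ℝ) (β α : Circle N) (x : ℝ) : ℝ :=
  amplitude (potential f g E (coupling f M N g E β α)) 0 (rep α) x

open Classical in
/-- The kernel `T₁(β, α) = R₊(-1, β, α) r(lam(β, α)) / ∫ f u₊²` if `lam(β, α)` exists, and `0`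
otherwise. (The potential `f` vanishes outside `[-1,0]`.) -/
def kernelT₁ (r f : ℝ → ℝ) (M : ℝ) (N : ℕ+) (g : Background) (E : ℝ) (β α : Circle N) : ℝ :=
  if ∃ lam, IsCoupling f M N g E β α lam then
    rPlus f M N g E β α (-1) * r (coupling f M N g E β α) /
      ∫ x in (-1 : ℝ)..0, f x * uPlus f M N g E β α x ^ 2
  else 0

/-- The bounded operator `T` on `L²` is the integral operator with kernel `k`. -/
def IsIntegralOperator {X : Type*} [MeasurableSpace X] (μ : Measure X) (k : X → X → ℝ)
    (T : Lp ℂ 2 μ →L[ℂ] Lp ℂ 2 μ) : Prop :=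
  ∀ F : Lp ℂ 2 μ, (∀ᵐ β ∂μ, Integrable (fun α => (k β α : ℂ) * F α) μ) ∧
    T F =ᵐ[μ] fun β => ∫ α, (k β α : ℂ) * F α ∂μ

end PrueferOperator

end

/-!
The transfer operator with kernel `T₁` is a strict contraction because it is a compact operator
whose transpose averages unitary operators over the random coupling, and this average can only keep
the norm of a function if the function is transported by the Prüfer flow in a way that complex
analysis in the coupling excludes.

Write `φ_t(θ)`, `R_t(θ)` for the Prüfer phase and amplitude at `-1` of the solution with initial
phase `θ` and coupling `t`, and `Q_t(θ) = ∫ f u²`. Wronskian identities give `∂φ/∂θ = R⁻²` and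
`∂φ/∂t = Q R⁻² > 0` (`hasDerivAt_angle_angle`, `hasDerivAt_angle_coupling`). For couplings in
`[-M, M]` the phase moves by less than half of the circle, so the coupling that connects two phases
is unique, and the substitution `β = φ_t(α)` turns the transposed operator into
`F ↦ ∫ r(t) U_t F dt` with `(U_t F)(θ) = R_t(θ)⁻¹ F(φ_t(θ))` (`IsPhaseFlow.integral_kernel_mul`).
Each `U_t` is isometric since `∂φ/∂θ = R⁻²`, so the norm is at most one. The kernel is bounded, hence
the operator is compact and attains its norm (`IsIntegralOperator.exists_norm_attained`).

If the norm were one, a maximizer `F` would satisfy equality in the triangle inequality for a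
probability average: `F(φ_t(θ)) = R_t(θ) m(θ)` for almost all `t` with a single function `m`
(`ae_eq_mean`, `IsPhaseFlow.ae_eq_of_norm_le`). The averaged function `m` is continuous, so `F` may be
taken continuous, and `k = |F|²`, `H = |m|²` satisfy `k(φ_t(θ)) = R_t(θ)² H(θ)` for all `t` in the
open set `{r > 0}`. This forces `k = 0` (`density_eq_zero`): primitives of `k` and `H` show that the
`φ_t` are conjugate to translations, so that `H Q_t` is a constant; a positive definite quadratic
form is then constant along `t ↦ (u(-1), u'(-1))`, for `t` near one point and, by analyticity, for all
real `t`. Hence the solution at `-1` stays bounded as `t` runs through the real line. But it is entire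
in `t` of order at most `1/2`, and by Phragmén–Lindelöf such a function is constant
(`apply_eq_apply_of_bounded_on_real`), which contradicts `∂φ/∂t ≠ 0`.
-/

open MeasureTheory Set
open scoped ENNReal

noncomputable section

namespace PrueferOperator

/-! ### Volterra operators and solutions with complex coupling -/

/-- The Volterra operator `h ↦ ∫₀ˣ p h` on the continuous functions on `[-1,0]`. -/
def volterra (p : ℝ → ℝ) (hp : IntervalIntegrable p volume (-1) 0) :
    C(Icc (-1 : ℝ) 0, ℂ) →L[ℂ] C(Icc (-1 : ℝ) 0, ℂ) :=
  have hint : ∀ h : C(Icc (-1 : ℝ) 0, ℂ), IntervalIntegrable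
      (fun t => (p t : ℂ) * IccExtend (by norm_num) h t) volume (-1) 0 := fun h =>
    IntervalIntegrable.mul_continuousOn ⟨hp.1.ofReal, hp.2.ofReal⟩
      h.continuous.Icc_extend'.continuousOn
  have hint' : ∀ (h : C(Icc (-1 : ℝ) 0, ℂ)) (x : Icc (-1 : ℝ) 0), IntervalIntegrable
      (fun t => (p t : ℂ) * IccExtend (by norm_num) h t) volume 0 x := fun h x =>
    (hint h).mono_set (uIcc_subset_uIcc right_mem_uIcc
      (by rw [uIcc_of_le (by norm_num)]; exact x.2))
  LinearMap.mkContinuous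
    { toFun := fun h => ⟨fun x => ∫ t in (0 : ℝ)..x, (p t : ℂ) * IccExtend (by norm_num) h t, by
        have := intervalIntegral.continuousOn_primitive_interval' (hint h) right_mem_uIcc
        rw [uIcc_of_le (by norm_num)] at this
        exact this.comp_continuous continuous_subtype_val (fun x => x.2)⟩
      map_add' := fun h₁ h₂ => by
        ext x
        simp only [ContinuousMap.coe_mk, ContinuousMap.add_apply]
        rw [← intervalIntegral.integral_add (hint' h₁ x) (hint' h₂ x)]
        congr 1 with t
        simp [IccExtend, mul_add]
      map_smul' := fun c h => by
        ext x
        simp only [ContinuousMap.coe_mk, ContinuousMap.smul_apply, RingHom.id_apply]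
        rw [← intervalIntegral.integral_smul]
        congr 1 with t
        simp [IccExtend]; ring }
    (∫ t in (-1 : ℝ)..0, |p t|) (fun h => by
      rw [ContinuousMap.norm_le _ (mul_nonneg (intervalIntegral.integral_nonneg (by norm_num)
        fun t _ => abs_nonneg _) (norm_nonneg _))]
      intro x
      simp only [LinearMap.coe_mk, AddHom.coe_mk, ContinuousMap.coe_mk]
      rw [intervalIntegral.integral_symm, norm_neg, ← intervalIntegral.integral_mul_const]
      calc _ ≤ ∫ t in (x : ℝ)..0, |p t| * ‖h‖ := by
            refine intervalIntegral.norm_integral_le_of_norm_le x.2.2 (.of_forall fun t _ => ?_)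
              ((hp.abs.mul_const _).mono_set (uIcc_subset_uIcc
                (by rw [uIcc_of_le (by norm_num)]; exact x.2) right_mem_uIcc))
            rw [norm_mul, Complex.norm_real, Real.norm_eq_abs]
            exact mul_le_mul_of_nonneg_left (h.norm_coe_le_norm _) (abs_nonneg _)
        _ ≤ _ := intervalIntegral.integral_mono_interval x.2.1 x.2.2 le_rfl
            (.of_forall fun t => by positivity) (hp.abs.mul_const _))

theorem volterra_apply {p : ℝ → ℝ} (hp : IntervalIntegrable p volume (-1) 0)
    (h : C(Icc (-1 : ℝ) 0, ℂ)) (x : Icc (-1 : ℝ) 0) :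
    volterra p hp h x = ∫ t in (0 : ℝ)..x, (p t : ℂ) * IccExtend (by norm_num) h t := rfl

/-- Exponentially weighted bound for a Volterra operator: integration from `0` against a bounded
coefficient gains a factor `1/k` in the weight `e^{-kx}`. -/
theorem norm_volterra_le {p : ℝ → ℝ} (hp : IntervalIntegrable p volume (-1) 0) {K : ℝ}
    (hK : ∀ᵐ t, t ∈ Ioc (-1 : ℝ) 0 → |p t| ≤ K) {k m : ℝ} (hk : 0 < k) (hm : 0 ≤ m) (hK0 : 0 ≤ K)
    {h : C(Icc (-1 : ℝ) 0, ℂ)} (hh : ∀ x, ‖h x‖ ≤ m * Real.exp (-k * x)) (x : Icc (-1 : ℝ) 0) :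
    ‖volterra p hp h x‖ ≤ K * m / k * Real.exp (-k * x) := by
  rw [volterra_apply, intervalIntegral.integral_symm, norm_neg]
  have hb : ∀ t ∈ uIcc (x : ℝ) 0, HasDerivAt (fun t => -(K * m / k * Real.exp (-k * t)))
      (K * (m * Real.exp (-k * t))) t := by
    intro t _
    have := ((((hasDerivAt_id t).const_mul (-k)).exp).const_mul (K * m / k)).neg
    refine this.congr_deriv ?_
    simp; field_simp
  have hi := intervalIntegral.integral_eq_sub_of_hasDerivAt hb
    (Continuous.intervalIntegrable (by fun_prop) _ _)
  calc _ ≤ ∫ t in (x : ℝ)..0, K * (m * Real.exp (-k * t)) := by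
        refine intervalIntegral.norm_integral_le_of_norm_le x.2.2 ?_
          (Continuous.intervalIntegrable (by fun_prop) _ _)
        filter_upwards [hK] with t ht htx
        have h1 : t ∈ Ioc (-1 : ℝ) 0 := ⟨x.2.1.trans_lt htx.1, htx.2⟩
        rw [norm_mul, Complex.norm_real, Real.norm_eq_abs,
          IccExtend_of_mem _ _ (Ioc_subset_Icc_self h1)]
        exact mul_le_mul (ht h1) (hh _) (norm_nonneg _) hK0
    _ ≤ _ := by
        rw [hi]
        have : 0 ≤ K * m / k * Real.exp (-k * 0) := by positivity
        linarith

theorem one_sub_isUnit_of_conj {A : Type*} [NormedRing A] [CompleteSpace A] (W V P : A)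
    (h1 : W * V = 1) (h2 : V * W = 1) (hP : ‖V * P * W‖ < 1) : IsUnit (1 - P) := by
  let w : Aˣ := ⟨W, V, h1, h2⟩
  have h3 : IsUnit (1 - V * P * W) := isUnit_one_sub_of_norm_lt_one hP
  have : 1 - P = w * (1 - V * P * W) * (w⁻¹ : Aˣ) := by
    change 1 - P = W * (1 - V * P * W) * V
    rw [mul_sub, sub_mul, mul_one, h1]
    congr 1
    calc P = (W * V) * P * (W * V) := by rw [h1]; simp
      _ = _ := by simp only [mul_assoc]
  rw [this]
  exact (w.isUnit.mul h3).mul w⁻¹.isUnit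

theorem differentiable_inverse_sub_smul {A : Type*} [NormedRing A] [NormedAlgebra ℂ A]
    [CompleteSpace A] (P Q : A) (h : ∀ z : ℂ, IsUnit (P - z • Q)) :
    Differentiable ℂ fun z : ℂ => Ring.inverse (P - z • Q) := fun z => by
  have h1 : DifferentiableAt ℂ (fun w : ℂ => P - w • Q) z := by fun_prop
  exact h1.inverse (h z)

/-- A real coefficient on `[-1,0]`, measurable and essentially bounded by `K`. -/
structure IsBddCoeff (p : ℝ → ℝ) (K : ℝ) : Prop where
  nonneg : 0 ≤ K
  intervalIntegrable : IntervalIntegrable p volume (-1) 0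
  bound : ∀ᵐ t, t ∈ Ioc (-1 : ℝ) 0 → |p t| ≤ K

theorem isBddCoeff_one : IsBddCoeff (fun _ => 1) 1 :=
  ⟨zero_le_one, intervalIntegrable_const, .of_forall fun _ _ => by simp⟩

/-- The exponential `e^{kx}` on `[-1,0]`. -/
def expWeight (k : ℝ) : C(Icc (-1 : ℝ) 0, ℂ) :=
  ⟨fun x => (Real.exp (k * x) : ℂ), by fun_prop⟩

theorem norm_expWeight (k : ℝ) (x : Icc (-1 : ℝ) 0) : ‖expWeight k x‖ = Real.exp (k * x) := by
  change ‖((Real.exp (k * x) : ℝ) : ℂ)‖ = _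
  rw [Complex.norm_real, Real.norm_of_nonneg (Real.exp_pos _).le]

section

variable {q f : ℝ → ℝ} {K F : ℝ} (hq : IsBddCoeff q K) (hf : IsBddCoeff f F)

/-- `h ↦ ∫₀ˣ (q + z f) h`. -/
def potOp (z : ℂ) : C(Icc (-1 : ℝ) 0, ℂ) →L[ℂ] C(Icc (-1 : ℝ) 0, ℂ) :=
  volterra q hq.intervalIntegrable + z • volterra f hf.intervalIntegrable

/-- Integration from `0` on `[-1,0]`. -/
def primOp : C(Icc (-1 : ℝ) 0, ℂ) →L[ℂ] C(Icc (-1 : ℝ) 0, ℂ) :=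
  volterra (fun _ => 1) isBddCoeff_one.intervalIntegrable

theorem norm_potOp_le (z : ℂ) {k m : ℝ} (hk : 0 < k) (hm : 0 ≤ m) {h : C(Icc (-1 : ℝ) 0, ℂ)}
    (hh : ∀ x, ‖h x‖ ≤ m * Real.exp (-k * x)) (x : Icc (-1 : ℝ) 0) :
    ‖potOp hq hf z h x‖ ≤ (K + ‖z‖ * F) * m / k * Real.exp (-k * x) := by
  have h1 := norm_volterra_le hq.intervalIntegrable hq.bound hk hm hq.nonneg hh x
  have h2 := norm_volterra_le hf.intervalIntegrable hf.bound hk hm hf.nonneg hh x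
  calc _ ≤ ‖volterra q hq.intervalIntegrable h x‖ +
        ‖z‖ * ‖volterra f hf.intervalIntegrable h x‖ := by
        rw [← norm_mul]; exact norm_add_le _ _
    _ ≤ K * m / k * Real.exp (-k * x) + ‖z‖ * (F * m / k * Real.exp (-k * x)) := by gcongr
    _ = _ := by ring

theorem norm_primOp_potOp_le (z : ℂ) {k m : ℝ} (hk : 0 < k) (hm : 0 ≤ m)
    {h : C(Icc (-1 : ℝ) 0, ℂ)}
    (hh : ∀ x, ‖h x‖ ≤ m * Real.exp (-k * x)) (x : Icc (-1 : ℝ) 0) :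
    ‖primOp (potOp hq hf z h) x‖ ≤ (K + ‖z‖ * F) * m / k ^ 2 * Real.exp (-k * x) := by
  have h0 : 0 ≤ (K + ‖z‖ * F) := add_nonneg hq.nonneg (mul_nonneg (norm_nonneg _) hf.nonneg)
  refine (norm_volterra_le isBddCoeff_one.intervalIntegrable isBddCoeff_one.bound hk
    (by positivity) zero_le_one (norm_potOp_le hq hf z hk hm hh) x).trans (le_of_eq ?_)
  field_simp

/-- The exponential rate `√(2 (K + |z| F) + 1)` governing solutions of `u'' = (q + z f) u`. -/
def rate (K F : ℝ) (z : ℂ) : ℝ := Real.sqrt (2 * (K + ‖z‖ * F) + 1)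

theorem rate_pos (hq : IsBddCoeff q K) (hf : IsBddCoeff f F) (z : ℂ) : 0 < rate K F z :=
  Real.sqrt_pos.mpr (by have := mul_nonneg (norm_nonneg z) hf.nonneg; linarith [hq.nonneg])

theorem norm_primOp_potOp_le_half (z : ℂ) {m : ℝ} (hm : 0 ≤ m) {h : C(Icc (-1 : ℝ) 0, ℂ)}
    (hh : ∀ x, ‖h x‖ ≤ m * Real.exp (-rate K F z * x)) (x : Icc (-1 : ℝ) 0) :
    ‖primOp (potOp hq hf z h) x‖ ≤ m / 2 * Real.exp (-rate K F z * x) := by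
  have h0 : 0 ≤ (K + ‖z‖ * F) := add_nonneg hq.nonneg (mul_nonneg (norm_nonneg _) hf.nonneg)
  refine (norm_primOp_potOp_le hq hf z (rate_pos hq hf z) hm hh x).trans ?_
  have h2 : rate K F z ^ 2 = 2 * (K + ‖z‖ * F) + 1 := Real.sq_sqrt (by linarith)
  refine mul_le_mul_of_nonneg_right ?_ (Real.exp_pos _).le
  rw [h2, div_le_div_iff₀ (by linarith) two_pos]
  nlinarith

/-- The Volterra equation is uniquely solvable at every complex coupling: in the weight `e^{-kx}` with
`k = rate K F z` the integral operator has norm at most `1/2`. -/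
theorem isUnit_one_sub (z : ℂ) : IsUnit (1 - primOp ∘L potOp hq hf z) := by
  set k := rate K F z with hk
  have hW : ∀ a b : ℝ, a + b = 0 → ContinuousLinearMap.mul ℂ C(Icc (-1 : ℝ) 0, ℂ) (expWeight a) *
      ContinuousLinearMap.mul ℂ C(Icc (-1 : ℝ) 0, ℂ) (expWeight b) = 1 := by
    intro a b hab
    ext h x
    change (Real.exp (a * x) : ℂ) * ((Real.exp (b * x) : ℂ) * h x) = h x
    rw [← mul_assoc, ← Complex.ofReal_mul, ← Real.exp_add, ← add_mul, hab]
    simp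
  refine one_sub_isUnit_of_conj (ContinuousLinearMap.mul ℂ C(Icc (-1 : ℝ) 0, ℂ) (expWeight (-k)))
    (ContinuousLinearMap.mul ℂ C(Icc (-1 : ℝ) 0, ℂ) (expWeight k)) _ (hW _ _ (by ring))
    (hW _ _ (by ring)) (lt_of_le_of_lt (ContinuousLinearMap.opNorm_le_bound _
      (by norm_num : (0 : ℝ) ≤ 1 / 2) fun h => ?_) (by norm_num : (1 / 2 : ℝ) < 1))
  rw [ContinuousMap.norm_le _ (by positivity)]
  intro x
  change ‖(Real.exp (k * x) : ℂ) * primOp (potOp hq hf z (expWeight (-k) * h)) x‖ ≤ _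
  have := norm_primOp_potOp_le_half hq hf z (norm_nonneg h) (h := expWeight (-k) * h) (fun y => by
    rw [ContinuousMap.mul_apply, norm_mul, mul_comm]
    refine mul_le_mul (h.norm_coe_le_norm y) (norm_expWeight (-k) y).le (norm_nonneg _)
      (norm_nonneg _)) x
  rw [norm_mul, Complex.norm_real, Real.norm_of_nonneg (Real.exp_pos _).le]
  calc _ ≤ Real.exp (k * x) * (‖h‖ / 2 * Real.exp (-k * x)) := by gcongr
    _ = 1 / 2 * ‖h‖ * (Real.exp (k * x) * Real.exp (-k * x)) := by ring
    _ = _ := by rw [← Real.exp_add]; simp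

/-- The affine function `a + b x` on `[-1,0]`. -/
def affine (a b : ℂ) : C(Icc (-1 : ℝ) 0, ℂ) := ⟨fun x => a + b * (x : ℝ), by fun_prop⟩

/-- The solution of `u'' = (q + z f) u` with `u(0) = a`, `u'(0) = b`, for complex `z`, as a fixed
point of the Volterra equation `u = a + b x + ∫₀ˣ ∫₀ᵗ (q + z f) u`. -/
def cSol (a b z : ℂ) : C(Icc (-1 : ℝ) 0, ℂ) :=
  Ring.inverse (1 - primOp ∘L potOp hq hf z) (affine a b)

/-- The derivative of `cSol`. -/
def cSolDeriv (a b z : ℂ) : C(Icc (-1 : ℝ) 0, ℂ) :=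
  ContinuousMap.const _ b + potOp hq hf z (cSol hq hf a b z)

theorem cSol_fixed (a b z : ℂ) :
    cSol hq hf a b z = affine a b + primOp (potOp hq hf z (cSol hq hf a b z)) := by
  have := congrArg (fun T : C(Icc (-1 : ℝ) 0, ℂ) →L[ℂ] C(Icc (-1 : ℝ) 0, ℂ) => T (affine a b))
    (Ring.mul_inverse_cancel _ (isUnit_one_sub hq hf z))
  simp only [mul_apply_eq_comp, sub_apply,
    one_apply_eq_self, ContinuousLinearMap.comp_apply] at this
  rw [sub_eq_iff_eq_add] at this
  exact this

theorem eq_inverse_of_fixed {z : ℂ} {u h : C(Icc (-1 : ℝ) 0, ℂ)}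
    (hu : u = h + primOp (potOp hq hf z u)) :
    u = Ring.inverse (1 - primOp ∘L potOp hq hf z) h := by
  have := congrArg (fun T : C(Icc (-1 : ℝ) 0, ℂ) →L[ℂ] C(Icc (-1 : ℝ) 0, ℂ) => T u)
    (Ring.inverse_mul_cancel _ (isUnit_one_sub hq hf z))
  simp only [mul_apply_eq_comp, sub_apply,
    one_apply_eq_self, ContinuousLinearMap.comp_apply] at this
  rw [← this]
  congr 1
  rw [sub_eq_iff_eq_add]
  exact hu

/-- Solutions grow at most like `e^{√(2 F |z|)}` in the coupling, up to constants. -/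
theorem norm_cSol_le (a b z : ℂ) (x : Icc (-1 : ℝ) 0) :
    ‖cSol hq hf a b z x‖ ≤ 2 * (‖a‖ + ‖b‖) * Real.exp (-rate K F z * x) := by
  set k := rate K F z with hk
  have hk0 : 0 < k := rate_pos hq hf z
  set u := cSol hq hf a b z with hu
  -- `m` is the weighted sup norm of the solution
  obtain ⟨m, hm⟩ : ∃ m, m = ‖expWeight k * u‖ := ⟨_, rfl⟩
  have hub : ∀ x, ‖u x‖ ≤ m * Real.exp (-k * x) := by
    intro x
    have := (expWeight k * u).norm_coe_le_norm x
    rw [ContinuousMap.mul_apply, norm_mul, ← hm] at this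
    rw [norm_expWeight] at this
    calc ‖u x‖ = Real.exp (k * x) * ‖u x‖ * Real.exp (-k * x) := by
          rw [mul_right_comm, ← Real.exp_add]; simp
      _ ≤ _ := by gcongr
  have hm0 : 0 ≤ m := hm ▸ norm_nonneg _
  have hm2 : m ≤ (‖a‖ + ‖b‖) + m / 2 := by
    nth_rewrite 1 [hm]
    rw [ContinuousMap.norm_le _ (by positivity)]
    intro x
    have h3 := norm_primOp_potOp_le_half hq hf z hm0 hub x
    have h4 : ‖affine a b x‖ ≤ ‖a‖ + ‖b‖ := by
      refine (norm_add_le _ _).trans ?_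
      rw [norm_mul, Complex.norm_real]
      gcongr
      refine mul_le_of_le_one_right (norm_nonneg _) ?_
      rw [Real.norm_eq_abs, abs_le]
      exact ⟨x.2.1, x.2.2.trans zero_le_one⟩
    have h5 : Real.exp (k * x) ≤ 1 := by
      rw [Real.exp_le_one_iff]; exact mul_nonpos_of_nonneg_of_nonpos hk0.le x.2.2
    rw [ContinuousMap.mul_apply, norm_mul, norm_expWeight, hu, cSol_fixed]
    calc _ ≤ Real.exp (k * x) * (‖affine a b x‖ + ‖primOp (potOp hq hf z u) x‖) := by
          gcongr; exact norm_add_le _ _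
      _ ≤ Real.exp (k * x) * ((‖a‖ + ‖b‖) + m / 2 * Real.exp (-k * x)) := by gcongr
      _ = Real.exp (k * x) * (‖a‖ + ‖b‖) + m / 2 * (Real.exp (k * x) * Real.exp (-k * x)) := by ring
      _ ≤ 1 * (‖a‖ + ‖b‖) + m / 2 * 1 := by
          rw [← Real.exp_add]; simp only [neg_mul, add_neg_cancel, Real.exp_zero]; gcongr
      _ = _ := by ring
  refine (hub x).trans ?_
  gcongr
  linarith

theorem norm_cSolDeriv_le (a b z : ℂ) (x : Icc (-1 : ℝ) 0) :
    ‖cSolDeriv hq hf a b z x‖ ≤ ‖b‖ + (K + ‖z‖ * F) * (2 * (‖a‖ + ‖b‖)) / rate K F z *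
      Real.exp (-rate K F z * x) :=
  (norm_add_le _ _).trans (add_le_add le_rfl (norm_potOp_le hq hf z (rate_pos hq hf z)
    (by positivity) (norm_cSol_le hq hf a b z) x))

theorem differentiable_inverse :
    Differentiable ℂ fun z => Ring.inverse (1 - primOp ∘L potOp hq hf z) := by
  have h : ∀ z : ℂ, 1 - primOp ∘L potOp hq hf z =
      (1 - primOp ∘L volterra q hq.intervalIntegrable) -
        z • (primOp ∘L volterra f hf.intervalIntegrable) := by
    intro z
    ext h x
    simp [potOp]; ring
  simp only [h]
  exact differentiable_inverse_sub_smul (A := C(Icc (-1 : ℝ) 0, ℂ) →L[ℂ] C(Icc (-1 : ℝ) 0, ℂ))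
    _ _ fun z => h z ▸ isUnit_one_sub hq hf z

theorem differentiable_cSol (a b : ℂ) : Differentiable ℂ (cSol hq hf a b) :=
  fun z => (differentiable_inverse hq hf z).clm_apply (differentiableAt_const _)

theorem differentiable_cSolDeriv (a b : ℂ) : Differentiable ℂ (cSolDeriv hq hf a b) := by
  have h := differentiable_cSol hq hf a b
  unfold cSolDeriv potOp
  simp only [add_apply, smul_apply]
  fun_prop

theorem cSol_add_smul (a b a' b' s t z : ℂ) :
    cSol hq hf (s * a + t * a') (s * b + t * b') z
      = s • cSol hq hf a b z + t • cSol hq hf a' b' z := by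
  unfold cSol
  rw [← map_smul, ← map_smul, ← map_add]
  congr 1
  ext x
  simp [affine]; ring

theorem cSolDeriv_add_smul (a b a' b' s t z : ℂ) :
    cSolDeriv hq hf (s * a + t * a') (s * b + t * b') z
      = s • cSolDeriv hq hf a b z + t • cSolDeriv hq hf a' b' z := by
  unfold cSolDeriv
  rw [cSol_add_smul, map_add, map_smul, map_smul]
  ext x
  simp; ring

end

/-! ### Primitives of bounded measurable functions -/

/-- `U` is on `[-1,0]` a primitive of the bounded measurable function `a`. -/
structure IsPrim {𝕜 : Type*} [RCLike 𝕜] (U a : ℝ → 𝕜) : Prop where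
  intervalIntegrable : IntervalIntegrable a volume (-1) 0
  bound : ∃ K : ℝ, 0 ≤ K ∧ ∀ᵐ t, t ∈ Ioc (-1 : ℝ) 0 → ‖a t‖ ≤ K
  eq : ∀ x ∈ Icc (-1 : ℝ) 0, U x = U 0 + ∫ t in (0 : ℝ)..x, a t

namespace IsPrim

variable {𝕜 : Type*} [RCLike 𝕜] {U V a b : ℝ → 𝕜}

theorem intervalIntegrable_of_mem (h : IsPrim U a) {x y : ℝ} (hx : x ∈ Icc (-1 : ℝ) 0)
    (hy : y ∈ Icc (-1 : ℝ) 0) : IntervalIntegrable a volume x y := by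
  refine h.intervalIntegrable.mono_set (uIcc_subset_uIcc ?_ ?_) <;>
  rwa [uIcc_of_le (by norm_num)]

theorem sub_eq (h : IsPrim U a) {x y : ℝ} (hx : x ∈ Icc (-1 : ℝ) 0)
    (hy : y ∈ Icc (-1 : ℝ) 0) : U y - U x = ∫ t in x..y, a t := by
  have h0 : (0 : ℝ) ∈ Icc (-1 : ℝ) 0 := by norm_num
  rw [h.eq y hy, h.eq x hx, add_sub_add_left_eq_sub,
    intervalIntegral.integral_interval_sub_left (h.intervalIntegrable_of_mem h0 hy)
      (h.intervalIntegrable_of_mem h0 hx)]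

theorem lipschitzOnWith (h : IsPrim U a) :
    ∃ K : NNReal, LipschitzOnWith K U (uIcc (-1) 0) := by
  obtain ⟨K, hK0, hK⟩ := h.bound
  refine ⟨⟨K, hK0⟩, LipschitzOnWith.of_dist_le_mul fun x hx y hy => ?_⟩
  rw [uIcc_of_le (by norm_num)] at hx hy
  rw [dist_eq_norm, h.sub_eq hy hx, Real.dist_eq]
  refine intervalIntegral.norm_integral_le_of_norm_le_const_ae ?_
  filter_upwards [hK] with t ht htx
  refine ht ?_
  rw [uIoc, mem_Ioc] at htx
  exact ⟨(le_min hy.1 hx.1).trans_lt htx.1, htx.2.trans (max_le hy.2 hx.2)⟩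

theorem absolutelyContinuous (h : IsPrim U a) : AbsolutelyContinuousOnInterval U (-1) 0 :=
  h.lipschitzOnWith.choose_spec.absolutelyContinuousOnInterval

theorem continuousOn (h : IsPrim U a) : ContinuousOn U (Icc (-1) 0) := by
  have := h.lipschitzOnWith.choose_spec.continuousOn
  rwa [uIcc_of_le (by norm_num)] at this

theorem ae_hasDerivAt (h : IsPrim U a) : ∀ᵐ x, x ∈ uIcc (-1 : ℝ) 0 → HasDerivAt U (a x) x := by
  have h1 : ∀ᵐ x : ℝ, x ≠ -1 := by simp [ae_iff]
  have h2 : ∀ᵐ x : ℝ, x ≠ 0 := by simp [ae_iff]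
  filter_upwards [h.intervalIntegrable.ae_hasDerivAt_integral, h1, h2] with x hx hx1 hx2 hxm
  have h3 := (hx hxm 0 right_mem_uIcc).const_add (U 0)
  rw [uIcc_of_le (by norm_num)] at hxm
  refine h3.congr_of_eventuallyEq ?_
  filter_upwards [Ioo_mem_nhds (lt_of_le_of_ne hxm.1 (Ne.symm hx1)) (lt_of_le_of_ne hxm.2 hx2)]
    with y hy
  exact h.eq y (Ioo_subset_Icc_self hy)

/-- An absolutely continuous function with an almost everywhere derivative that is bounded is a
primitive of the latter. -/
theorem of_absolutelyContinuous (hU : AbsolutelyContinuousOnInterval U (-1) 0)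
    (hi : IntervalIntegrable a volume (-1) 0)
    (hb : ∃ K : ℝ, 0 ≤ K ∧ ∀ᵐ t, t ∈ Ioc (-1 : ℝ) 0 → ‖a t‖ ≤ K)
    (hd : ∀ᵐ x, x ∈ uIcc (-1 : ℝ) 0 → HasDerivAt U (a x) x) : IsPrim U a := by
  refine ⟨hi, hb, fun x hx => ?_⟩
  have hA : IsPrim (fun x => ∫ t in (0 : ℝ)..x, a t) a := ⟨hi, hb, fun x _ => by simp⟩
  have hac : AbsolutelyContinuousOnInterval (fun x => U x - ∫ t in (0 : ℝ)..x, a t) (-1) 0 :=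
    hU.sub hA.absolutelyContinuous
  obtain ⟨C, hC⟩ := hac.const_of_ae_hasDerivAt_zero (by
    filter_upwards [hd, hA.ae_hasDerivAt] with x h1 h2 hx
    exact ((h1 hx).sub (h2 hx)).congr_deriv (sub_self _))
  have e0 := hC 0 right_mem_uIcc
  have ex := hC x (by rwa [uIcc_of_le (by norm_num)])
  simp only [intervalIntegral.integral_same, sub_zero] at e0
  rw [e0, ← ex]; ring

theorem bound_continuousOn (hU : ContinuousOn U (Icc (-1) 0)) :
    ∃ K : ℝ, 0 ≤ K ∧ ∀ t ∈ Icc (-1 : ℝ) 0, ‖U t‖ ≤ K := by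
  obtain ⟨K, hK⟩ := isCompact_Icc.exists_bound_of_continuousOn hU
  exact ⟨max K 0, le_max_right _ _, fun t ht => (hK t ht).trans (le_max_left _ _)⟩

theorem mul_bound (ha : ∃ K : ℝ, 0 ≤ K ∧ ∀ᵐ t, t ∈ Ioc (-1 : ℝ) 0 → ‖a t‖ ≤ K)
    (hV : ContinuousOn V (Icc (-1) 0)) :
    ∃ K : ℝ, 0 ≤ K ∧ ∀ᵐ t, t ∈ Ioc (-1 : ℝ) 0 → ‖a t * V t‖ ≤ K := by
  obtain ⟨K, hK0, hK⟩ := ha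
  obtain ⟨L, hL0, hL⟩ := bound_continuousOn hV
  refine ⟨K * L, mul_nonneg hK0 hL0, ?_⟩
  filter_upwards [hK] with t ht htm
  rw [norm_mul]
  exact mul_le_mul (ht htm) (hL t (Ioc_subset_Icc_self htm)) (norm_nonneg _) hK0

theorem add_bound (ha : ∃ K : ℝ, 0 ≤ K ∧ ∀ᵐ t, t ∈ Ioc (-1 : ℝ) 0 → ‖a t‖ ≤ K)
    (hb : ∃ K : ℝ, 0 ≤ K ∧ ∀ᵐ t, t ∈ Ioc (-1 : ℝ) 0 → ‖b t‖ ≤ K) :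
    ∃ K : ℝ, 0 ≤ K ∧ ∀ᵐ t, t ∈ Ioc (-1 : ℝ) 0 → ‖a t + b t‖ ≤ K := by
  obtain ⟨K, hK0, hK⟩ := ha
  obtain ⟨L, hL0, hL⟩ := hb
  refine ⟨K + L, add_nonneg hK0 hL0, ?_⟩
  filter_upwards [hK, hL] with t ht ht' htm
  exact (norm_add_le _ _).trans (add_le_add (ht htm) (ht' htm))

theorem add (hU : IsPrim U a) (hV : IsPrim V b) :
    IsPrim (fun x => U x + V x) (fun x => a x + b x) := by
  refine ⟨hU.intervalIntegrable.add hV.intervalIntegrable, add_bound hU.bound hV.bound,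
    fun x hx => ?_⟩
  have h0 : (0 : ℝ) ∈ Icc (-1 : ℝ) 0 := by norm_num
  rw [intervalIntegral.integral_add (hU.intervalIntegrable_of_mem h0 hx)
    (hV.intervalIntegrable_of_mem h0 hx), hU.eq x hx, hV.eq x hx]
  ring

theorem neg (hU : IsPrim U a) : IsPrim (fun x => -U x) (fun x => -a x) := by
  refine ⟨hU.intervalIntegrable.neg, by simpa using hU.bound, fun x hx => ?_⟩
  rw [intervalIntegral.integral_neg, hU.eq x hx]
  ring

theorem mul (hU : IsPrim U a) (hV : IsPrim V b) :
    IsPrim (fun x => U x * V x) (fun x => a x * V x + b x * U x) := by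
  have hUc := hU.continuousOn
  have hVc := hV.continuousOn
  have hUc' := hUc
  have hVc' := hVc
  rw [← uIcc_of_le (by norm_num : (-1 : ℝ) ≤ 0)] at hUc' hVc'
  refine of_absolutelyContinuous (hU.absolutelyContinuous.smul hV.absolutelyContinuous)
    ((hU.intervalIntegrable.mul_continuousOn hVc').add
      (hV.intervalIntegrable.mul_continuousOn hUc'))
    (add_bound (mul_bound hU.bound hVc) (mul_bound hV.bound hUc)) ?_
  filter_upwards [hU.ae_hasDerivAt, hV.ae_hasDerivAt] with x h1 h2 hx
  exact ((h1 hx).mul (h2 hx)).congr_deriv (by ring)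

theorem congr (hU : IsPrim U a) (h : ∀ᵐ t, t ∈ Ioc (-1 : ℝ) 0 → a t = b t) : IsPrim U b := by
  have h' : ∀ x ∈ Icc (-1 : ℝ) 0, ∀ᵐ t, t ∈ uIoc 0 x → a t = b t := by
    intro x hx
    filter_upwards [h] with t ht htx
    rw [uIoc_of_ge hx.2] at htx
    exact ht ⟨hx.1.trans_lt htx.1, htx.2⟩
  refine ⟨hU.intervalIntegrable.congr_ae ?_, ?_, fun x hx => ?_⟩
  · rw [uIoc_of_le (by norm_num)]
    exact (ae_restrict_iff' measurableSet_Ioc).2 h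
  · obtain ⟨K, hK0, hK⟩ := hU.bound
    refine ⟨K, hK0, ?_⟩
    filter_upwards [hK, h] with t h1 h2 ht
    rw [← h2 ht]; exact h1 ht
  · rw [hU.eq x hx, intervalIntegral.integral_congr_ae (h' x hx)]

theorem comp_real {ζ p : ℝ → ℝ} (hζ : IsPrim ζ p) {φ φ' : ℝ → ℝ} (hφ : LipschitzWith 1 φ)
    (hd : ∀ x, HasDerivAt φ (φ' x) x) (hc : Continuous φ') :
    IsPrim (fun x => φ (ζ x)) (fun x => p x * φ' (ζ x)) := by
  have hcont : ContinuousOn (fun x => φ' (ζ x)) (Icc (-1) 0) :=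
    hc.comp_continuousOn hζ.continuousOn
  refine of_absolutelyContinuous ?_ (hζ.intervalIntegrable.mul_continuousOn
    (by rwa [uIcc_of_le (by norm_num)])) (mul_bound hζ.bound hcont) ?_
  · obtain ⟨K, hK⟩ := hζ.lipschitzOnWith
    exact (hφ.comp_lipschitzOnWith hK).absolutelyContinuousOnInterval
  · filter_upwards [hζ.ae_hasDerivAt] with x hx hxm
    exact ((hd (ζ x)).comp x (hx hxm)).congr_deriv (mul_comm _ _)

theorem sin {ζ p : ℝ → ℝ} (hζ : IsPrim ζ p) :
    IsPrim (fun x => Real.sin (ζ x)) (fun x => p x * Real.cos (ζ x)) :=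
  hζ.comp_real (φ := Real.sin) (LipschitzWith.of_dist_le_mul fun x y => by
    simpa [Real.dist_eq] using Real.abs_sin_sub_sin_le x y) Real.hasDerivAt_sin Real.continuous_cos

theorem cos {ζ p : ℝ → ℝ} (hζ : IsPrim ζ p) :
    IsPrim (fun x => Real.cos (ζ x)) (fun x => p x * -Real.sin (ζ x)) :=
  hζ.comp_real (φ := Real.cos) (LipschitzWith.of_dist_le_mul fun x y => by
    simpa [Real.dist_eq] using Real.abs_cos_sub_cos_le x y) Real.hasDerivAt_cos
      Real.continuous_sin.neg

/-- Wronskian identity: for `U'' = A`, `V'' = B`, the derivative of `U' V - V' U` is `A V - B U`. -/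
theorem wronskian {U' V' A B : ℝ → 𝕜} (h1 : IsPrim U U') (h2 : IsPrim U' A) (h3 : IsPrim V V')
    (h4 : IsPrim V' B) :
    IsPrim (fun x => U' x * V x + -(V' x * U x)) (fun x => A x * V x + -(B x * U x)) :=
  ((h2.mul h3).add (h4.mul h1).neg).congr (.of_forall fun t _ => by ring)

end IsPrim

/-- A homogeneous Volterra equation has only the zero solution, by a weight `e^{-kx}` in which the
operator is a contraction. -/
theorem eq_zero_of_volterra_fixed {p : ℝ → ℝ} {K : ℝ} (hp : IsBddCoeff p K)
    {h : C(Icc (-1 : ℝ) 0, ℂ)} (hh : h = volterra p hp.intervalIntegrable h) : h = 0 := by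
  have hk : 0 < 2 * K + 1 := by linarith [hp.nonneg]
  obtain ⟨m, hm⟩ : ∃ m, m = ‖expWeight (2 * K + 1) * h‖ := ⟨_, rfl⟩
  have hm0 : 0 ≤ m := hm ▸ norm_nonneg _
  have hub : ∀ x, ‖h x‖ ≤ m * Real.exp (-(2 * K + 1) * x) := by
    intro x
    have := (expWeight (2 * K + 1) * h).norm_coe_le_norm x
    rw [ContinuousMap.mul_apply, norm_mul, ← hm, norm_expWeight] at this
    calc ‖h x‖ = Real.exp ((2 * K + 1) * x) * ‖h x‖ * Real.exp (-(2 * K + 1) * x) := by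
          rw [mul_right_comm, ← Real.exp_add, neg_mul, add_neg_cancel]; simp
      _ ≤ _ := by gcongr
  have hm2 : m ≤ K * m / (2 * K + 1) := by
    have : 0 ≤ K * m / (2 * K + 1) := by have := hp.nonneg; positivity
    nth_rewrite 1 [hm]
    rw [ContinuousMap.norm_le _ this]
    intro x
    have h3 := norm_volterra_le hp.intervalIntegrable hp.bound hk hm0 hp.nonneg hub x
    rw [← hh] at h3
    rw [ContinuousMap.mul_apply, norm_mul, norm_expWeight]
    calc _ ≤ Real.exp ((2 * K + 1) * x) * (K * m / (2 * K + 1) * Real.exp (-(2 * K + 1) * x)) := by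
          gcongr
      _ = K * m / (2 * K + 1) * (Real.exp ((2 * K + 1) * x) * Real.exp (-(2 * K + 1) * x)) := by
          ring
      _ = _ := by rw [← Real.exp_add, neg_mul, add_neg_cancel]; simp
  have hm3 : m = 0 := by
    rw [le_div_iff₀ hk] at hm2
    nlinarith [hp.nonneg]
  ext x
  have := hub x
  rw [hm3, zero_mul] at this
  simpa using this

/-- A primitive that vanishes at `0` and solves a homogeneous linear first-order equation
vanishes. -/
theorem IsPrim.eq_zero {n p : ℝ → ℝ} {K : ℝ} (hp : IsBddCoeff p K)
    (hn : IsPrim n (fun x => p x * n x)) (h0 : n 0 = 0) : ∀ x ∈ Icc (-1 : ℝ) 0, n x = 0 := by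
  have hc := hn.continuousOn.domRestrict
  have := eq_zero_of_volterra_fixed hp (h := ⟨fun x => (n x : ℂ), by
    exact Complex.continuous_ofReal.comp hc⟩) (by
      ext x
      rw [volterra_apply]
      simp only [ContinuousMap.coe_mk]
      rw [hn.eq x x.2, h0, zero_add, ← intervalIntegral.integral_ofReal]
      refine intervalIntegral.integral_congr fun t ht => ?_
      rw [uIcc_of_ge x.2.2] at ht
      have ht' : t ∈ Icc (-1 : ℝ) 0 := ⟨x.2.1.trans ht.1, ht.2⟩
      simp only [IccExtend_of_mem _ _ ht', Complex.ofReal_mul])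
  intro x hx
  have := DFunLike.congr_fun this ⟨x, hx⟩
  simpa using this

/-! ### Real solutions and the derivative in the coupling -/

/-- The extension of a function on `[-1,0]` to the line by its boundary values. -/
abbrev extend (h : C(Icc (-1 : ℝ) 0, ℂ)) : ℝ → ℂ := IccExtend (by norm_num) h

theorem continuous_extend (h : C(Icc (-1 : ℝ) 0, ℂ)) : Continuous (extend h) :=
  h.continuous.Icc_extend'

theorem extend_of_mem (h : C(Icc (-1 : ℝ) 0, ℂ)) {x : ℝ} (hx : x ∈ Icc (-1 : ℝ) 0) :
    extend h x = h ⟨x, hx⟩ := IccExtend_of_mem _ _ hx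

theorem norm_extend_le (h : C(Icc (-1 : ℝ) 0, ℂ)) (x : ℝ) : ‖extend h x‖ ≤ ‖h‖ :=
  h.norm_coe_le_norm _

theorem isPrim_volterra {p : ℝ → ℝ} {K : ℝ} (hp : IsBddCoeff p K) (h : C(Icc (-1 : ℝ) 0, ℂ)) :
    IsPrim (extend (volterra p hp.intervalIntegrable h)) (fun t => (p t : ℂ) * extend h t) := by
  refine ⟨IntervalIntegrable.mul_continuousOn
      ⟨hp.intervalIntegrable.1.ofReal, hp.intervalIntegrable.2.ofReal⟩
      (continuous_extend h).continuousOn, ⟨K * ‖h‖, mul_nonneg hp.nonneg (norm_nonneg _), ?_⟩,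
      fun x hx => ?_⟩
  · filter_upwards [hp.bound] with t ht htm
    rw [norm_mul, Complex.norm_real]
    exact mul_le_mul (ht htm) (norm_extend_le h t) (norm_nonneg _) hp.nonneg
  · rw [extend_of_mem _ hx, extend_of_mem _ (by norm_num : (0 : ℝ) ∈ Icc (-1 : ℝ) 0),
      volterra_apply, volterra_apply]
    simp

theorem IsPrim.congr_left {𝕜 : Type*} [RCLike 𝕜] {U V a : ℝ → 𝕜} (h : IsPrim U a)
    (hUV : ∀ x ∈ Icc (-1 : ℝ) 0, U x = V x) : IsPrim V a :=
  ⟨h.intervalIntegrable, h.bound, fun x hx => by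
    rw [← hUV x hx, ← hUV 0 (by norm_num), h.eq x hx]⟩

theorem IsPrim.const_add {𝕜 : Type*} [RCLike 𝕜] {U a : ℝ → 𝕜} (h : IsPrim U a) (c : 𝕜) :
    IsPrim (fun x => c + U x) a :=
  ⟨h.intervalIntegrable, h.bound, fun x hx => by rw [h.eq x hx]; ring⟩

theorem isPrim_const_mul {𝕜 : Type*} [RCLike 𝕜] {U a : ℝ → 𝕜} (h : IsPrim U a) (c : 𝕜) :
    IsPrim (fun x => c * U x) (fun x => c * a x) := by
  refine ⟨h.intervalIntegrable.const_mul c, ?_, fun x hx => by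
    rw [intervalIntegral.integral_const_mul, h.eq x hx]; ring⟩
  obtain ⟨K, hK0, hK⟩ := h.bound
  refine ⟨‖c‖ * K, by positivity, ?_⟩
  filter_upwards [hK] with t ht htm
  rw [norm_mul]
  exact mul_le_mul_of_nonneg_left (ht htm) (norm_nonneg _)

theorem IsPrim.re {U a : ℝ → ℂ} (h : IsPrim U a) :
    IsPrim (fun x => (U x).re) (fun x => (a x).re) := by
  refine ⟨⟨h.intervalIntegrable.1.re, h.intervalIntegrable.2.re⟩, ?_, fun x hx => ?_⟩
  · obtain ⟨K, hK0, hK⟩ := h.bound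
    refine ⟨K, hK0, ?_⟩
    filter_upwards [hK] with t ht htm
    exact (Complex.abs_re_le_norm _).trans (ht htm)
  · have hi := h.intervalIntegrable_of_mem (by norm_num : (0 : ℝ) ∈ Icc (-1 : ℝ) 0) hx
    have := Complex.reCLM.intervalIntegral_comp_comm hi
    simp only [Complex.reCLM_apply] at this
    rw [this, h.eq x hx, Complex.add_re]

theorem volterra_zero {p : ℝ → ℝ} (hp : IntervalIntegrable p volume (-1) 0)
    (h : C(Icc (-1 : ℝ) 0, ℂ)) : volterra p hp h ⟨0, by norm_num⟩ = 0 := by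
  rw [volterra_apply]; simp

theorem volterra_star {p : ℝ → ℝ} (hp : IntervalIntegrable p volume (-1) 0)
    (h : C(Icc (-1 : ℝ) 0, ℂ)) : volterra p hp (star h) = star (volterra p hp h) := by
  ext x
  rw [ContinuousMap.star_apply, volterra_apply, volterra_apply]
  simp only [intervalIntegral]
  rw [RCLike.star_def, map_sub, ← integral_conj, ← integral_conj]
  simp [IccExtend]

section

variable {q f : ℝ → ℝ} {K F : ℝ} (hq : IsBddCoeff q K) (hf : IsBddCoeff f F)

theorem isPrim_potOp (z : ℂ) (h : C(Icc (-1 : ℝ) 0, ℂ)) :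
    IsPrim (extend (potOp hq hf z h)) (fun t => (q t + z * f t) * extend h t) :=
  (((isPrim_volterra hq h).add (isPrim_const_mul (isPrim_volterra hf h) z)).congr
    (.of_forall fun t _ => by ring)).congr_left fun x hx => by
      simp [IccExtend, potOp]

theorem cSol_eq (a b z : ℂ) :
    cSol hq hf a b z = ContinuousMap.const _ a + primOp (cSolDeriv hq hf a b z) := by
  have : primOp (ContinuousMap.const _ b) = affine 0 b := by
    ext x
    rw [primOp, volterra_apply]
    simp [IccExtend, affine, mul_comm]
  rw [cSolDeriv, map_add, this]
  nth_rewrite 1 [cSol_fixed]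
  ext x
  simp [affine]; ring

theorem isPrim_cSol (a b z : ℂ) :
    IsPrim (extend (cSol hq hf a b z)) (extend (cSolDeriv hq hf a b z)) :=
  (((isPrim_volterra isBddCoeff_one (cSolDeriv hq hf a b z)).const_add a).congr
    (.of_forall fun t _ => by simp)).congr_left fun x hx => by
      rw [cSol_eq]; simp [IccExtend, primOp]

theorem isPrim_cSolDeriv (a b z : ℂ) :
    IsPrim (extend (cSolDeriv hq hf a b z))
      (fun t => (q t + z * f t) * extend (cSol hq hf a b z) t) :=
  ((isPrim_potOp hq hf z (cSol hq hf a b z)).const_add b).congr_left fun x hx => by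
      simp [IccExtend, cSolDeriv]

theorem cSol_zero (a b z : ℂ) : cSol hq hf a b z ⟨0, by norm_num⟩ = a := by
  rw [cSol_eq, ContinuousMap.add_apply, primOp, volterra_zero]; simp

theorem cSolDeriv_zero (a b z : ℂ) : cSolDeriv hq hf a b z ⟨0, by norm_num⟩ = b := by
  rw [cSolDeriv, ContinuousMap.add_apply, potOp]
  simp [volterra_zero]

/-- At real coupling a solution with real initial values is real. -/
theorem star_cSol (a b t : ℝ) : star (cSol hq hf a b t) = cSol hq hf a b t := by
  refine eq_inverse_of_fixed hq hf ?_
  nth_rewrite 1 [cSol_fixed]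
  have h1 : ∀ h, potOp hq hf (t : ℂ) (star h) = star (potOp hq hf (t : ℂ) h) := by
    intro h
    simp only [potOp, add_apply, smul_apply, volterra_star, star_add, star_smul]
    congr 2
    simp
  rw [star_add, h1, primOp, volterra_star]
  congr 1
  ext x
  simp [affine]

theorem star_cSolDeriv (a b t : ℝ) : star (cSolDeriv hq hf a b t) = cSolDeriv hq hf a b t := by
  have h1 : ∀ h, potOp hq hf (t : ℂ) (star h) = star (potOp hq hf (t : ℂ) h) := by
    intro h
    simp only [potOp, add_apply, smul_apply, volterra_star, star_add, star_smul]
    congr 2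
    simp
  rw [cSolDeriv, star_add, ← h1, star_cSol]
  congr 1
  ext x
  simp

/-- The derivatives `(w, v)` of `(u, u')` with respect to the coupling solve the inhomogeneous
equation `w' = v`, `v' = (q + z f) w + f u` with vanishing data at `0`. The Wronskian of `u`
and `w` therefore integrates `f u²`. -/
theorem deriv_coupling_wronskian (a b z : ℂ) :
    deriv (cSol hq hf a b) z ⟨-1, by norm_num⟩ * cSolDeriv hq hf a b z ⟨-1, by norm_num⟩
      - cSol hq hf a b z ⟨-1, by norm_num⟩ * deriv (cSolDeriv hq hf a b) z ⟨-1, by norm_num⟩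
      = ∫ t in (-1 : ℝ)..0, (f t : ℂ) * extend (cSol hq hf a b z) t ^ 2 := by
  set u := cSol hq hf a b z with hu
  set u' := cSolDeriv hq hf a b z with hu'
  have hdu : HasDerivAt (cSol hq hf a b) (deriv (cSol hq hf a b) z) z :=
    (differentiable_cSol hq hf a b z).hasDerivAt
  have hdu' : HasDerivAt (cSolDeriv hq hf a b) (deriv (cSolDeriv hq hf a b) z) z :=
    (differentiable_cSolDeriv hq hf a b z).hasDerivAt
  set w := deriv (cSol hq hf a b) z
  set v := deriv (cSolDeriv hq hf a b) z
  have hw : w = primOp v := by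
    have h1 : HasDerivAt (fun z => ContinuousMap.const (Icc (-1 : ℝ) 0) a +
        primOp (cSolDeriv hq hf a b z)) (primOp v) z :=
      (primOp.hasFDerivAt.comp_hasDerivAt z hdu').const_add _
    simp only [← cSol_eq] at h1
    exact hdu.unique h1
  have hv : v = potOp hq hf z w + volterra f hf.intervalIntegrable u := by
    have h1 : HasDerivAt (fun z => ContinuousMap.const (Icc (-1 : ℝ) 0) b +
        (volterra q hq.intervalIntegrable (cSol hq hf a b z) +
        z • volterra f hf.intervalIntegrable (cSol hq hf a b z)))
        (volterra q hq.intervalIntegrable w + (z • volterra f hf.intervalIntegrable w +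
          (1 : ℂ) • volterra f hf.intervalIntegrable u)) z :=
      (((volterra q hq.intervalIntegrable).hasFDerivAt.comp_hasDerivAt z hdu).add
        ((hasDerivAt_id z).smul
          ((volterra f hf.intervalIntegrable).hasFDerivAt.comp_hasDerivAt z hdu))).const_add _
    have h2 := hdu'.unique h1
    rw [h2, potOp, one_smul, ← add_assoc]
    rfl
  have p1 : IsPrim (extend w) (extend v) :=
    ((isPrim_volterra isBddCoeff_one v).congr (.of_forall fun t _ => by simp)).congr_left
      fun x hx => by rw [hw]; rfl
  have p2 : IsPrim (extend v) (fun t => (q t + z * f t) * extend w t + f t * extend u t) :=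
    ((isPrim_potOp hq hf z w).add (isPrim_volterra hf u)).congr_left fun x hx => by
      rw [extend_of_mem _ hx, extend_of_mem _ hx, extend_of_mem _ hx, ← ContinuousMap.add_apply,
        ← hv]
  have hW := ((IsPrim.wronskian p1 p2 (isPrim_cSol hq hf a b z)
    (isPrim_cSolDeriv hq hf a b z)).congr (b := fun t => f t * extend u t ^ 2)
      (.of_forall fun t _ => by ring)).eq (-1) (by norm_num)
  have h0 : (0 : ℝ) ∈ Icc (-1 : ℝ) 0 := by norm_num
  have h1 : (-1 : ℝ) ∈ Icc (-1 : ℝ) 0 := by norm_num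
  have hw0 : w ⟨0, h0⟩ = 0 := by rw [hw]; exact volterra_zero _ _
  have hv0 : v ⟨0, h0⟩ = 0 := by
    rw [hv]
    simp [potOp, volterra_zero]
  simp only [extend_of_mem _ h0, extend_of_mem _ h1, hw0, hv0] at hW
  rw [intervalIntegral.integral_symm, ← neg_eq_iff_eq_neg]
  simp only [zero_mul, mul_zero, neg_zero, add_zero, zero_add] at hW
  rw [← hW]
  ring

/-- The real solution of `u'' = (q + t f) u` with `u(0) = sin θ`, `u'(0) = cos θ`. -/
def sol (t θ x : ℝ) : ℝ := (extend (cSol hq hf (Real.sin θ : ℂ) (Real.cos θ : ℂ) t) x).re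

/-- The derivative of `sol`. -/
def solDeriv (t θ x : ℝ) : ℝ :=
  (extend (cSolDeriv hq hf (Real.sin θ : ℂ) (Real.cos θ : ℂ) t) x).re

theorem ofReal_sol (t θ x : ℝ) :
    (sol hq hf t θ x : ℂ) = extend (cSol hq hf (Real.sin θ : ℂ) (Real.cos θ : ℂ) t) x := by
  have := DFunLike.congr_fun (star_cSol hq hf (Real.sin θ) (Real.cos θ) t)
    (projIcc (-1) 0 (by norm_num) x)
  exact Complex.conj_eq_iff_re.1 this

theorem ofReal_solDeriv (t θ x : ℝ) :
    (solDeriv hq hf t θ x : ℂ) =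
      extend (cSolDeriv hq hf (Real.sin θ : ℂ) (Real.cos θ : ℂ) t) x := by
  have := DFunLike.congr_fun (star_cSolDeriv hq hf (Real.sin θ) (Real.cos θ) t)
    (projIcc (-1) 0 (by norm_num) x)
  exact Complex.conj_eq_iff_re.1 this

theorem isPrim_sol (t θ : ℝ) : IsPrim (sol hq hf t θ) (solDeriv hq hf t θ) :=
  (isPrim_cSol hq hf _ _ _).re

theorem isPrim_solDeriv (t θ : ℝ) :
    IsPrim (solDeriv hq hf t θ) (fun x => (q x + t * f x) * sol hq hf t θ x) :=
  (isPrim_cSolDeriv hq hf _ _ _).re.congr (.of_forall fun x _ => by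
    rw [← ofReal_sol]
    norm_cast)

theorem sol_zero (t θ : ℝ) : sol hq hf t θ 0 = Real.sin θ := by
  rw [sol, extend_of_mem _ (by norm_num), cSol_zero, Complex.ofReal_re]

theorem solDeriv_zero (t θ : ℝ) : solDeriv hq hf t θ 0 = Real.cos θ := by
  rw [solDeriv, extend_of_mem _ (by norm_num), cSolDeriv_zero, Complex.ofReal_re]

theorem isSolution_sol (t θ : ℝ) : IsSolution (fun x => q x + t * f x) 0 θ
    (fun x => (sol hq hf t θ x, solDeriv hq hf t θ x)) where
  continuousOn := (isPrim_sol hq hf t θ).continuousOn.prodMk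
    (isPrim_solDeriv hq hf t θ).continuousOn
  init := by rw [sol_zero, solDeriv_zero]
  fst_eq := (isPrim_sol hq hf t θ).eq
  snd_eq := (isPrim_solDeriv hq hf t θ).eq

/-- Uniqueness: every solution in the integrated sense is a fixed point of the Volterra equation. -/
theorem IsSolution.eq_sol {t θ : ℝ} {y : ℝ → ℝ × ℝ}
    (hy : IsSolution (fun x => q x + t * f x) 0 θ y) {x : ℝ} (hx : x ∈ Icc (-1 : ℝ) 0) :
    y x = (sol hq hf t θ x, solDeriv hq hf t θ x) := by
  have hc1 : ContinuousOn (fun x => (y x).1) (Icc (-1) 0) :=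
    continuous_fst.comp_continuousOn hy.continuousOn
  have hc2 : ContinuousOn (fun x => (y x).2) (Icc (-1) 0) :=
    continuous_snd.comp_continuousOn hy.continuousOn
  let u : C(Icc (-1 : ℝ) 0, ℂ) := ⟨fun x => ((y x).1 : ℂ),
    Complex.continuous_ofReal.comp hc1.domRestrict⟩
  let v : C(Icc (-1 : ℝ) 0, ℂ) := ⟨fun x => ((y x).2 : ℂ),
    Complex.continuous_ofReal.comp hc2.domRestrict⟩
  have hv : v = ContinuousMap.const _ (Real.cos θ : ℂ) + potOp hq hf t u := by
    ext x
    have h0 : (0 : ℝ) ∈ Icc (-1 : ℝ) 0 := by norm_num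
    have hP := (isPrim_potOp hq hf t u).eq x x.2
    rw [extend_of_mem _ x.2, extend_of_mem _ h0] at hP
    have hz : potOp hq hf t u ⟨0, h0⟩ = 0 := by simp [potOp, volterra_zero]
    rw [hz, zero_add] at hP
    change ((y x).2 : ℂ) = (Real.cos θ : ℂ) + potOp hq hf t u x
    rw [hP, hy.snd_eq x x.2, hy.init, Complex.ofReal_add, ← intervalIntegral.integral_ofReal]
    congr 1
    refine intervalIntegral.integral_congr fun s hs => ?_
    rw [uIcc_of_ge x.2.2] at hs
    have hs' : s ∈ Icc (-1 : ℝ) 0 := ⟨x.2.1.trans hs.1, hs.2⟩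
    simp only [extend_of_mem _ hs', u, ContinuousMap.coe_mk]
    push_cast; ring
  have hu : u = ContinuousMap.const _ (Real.sin θ : ℂ) + primOp v := by
    ext x
    change ((y x).1 : ℂ) = (Real.sin θ : ℂ) + primOp v x
    rw [primOp, volterra_apply, hy.fst_eq x x.2, hy.init, Complex.ofReal_add,
      ← intervalIntegral.integral_ofReal]
    congr 1
    refine intervalIntegral.integral_congr fun s hs => ?_
    rw [uIcc_of_ge x.2.2] at hs
    have hs' : s ∈ Icc (-1 : ℝ) 0 := ⟨x.2.1.trans hs.1, hs.2⟩
    simp only [IccExtend_of_mem _ _ hs', v, ContinuousMap.coe_mk, Complex.ofReal_one, one_mul]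
  have hu' : u = cSol hq hf (Real.sin θ : ℂ) (Real.cos θ : ℂ) t := by
    refine eq_inverse_of_fixed hq hf ?_
    have : primOp (ContinuousMap.const _ (Real.cos θ : ℂ)) = affine 0 (Real.cos θ : ℂ) := by
      ext x
      rw [primOp, volterra_apply]
      simp [IccExtend, affine, mul_comm]
    rw [hv, map_add, this] at hu
    nth_rewrite 1 [hu]
    ext x
    simp [affine]; ring
  have hv' : v = cSolDeriv hq hf (Real.sin θ : ℂ) (Real.cos θ : ℂ) t := by
    rw [hv, hu', cSolDeriv]
  refine Prod.ext ?_ ?_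
  · have := congrArg (fun h : C(Icc (-1 : ℝ) 0, ℂ) => (h ⟨x, hx⟩).re) hu'
    rw [sol, extend_of_mem _ hx, ← this]
    exact (Complex.ofReal_re _).symm
  · have := congrArg (fun h : C(Icc (-1 : ℝ) 0, ℂ) => (h ⟨x, hx⟩).re) hv'
    rw [solDeriv, extend_of_mem _ hx, ← this]
    exact (Complex.ofReal_re _).symm

theorem solution_eq (t θ : ℝ) {x : ℝ} (hx : x ∈ Icc (-1 : ℝ) 0) :
    solution (fun x => q x + t * f x) 0 θ x = (sol hq hf t θ x, solDeriv hq hf t θ x) :=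
  (Classical.epsilon_spec ⟨_, isSolution_sol hq hf t θ⟩ :
    IsSolution _ 0 θ (solution (fun x => q x + t * f x) 0 θ)).eq_sol hq hf hx

end

/-! ### Prüfer amplitude and phase -/

section

variable {q f : ℝ → ℝ} {K F : ℝ} (hq : IsBddCoeff q K) (hf : IsBddCoeff f F)

/-- The square `u² + u'²` of the Prüfer amplitude. -/
def ampSq (t θ x : ℝ) : ℝ := sol hq hf t θ x ^ 2 + solDeriv hq hf t θ x ^ 2

/-- The solution with initial angle `θ + π/2` has Wronskian `1` with that of initial angle `θ`. -/
theorem wronskian_eq_one (t θ : ℝ) {x : ℝ} (hx : x ∈ Icc (-1 : ℝ) 0) :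
    solDeriv hq hf t θ x * sol hq hf t (θ + Real.pi / 2) x -
      solDeriv hq hf t (θ + Real.pi / 2) x * sol hq hf t θ x = 1 := by
  have h := (IsPrim.wronskian (isPrim_sol hq hf t θ) (isPrim_solDeriv hq hf t θ)
    (isPrim_sol hq hf t (θ + Real.pi / 2)) (isPrim_solDeriv hq hf t (θ + Real.pi / 2))).congr
      (b := fun _ => 0) (.of_forall fun s _ => by ring)
  have := h.eq x hx
  simp only [sol_zero, solDeriv_zero, Real.sin_add_pi_div_two, Real.cos_add_pi_div_two,
    intervalIntegral.integral_zero] at this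
  nlinarith [Real.sin_sq_add_cos_sq θ]

theorem ampSq_pos (t θ : ℝ) {x : ℝ} (hx : x ∈ Icc (-1 : ℝ) 0) : 0 < ampSq hq hf t θ x := by
  have h := wronskian_eq_one hq hf t θ hx
  rw [ampSq]
  rcases eq_or_ne (sol hq hf t θ x) 0 with h1 | h1
  · rcases eq_or_ne (solDeriv hq hf t θ x) 0 with h2 | h2
    · simp [h1, h2] at h
    · positivity
  · positivity

/-- The derivative `(u'² - (q + t f) u²) / (u² + u'²)` of the Prüfer phase. -/
def phaseDeriv (t θ x : ℝ) : ℝ :=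
  (solDeriv hq hf t θ x ^ 2 - (q x + t * f x) * sol hq hf t θ x ^ 2) / ampSq hq hf t θ x

/-- The Prüfer phase as an integral of its derivative. -/
def angle (t θ x : ℝ) : ℝ := θ + ∫ s in (0 : ℝ)..x, phaseDeriv hq hf t θ s

theorem coeff_bound {q f : ℝ → ℝ} {K F : ℝ} (hq : IsBddCoeff q K) (hf : IsBddCoeff f F) (t : ℝ) :
    IsBddCoeff (fun x => q x + t * f x) (K + |t| * F) := by
  refine ⟨add_nonneg hq.nonneg (mul_nonneg (abs_nonneg _) hf.nonneg),
    hq.intervalIntegrable.add (hf.intervalIntegrable.const_mul t), ?_⟩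
  filter_upwards [hq.bound, hf.bound] with x h1 h2 hx
  refine (abs_add_le _ _).trans (add_le_add (h1 hx) ?_)
  rw [abs_mul]
  exact mul_le_mul_of_nonneg_left (h2 hx) (abs_nonneg _)

theorem continuousOn_sol (t θ : ℝ) : ContinuousOn (sol hq hf t θ) (Icc (-1) 0) :=
  (isPrim_sol hq hf t θ).continuousOn

theorem continuousOn_solDeriv (t θ : ℝ) : ContinuousOn (solDeriv hq hf t θ) (Icc (-1) 0) :=
  (isPrim_solDeriv hq hf t θ).continuousOn

theorem continuousOn_ampSq (t θ : ℝ) : ContinuousOn (ampSq hq hf t θ) (Icc (-1) 0) :=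
  ((continuousOn_sol hq hf t θ).pow 2).add ((continuousOn_solDeriv hq hf t θ).pow 2)

theorem isBddCoeff_phaseDeriv (t θ : ℝ) :
    IsBddCoeff (phaseDeriv hq hf t θ) (1 + (K + |t| * F)) := by
  have hc := coeff_bound hq hf t
  have h1 : ∀ x ∈ Icc (-1 : ℝ) 0, ampSq hq hf t θ x ≠ 0 := fun x hx => (ampSq_pos hq hf t θ hx).ne'
  refine ⟨by linarith [hc.nonneg], ?_, ?_⟩
  · have hA : ContinuousOn (fun x => solDeriv hq hf t θ x ^ 2 / ampSq hq hf t θ x) (Icc (-1) 0) :=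
      ((continuousOn_solDeriv hq hf t θ).pow 2).div (continuousOn_ampSq hq hf t θ) h1
    have hB : ContinuousOn (fun x => sol hq hf t θ x ^ 2 / ampSq hq hf t θ x) (Icc (-1) 0) :=
      ((continuousOn_sol hq hf t θ).pow 2).div (continuousOn_ampSq hq hf t θ) h1
    rw [← uIcc_of_le (by norm_num : (-1 : ℝ) ≤ 0)] at hA hB
    refine (hA.intervalIntegrable.sub (hc.intervalIntegrable.mul_continuousOn hB)).congr ?_
    intro x _
    simp only [phaseDeriv]
    ring
  · filter_upwards [hc.bound] with x hx hxm
    have hpos := ampSq_pos hq hf t θ (Ioc_subset_Icc_self hxm)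
    rw [phaseDeriv, abs_div, abs_of_pos hpos, div_le_iff₀ hpos]
    have h2 := hx hxm
    calc _ ≤ |solDeriv hq hf t θ x ^ 2| + |(q x + t * f x) * sol hq hf t θ x ^ 2| := abs_sub _ _
      _ = solDeriv hq hf t θ x ^ 2 + |q x + t * f x| * sol hq hf t θ x ^ 2 := by
          rw [abs_mul, abs_of_nonneg (sq_nonneg (solDeriv hq hf t θ x)),
            abs_of_nonneg (sq_nonneg (sol hq hf t θ x))]
      _ ≤ solDeriv hq hf t θ x ^ 2 + (K + |t| * F) * sol hq hf t θ x ^ 2 := by gcongr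
      _ ≤ _ := by
          rw [ampSq]
          nlinarith [hc.nonneg, sq_nonneg (solDeriv hq hf t θ x), sq_nonneg (sol hq hf t θ x),
            mul_nonneg hc.nonneg (sq_nonneg (solDeriv hq hf t θ x))]

theorem isPrim_angle (t θ : ℝ) : IsPrim (angle hq hf t θ) (phaseDeriv hq hf t θ) where
  intervalIntegrable := (isBddCoeff_phaseDeriv hq hf t θ).intervalIntegrable
  bound := ⟨_, (isBddCoeff_phaseDeriv hq hf t θ).nonneg, (isBddCoeff_phaseDeriv hq hf t θ).bound⟩
  eq := fun x _ => by simp [angle]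

theorem angle_zero (t θ : ℝ) : angle hq hf t θ 0 = θ := by simp [angle]

theorem abs_angle_sub_le (t θ : ℝ) {x : ℝ} (hx : x ∈ Icc (-1 : ℝ) 0) :
    |angle hq hf t θ x - θ| ≤ 1 + (K + |t| * F) := by
  have hb := isBddCoeff_phaseDeriv hq hf t θ
  rw [angle, add_sub_cancel_left, ← Real.norm_eq_abs]
  refine (intervalIntegral.norm_integral_le_of_norm_le_const_ae (C := 1 + (K + |t| * F)) ?_).trans ?_
  · filter_upwards [hb.bound] with s hs hsx
    rw [uIoc_of_ge hx.2] at hsx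
    exact hs ⟨hx.1.trans_lt hsx.1, hsx.2⟩
  · refine mul_le_of_le_one_right hb.nonneg ?_
    rw [abs_le]
    constructor <;> linarith [hx.1, hx.2]

/-- The component of `(u, u')` orthogonal to the direction `(sin φ, cos φ)` solves a homogeneous
linear equation and vanishes at `0`. -/
theorem sol_mul_cos_eq (t θ : ℝ) {x : ℝ} (hx : x ∈ Icc (-1 : ℝ) 0) :
    sol hq hf t θ x * Real.cos (angle hq hf t θ x) =
      solDeriv hq hf t θ x * Real.sin (angle hq hf t θ x) := by
  have hc := coeff_bound hq hf t
  have h1 : ∀ x ∈ Icc (-1 : ℝ) 0, ampSq hq hf t θ x ≠ 0 := fun x hx => (ampSq_pos hq hf t θ hx).ne'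
  set κ : ℝ → ℝ := fun x => (1 + (q x + t * f x)) *
    (sol hq hf t θ x * solDeriv hq hf t θ x / ampSq hq hf t θ x) with hκ
  have hκb : IsBddCoeff κ (1 + (K + |t| * F)) := by
    have hA : ContinuousOn (fun x => sol hq hf t θ x * solDeriv hq hf t θ x / ampSq hq hf t θ x)
        (Icc (-1) 0) :=
      ((continuousOn_sol hq hf t θ).mul (continuousOn_solDeriv hq hf t θ)).div
        (continuousOn_ampSq hq hf t θ) h1
    rw [← uIcc_of_le (by norm_num : (-1 : ℝ) ≤ 0)] at hA
    refine ⟨by linarith [hc.nonneg],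
      (intervalIntegrable_const.add hc.intervalIntegrable).mul_continuousOn hA, ?_⟩
    filter_upwards [hc.bound] with x hx hxm
    have hpos := ampSq_pos hq hf t θ (Ioc_subset_Icc_self hxm)
    rw [hκ]
    simp only
    rw [abs_mul]
    have h3 : |sol hq hf t θ x * solDeriv hq hf t θ x / ampSq hq hf t θ x| ≤ 1 := by
      rw [abs_div, abs_of_pos hpos, div_le_one hpos, ampSq, abs_le]
      constructor <;> nlinarith [sq_nonneg (sol hq hf t θ x + solDeriv hq hf t θ x),
        sq_nonneg (sol hq hf t θ x - solDeriv hq hf t θ x)]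
    calc _ ≤ (1 + |q x + t * f x|) * 1 := by
          gcongr
          exact (abs_add_le _ _).trans (by simp)
      _ ≤ _ := by linarith [hx hxm]
  have hζ := isPrim_angle hq hf t θ
  have hn := ((isPrim_sol hq hf t θ).mul hζ.cos).add ((isPrim_solDeriv hq hf t θ).mul hζ.sin).neg
  have hz := (hn.congr (b := fun x => κ x * (sol hq hf t θ x * Real.cos (angle hq hf t θ x) +
      -(solDeriv hq hf t θ x * Real.sin (angle hq hf t θ x)))) (.of_forall fun x hxm => by
    have hne := h1 x (Ioc_subset_Icc_self hxm)
    simp only [hκ, phaseDeriv]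
    field_simp
    rw [ampSq]
    ring)).eq_zero hκb (by
      rw [sol_zero, solDeriv_zero, angle_zero]; ring) x hx
  linarith

/-- `angle` is indeed a Prüfer phase. -/
theorem sol_eq_sqrt_mul (t θ : ℝ) {x : ℝ} (hx : x ∈ Icc (-1 : ℝ) 0) :
    sol hq hf t θ x = √(ampSq hq hf t θ x) * Real.sin (angle hq hf t θ x) ∧
    solDeriv hq hf t θ x = √(ampSq hq hf t θ x) * Real.cos (angle hq hf t θ x) := by
  -- `H` is the component of `(u, u')` along `(sin φ, cos φ)`; it is continuous, has no zeros,
  -- and equals `1` at `0`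
  set H : ℝ → ℝ := fun x => sol hq hf t θ x * Real.sin (angle hq hf t θ x) +
    solDeriv hq hf t θ x * Real.cos (angle hq hf t θ x) with hH
  have hcont : ContinuousOn H (Icc (-1) 0) :=
    ((continuousOn_sol hq hf t θ).mul
      (Real.continuous_sin.comp_continuousOn (isPrim_angle hq hf t θ).continuousOn)).add
    ((continuousOn_solDeriv hq hf t θ).mul
      (Real.continuous_cos.comp_continuousOn (isPrim_angle hq hf t θ).continuousOn))
  have e1 : ∀ y ∈ Icc (-1 : ℝ) 0, sol hq hf t θ y = H y * Real.sin (angle hq hf t θ y) := by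
    intro y hy
    have h := sol_mul_cos_eq hq hf t θ hy
    simp only [hH]
    linear_combination (-sol hq hf t θ y) * Real.sin_sq_add_cos_sq (angle hq hf t θ y) +
      Real.cos (angle hq hf t θ y) * h
  have e2 : ∀ y ∈ Icc (-1 : ℝ) 0, solDeriv hq hf t θ y = H y * Real.cos (angle hq hf t θ y) := by
    intro y hy
    have h := sol_mul_cos_eq hq hf t θ hy
    simp only [hH]
    linear_combination (-solDeriv hq hf t θ y) * Real.sin_sq_add_cos_sq (angle hq hf t θ y) -
      Real.sin (angle hq hf t θ y) * h
  have e3 : ∀ y ∈ Icc (-1 : ℝ) 0, ampSq hq hf t θ y = H y ^ 2 := by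
    intro y hy
    rw [ampSq, e1 y hy, e2 y hy]
    linear_combination H y ^ 2 * Real.sin_sq_add_cos_sq (angle hq hf t θ y)
  have h0m : (0 : ℝ) ∈ Icc (-1 : ℝ) 0 := by norm_num
  have hH0 : H 0 = 1 := by
    simp only [hH, sol_zero, solDeriv_zero, angle_zero]
    linear_combination Real.sin_sq_add_cos_sq θ
  have hpos : 0 < H x := by
    by_contra hneg
    push Not at hneg
    have := isPreconnected_Icc.intermediate_value hx h0m hcont
    obtain ⟨y, hy, hy0⟩ := this ⟨hneg, hH0.symm ▸ zero_le_one⟩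
    have := ampSq_pos hq hf t θ hy
    rw [e3 y hy, hy0] at this
    simp at this
  rw [e3 x hx, Real.sqrt_sq hpos.le]
  exact ⟨e1 x hx, e2 x hx⟩

theorem amplitude_eq (t θ : ℝ) {x : ℝ} (hx : x ∈ Icc (-1 : ℝ) 0) :
    amplitude (fun x => q x + t * f x) 0 θ x = √(ampSq hq hf t θ x) := by
  rw [amplitude, solution_eq hq hf t θ hx, ampSq]

theorem isPhase_angle (t θ : ℝ) :
    IsPhase (fun x => q x + t * f x) 0 θ (angle hq hf t θ) where
  continuousOn := (isPrim_angle hq hf t θ).continuousOn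
  init := angle_zero hq hf t θ
  fst_eq := fun x hx => by
    rw [solution_eq hq hf t θ hx, amplitude_eq hq hf t θ hx]
    exact (sol_eq_sqrt_mul hq hf t θ hx).1
  snd_eq := fun x hx => by
    rw [solution_eq hq hf t θ hx, amplitude_eq hq hf t θ hx]
    exact (sol_eq_sqrt_mul hq hf t θ hx).2

/-- Two continuous functions with the same sine and cosine that agree at one point agree. -/
theorem eqOn_of_sin_cos {s : Set ℝ} (hs : IsPreconnected s) {φ ψ : ℝ → ℝ} (hφ : ContinuousOn φ s)
    (hψ : ContinuousOn ψ s) (hsin : ∀ x ∈ s, Real.sin (φ x) = Real.sin (ψ x))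
    (hcos : ∀ x ∈ s, Real.cos (φ x) = Real.cos (ψ x)) {x₀ : ℝ} (hx₀ : x₀ ∈ s)
    (h₀ : φ x₀ = ψ x₀) : ∀ x ∈ s, φ x = ψ x := by
  have key : ∀ x ∈ s, Real.cos (φ x - ψ x) = 1 := fun x hx => by
    rw [Real.cos_sub, hsin x hx, hcos x hx]
    linear_combination Real.sin_sq_add_cos_sq (ψ x)
  intro x hx
  by_contra hne
  -- otherwise the difference takes a value in `(0, π)` or `(-π, 0)`
  obtain ⟨y, hy, hy1⟩ : ∃ y ∈ s, |φ y - ψ y| = min |φ x - ψ x| 1 := by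
    refine hs.intermediate_value hx₀ hx (hφ.sub hψ).abs ⟨?_, min_le_left _ _⟩
    rw [Pi.sub_apply, h₀, sub_self, abs_zero]
    positivity
  have hlt : 0 < |φ y - ψ y| := by
    rw [hy1]; exact lt_min (abs_pos.mpr (sub_ne_zero.mpr hne)) one_pos
  have hle : |φ y - ψ y| ≤ 1 := hy1 ▸ min_le_right _ _
  have := key y hy
  rw [← Real.cos_abs] at this
  have h2 := Real.cos_lt_cos_of_nonneg_of_le_pi (le_refl (0 : ℝ)) (hle.trans (by
    linarith [Real.pi_gt_three])) hlt
  rw [Real.cos_zero] at h2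
  linarith

theorem phase_eq (t θ : ℝ) {x : ℝ} (hx : x ∈ Icc (-1 : ℝ) 0) :
    phase (fun x => q x + t * f x) 0 θ x = angle hq hf t θ x := by
  have h := (Classical.epsilon_spec ⟨_, isPhase_angle hq hf t θ⟩ :
    IsPhase (fun x => q x + t * f x) 0 θ (phase (fun x => q x + t * f x) 0 θ))
  have h' := isPhase_angle hq hf t θ
  have hne : ∀ y ∈ Icc (-1 : ℝ) 0, amplitude (fun x => q x + t * f x) 0 θ y ≠ 0 := fun y hy => by
    rw [amplitude_eq hq hf t θ hy]
    exact (Real.sqrt_pos.2 (ampSq_pos hq hf t θ hy)).ne'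
  exact eqOn_of_sin_cos isPreconnected_Icc h.continuousOn h'.continuousOn
    (fun y hy => mul_left_cancel₀ (hne y hy) ((h.fst_eq y hy).symm.trans (h'.fst_eq y hy)))
    (fun y hy => mul_left_cancel₀ (hne y hy) ((h.snd_eq y hy).symm.trans (h'.snd_eq y hy)))
    (by norm_num : (0 : ℝ) ∈ Icc (-1 : ℝ) 0) (h.init.trans h'.init.symm) x hx

end

/-! ### Dependence of the Prüfer variables on the initial phase and the coupling -/

/-- A continuous angle of a differentiable curve `ρ (sin φ, cos φ)` in the plane that avoids the
origin is differentiable: near `x` it is `φ x` plus the arctangent of the slope of the curve in the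
frame given by its direction at `x`. -/
theorem hasDerivAt_of_continuousAt_angle {φ ρ s c : ℝ → ℝ} {s' c' x : ℝ} (hφ : ContinuousAt φ x)
    (hρ : ∀ y, 0 < ρ y) (hs : ∀ y, s y = ρ y * Real.sin (φ y))
    (hc : ∀ y, c y = ρ y * Real.cos (φ y)) (hs' : HasDerivAt s s' x) (hc' : HasDerivAt c c' x) :
    HasDerivAt φ ((s' * c x - s x * c') / ρ x ^ 2) x := by
  have hN : HasDerivAt (fun y => s y * c x - c y * s x) (s' * c x - c' * s x) x :=
    (hs'.mul_const _).sub (hc'.mul_const _)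
  have hD : HasDerivAt (fun y => c y * c x + s y * s x) (c' * c x + s' * s x) x :=
    (hc'.mul_const _).add (hs'.mul_const _)
  have hDx : c x * c x + s x * s x = ρ x ^ 2 := by
    rw [hs, hc]
    linear_combination ρ x ^ 2 * Real.sin_sq_add_cos_sq (φ x)
  have hρ2 : ρ x ^ 2 ≠ 0 := (pow_pos (hρ x) 2).ne'
  have h := ((hN.div hD (by rw [hDx]; exact hρ2)).arctan).const_add (φ x)
  have he : (fun y => φ x + Real.arctan ((s y * c x - c y * s x) / (c y * c x + s y * s x)))
      =ᶠ[nhds x] φ := by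
    have h1 : ∀ᶠ y in nhds x, φ y - φ x ∈ Ioo (-(Real.pi / 2)) (Real.pi / 2) := by
      have : ContinuousAt (fun y => φ y - φ x) x := hφ.sub continuousAt_const
      refine this.eventually_mem (Ioo_mem_nhds ?_ ?_) <;> rw [sub_self] <;> linarith [Real.pi_pos]
    filter_upwards [h1] with y hy
    have e1 : s y * c x - c y * s x = ρ y * ρ x * Real.sin (φ y - φ x) := by
      rw [hs, hc, hs, hc, Real.sin_sub]; ring
    have e2 : c y * c x + s y * s x = ρ y * ρ x * Real.cos (φ y - φ x) := by
      rw [hs, hc, hs, hc, Real.cos_sub]; ring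
    rw [e1, e2, mul_div_mul_left _ _ (mul_pos (hρ y) (hρ x)).ne', ← Real.tan_eq_sin_div_cos,
      Real.arctan_tan hy.1 hy.2]
    ring
  refine (h.congr_of_eventuallyEq he.symm).congr_deriv ?_
  have e0 : s x * c x - c x * s x = 0 := by ring
  simp only [Pi.div_apply, e0, hDx, zero_div]
  have := (hρ x).ne'
  field_simp
  ring

section

variable {q f : ℝ → ℝ} {K F : ℝ} (hq : IsBddCoeff q K) (hf : IsBddCoeff f F)

theorem cSol_combination (t θ : ℝ) :
    cSol hq hf (Real.sin θ : ℂ) (Real.cos θ : ℂ) t =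
      (Real.sin θ : ℂ) • cSol hq hf 1 0 t + (Real.cos θ : ℂ) • cSol hq hf 0 1 t := by
  rw [← cSol_add_smul]; simp

theorem cSolDeriv_combination (t θ : ℝ) :
    cSolDeriv hq hf (Real.sin θ : ℂ) (Real.cos θ : ℂ) t =
      (Real.sin θ : ℂ) • cSolDeriv hq hf 1 0 t + (Real.cos θ : ℂ) • cSolDeriv hq hf 0 1 t := by
  rw [← cSolDeriv_add_smul]; simp

theorem continuous_cSol_param : Continuous fun y : ℝ × ℝ =>
    cSol hq hf (Real.sin y.2 : ℂ) (Real.cos y.2 : ℂ) y.1 := by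
  have h1 := (differentiable_cSol hq hf 1 0).continuous
  have h2 := (differentiable_cSol hq hf 0 1).continuous
  simp only [cSol_combination]
  fun_prop

theorem continuous_cSolDeriv_param : Continuous fun y : ℝ × ℝ =>
    cSolDeriv hq hf (Real.sin y.2 : ℂ) (Real.cos y.2 : ℂ) y.1 := by
  have h1 := (differentiable_cSolDeriv hq hf 1 0).continuous
  have h2 := (differentiable_cSolDeriv hq hf 0 1).continuous
  simp only [cSolDeriv_combination]
  fun_prop

theorem continuous_sol_param (x : ℝ) : Continuous fun y : ℝ × ℝ => sol hq hf y.1 y.2 x :=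
  Complex.continuous_re.comp ((continuous_eval_const (F := C(Icc (-1 : ℝ) 0, ℂ)) _).comp
    (continuous_cSol_param hq hf))

theorem continuous_solDeriv_param (x : ℝ) :
    Continuous fun y : ℝ × ℝ => solDeriv hq hf y.1 y.2 x :=
  Complex.continuous_re.comp ((continuous_eval_const (F := C(Icc (-1 : ℝ) 0, ℂ)) _).comp
    (continuous_cSolDeriv_param hq hf))

theorem continuous_ampSq_param (x : ℝ) : Continuous fun y : ℝ × ℝ => ampSq hq hf y.1 y.2 x :=
  ((continuous_sol_param hq hf x).pow 2).add ((continuous_solDeriv_param hq hf x).pow 2)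

theorem continuous_angle_param {x : ℝ} (hx : x ∈ Icc (-1 : ℝ) 0) :
    Continuous fun y : ℝ × ℝ => angle hq hf y.1 y.2 x := by
  unfold angle
  refine continuous_snd.add (continuous_iff_continuousAt.2 fun y₀ => ?_)
  have hsub : ∀ s ∈ uIoc (0 : ℝ) x, s ∈ Ioc (-1 : ℝ) 0 := fun s hs => by
    rw [uIoc_of_ge hx.2] at hs
    exact ⟨hx.1.trans_lt hs.1, hs.2⟩
  refine intervalIntegral.continuousAt_of_dominated_interval
    (bound := fun _ => 1 + (K + (|y₀.1| + 1) * F)) ?_ ?_ intervalIntegrable_const ?_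
  · refine .of_forall fun y => ?_
    have h0 : (0 : ℝ) ∈ Icc (-1 : ℝ) 0 := by norm_num
    exact ((isPrim_angle hq hf y.1 y.2).intervalIntegrable_of_mem h0
      hx).aestronglyMeasurable_restrict_uIoc
  · have : ∀ᶠ y : ℝ × ℝ in nhds y₀, |y.1| < |y₀.1| + 1 :=
      (continuous_fst.abs.continuousAt).eventually_lt continuousAt_const (by simp)
    filter_upwards [this] with y hy
    filter_upwards [(isBddCoeff_phaseDeriv hq hf y.1 y.2).bound] with s hs hsx
    refine (hs (hsub s hsx)).trans ?_
    have := hf.nonneg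
    gcongr
  · refine .of_forall fun s hs => ContinuousAt.div ?_ (continuous_ampSq_param hq hf s).continuousAt
      (ampSq_pos hq hf _ _ (Ioc_subset_Icc_self (hsub s hs))).ne'
    have h1 := continuous_sol_param hq hf s
    have h2 := continuous_solDeriv_param hq hf s
    fun_prop

theorem sol_add_two_pi (t θ x : ℝ) : sol hq hf t (θ + 2 * Real.pi) x = sol hq hf t θ x := by
  rw [sol, sol, Real.sin_add_two_pi, Real.cos_add_two_pi]

theorem solDeriv_add_two_pi (t θ x : ℝ) :
    solDeriv hq hf t (θ + 2 * Real.pi) x = solDeriv hq hf t θ x := by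
  rw [solDeriv, solDeriv, Real.sin_add_two_pi, Real.cos_add_two_pi]

theorem ampSq_add_two_pi (t θ x : ℝ) : ampSq hq hf t (θ + 2 * Real.pi) x = ampSq hq hf t θ x := by
  rw [ampSq, ampSq, sol_add_two_pi, solDeriv_add_two_pi]

theorem angle_add_two_pi (t θ x : ℝ) :
    angle hq hf t (θ + 2 * Real.pi) x = angle hq hf t θ x + 2 * Real.pi := by
  simp only [angle, phaseDeriv, ampSq_add_two_pi, sol_add_two_pi, solDeriv_add_two_pi]
  ring

theorem sol_combination (t θ x : ℝ) : sol hq hf t θ x =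
    Real.sin θ * sol hq hf t (Real.pi / 2) x + Real.cos θ * sol hq hf t 0 x := by
  simp only [sol, extend, IccExtend, Function.comp]
  rw [cSol_combination]
  simp only [ContinuousMap.add_apply, ContinuousMap.smul_apply, smul_eq_mul, Complex.add_re,
    Complex.re_ofReal_mul]
  simp

theorem solDeriv_combination (t θ x : ℝ) : solDeriv hq hf t θ x =
    Real.sin θ * solDeriv hq hf t (Real.pi / 2) x + Real.cos θ * solDeriv hq hf t 0 x := by
  simp only [solDeriv, extend, IccExtend, Function.comp]
  rw [cSolDeriv_combination]
  simp only [ContinuousMap.add_apply, ContinuousMap.smul_apply, smul_eq_mul, Complex.add_re,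
    Complex.re_ofReal_mul]
  simp

theorem hasDerivAt_sol_angle (t θ x : ℝ) :
    HasDerivAt (fun θ => sol hq hf t θ x) (sol hq hf t (θ + Real.pi / 2) x) θ := by
  rw [sol_combination hq hf t (θ + Real.pi / 2), Real.sin_add_pi_div_two, Real.cos_add_pi_div_two]
  rw [funext fun θ => sol_combination hq hf t θ x]
  have := ((Real.hasDerivAt_sin θ).mul_const (sol hq hf t (Real.pi / 2) x)).add
    ((Real.hasDerivAt_cos θ).mul_const (sol hq hf t 0 x))
  exact this

theorem hasDerivAt_solDeriv_angle (t θ x : ℝ) :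
    HasDerivAt (fun θ => solDeriv hq hf t θ x) (solDeriv hq hf t (θ + Real.pi / 2) x) θ := by
  rw [solDeriv_combination hq hf t (θ + Real.pi / 2), Real.sin_add_pi_div_two,
    Real.cos_add_pi_div_two]
  rw [funext fun θ => solDeriv_combination hq hf t θ x]
  have := ((Real.hasDerivAt_sin θ).mul_const (solDeriv hq hf t (Real.pi / 2) x)).add
    ((Real.hasDerivAt_cos θ).mul_const (solDeriv hq hf t 0 x))
  exact this

/-- The integral `∫ f u²` over `[-1,0]`. -/
def potEnergy (t θ : ℝ) : ℝ := ∫ x in (-1 : ℝ)..0, f x * sol hq hf t θ x ^ 2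

theorem hasDerivAt_eval {G : ℂ → C(Icc (-1 : ℝ) 0, ℂ)} (hG : Differentiable ℂ G) (t : ℝ)
    (x : Icc (-1 : ℝ) 0) :
    HasDerivAt (fun t : ℝ => (G t x).re) (deriv G t x).re t := by
  have h1 : HasDerivAt (fun z : ℂ => G z x) (deriv G t x) (t : ℂ) :=
    ((ContinuousMap.evalCLM ℂ x : C(Icc (-1 : ℝ) 0, ℂ) →L[ℂ] ℂ).hasFDerivAt
      (x := G t)).comp_hasDerivAt (t : ℂ) (hG t).hasDerivAt
  exact h1.real_of_complex

/-- By the Wronskian, the phase is increasing in the initial phase, with derivative `R⁻²`. -/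
theorem hasDerivAt_angle_angle (t θ : ℝ) :
    HasDerivAt (fun θ => angle hq hf t θ (-1)) (1 / ampSq hq hf t θ (-1)) θ := by
  have hm : (-1 : ℝ) ∈ Icc (-1 : ℝ) 0 := by norm_num
  have hcont : Continuous fun θ => angle hq hf t θ (-1) :=
    (continuous_angle_param hq hf hm).comp (Continuous.prodMk_right t)
  refine (hasDerivAt_of_continuousAt_angle hcont.continuousAt
    (fun y => Real.sqrt_pos.2 (ampSq_pos hq hf t y hm))
    (fun y => (sol_eq_sqrt_mul hq hf t y hm).1) (fun y => (sol_eq_sqrt_mul hq hf t y hm).2)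
    (hasDerivAt_sol_angle hq hf t θ (-1)) (hasDerivAt_solDeriv_angle hq hf t θ (-1))).congr_deriv ?_
  rw [Real.sq_sqrt (ampSq_pos hq hf t θ hm).le]
  congr 1
  linarith [wronskian_eq_one hq hf t θ hm]

/-- Derivatives of `(u(-1), u'(-1))` with respect to the coupling, with their Wronskian. -/
theorem exists_hasDerivAt_coupling (t θ : ℝ) : ∃ s' c' : ℝ,
    HasDerivAt (fun t => sol hq hf t θ (-1)) s' t ∧
    HasDerivAt (fun t => solDeriv hq hf t θ (-1)) c' t ∧
    s' * solDeriv hq hf t θ (-1) - sol hq hf t θ (-1) * c' = potEnergy hq hf t θ := by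
  have hm : (-1 : ℝ) ∈ Icc (-1 : ℝ) 0 := by norm_num
  set a : ℂ := (Real.sin θ : ℂ)
  set b : ℂ := (Real.cos θ : ℂ)
  have h1 : HasDerivAt (fun t => sol hq hf t θ (-1)) (deriv (cSol hq hf a b) t ⟨-1, hm⟩).re t := by
    have := hasDerivAt_eval (differentiable_cSol hq hf a b) t ⟨-1, hm⟩
    simpa only [sol, extend_of_mem _ hm] using this
  have h2 : HasDerivAt (fun t => solDeriv hq hf t θ (-1))
      (deriv (cSolDeriv hq hf a b) t ⟨-1, hm⟩).re t := by
    have := hasDerivAt_eval (differentiable_cSolDeriv hq hf a b) t ⟨-1, hm⟩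
    simpa only [solDeriv, extend_of_mem _ hm] using this
  refine ⟨_, _, h1, h2, ?_⟩
  have hW := congrArg Complex.re (deriv_coupling_wronskian hq hf a b t)
  rw [← extend_of_mem (cSol hq hf a b t) hm, ← extend_of_mem (cSolDeriv hq hf a b t) hm,
    ← ofReal_sol, ← ofReal_solDeriv] at hW
  have hI : (∫ s in (-1 : ℝ)..0, (f s : ℂ) * extend (cSol hq hf a b t) s ^ 2)
      = (potEnergy hq hf t θ : ℂ) := by
    rw [potEnergy, ← intervalIntegral.integral_ofReal]
    congr 1 with s
    rw [← ofReal_sol]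
    push_cast; rfl
  rw [hI, Complex.sub_re, Complex.re_mul_ofReal, Complex.re_ofReal_mul, Complex.ofReal_re] at hW
  exact hW

/-- The phase at `-1` has derivative `R⁻² ∫ f u²` in the coupling. -/
theorem hasDerivAt_angle_coupling (t θ : ℝ) :
    HasDerivAt (fun t => angle hq hf t θ (-1))
      (potEnergy hq hf t θ / ampSq hq hf t θ (-1)) t := by
  have hm : (-1 : ℝ) ∈ Icc (-1 : ℝ) 0 := by norm_num
  obtain ⟨s', c', h1, h2, h3⟩ := exists_hasDerivAt_coupling hq hf t θ
  have hcont : Continuous fun t => angle hq hf t θ (-1) :=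
    (continuous_angle_param hq hf hm).comp (Continuous.prodMk_left θ)
  refine (hasDerivAt_of_continuousAt_angle hcont.continuousAt
    (fun y => Real.sqrt_pos.2 (ampSq_pos hq hf y θ hm))
    (fun y => (sol_eq_sqrt_mul hq hf y θ hm).1) (fun y => (sol_eq_sqrt_mul hq hf y θ hm).2)
    h1 h2).congr_deriv ?_
  rw [Real.sq_sqrt (ampSq_pos hq hf t θ hm).le, h3]

theorem continuous_potEnergy : Continuous fun y : ℝ × ℝ => potEnergy hq hf y.1 y.2 := by
  have hm : (-1 : ℝ) ∈ Icc (-1 : ℝ) 0 := by norm_num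
  have h : ∀ y : ℝ × ℝ, potEnergy hq hf y.1 y.2 = -(volterra f hf.intervalIntegrable
      (cSol hq hf (Real.sin y.2 : ℂ) (Real.cos y.2 : ℂ) y.1 ^ 2) ⟨-1, hm⟩).re := by
    intro y
    rw [volterra_apply, intervalIntegral.integral_symm, Complex.neg_re, neg_neg]
    have : (∫ s in (-1 : ℝ)..0, (f s : ℂ) * extend
        (cSol hq hf (Real.sin y.2 : ℂ) (Real.cos y.2 : ℂ) y.1 ^ 2) s)
        = (potEnergy hq hf y.1 y.2 : ℂ) := by
      rw [potEnergy, ← intervalIntegral.integral_ofReal]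
      congr 1 with s
      rw [Complex.ofReal_mul, Complex.ofReal_pow, ofReal_sol]
      rfl
    rw [this, Complex.ofReal_re]
  simp only [h]
  refine (Complex.continuous_re.comp ((continuous_eval_const (F := C(Icc (-1 : ℝ) 0, ℂ)) _).comp
    ((volterra f hf.intervalIntegrable).continuous.comp
      ((continuous_cSol_param hq hf).pow 2)))).neg

theorem potEnergy_add_two_pi (t θ : ℝ) :
    potEnergy hq hf t (θ + 2 * Real.pi) = potEnergy hq hf t θ := by
  simp only [potEnergy, sol_add_two_pi]

/-- A solution does not vanish identically on an interval on which `f` is bounded below. -/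
theorem potEnergy_pos {c a b : ℝ} (hc : 0 < c) (hab : a < b) (hI : Icc a b ⊆ Icc (-1) 0)
    (hlb : ∀ x, (Icc a b).indicator (fun _ => c) x ≤ f x) (t θ : ℝ) :
    0 < potEnergy hq hf t θ := by
  have hcs := continuousOn_sol hq hf t θ
  have ha : a ∈ Icc (-1 : ℝ) 0 := hI (left_mem_Icc.2 hab.le)
  have hb : b ∈ Icc (-1 : ℝ) 0 := hI (right_mem_Icc.2 hab.le)
  have hf0 : ∀ x, 0 ≤ f x := fun x => (indicator_nonneg (fun _ _ => hc.le) x).trans (hlb x)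
  obtain ⟨x₀, hx₀, hne⟩ : ∃ x ∈ Icc a b, sol hq hf t θ x ≠ 0 := by
    by_contra! hall
    -- then the derivative vanishes on the interval too, which contradicts `u² + u'² > 0`
    have hd : ∀ x ∈ Icc a b, solDeriv hq hf t θ x = 0 := by
      by_contra! hx
      obtain ⟨x, hx, hxne⟩ := hx
      have hU := isPrim_sol hq hf t θ
      have hcd : ContinuousOn (solDeriv hq hf t θ) (Icc a b) :=
        (continuousOn_solDeriv hq hf t θ).mono hI
      have hpos : 0 < ∫ y in a..b, solDeriv hq hf t θ y ^ 2 :=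
        intervalIntegral.integral_pos hab (hcd.pow 2) (fun y _ => sq_nonneg _)
          ⟨x, hx, by positivity⟩
      have hz := ((hU.mul (isPrim_solDeriv hq hf t θ)).sub_eq ha hb)
      simp only [hall a (left_mem_Icc.2 hab.le), hall b (right_mem_Icc.2 hab.le)] at hz
      rw [intervalIntegral.integral_congr (g := fun y => solDeriv hq hf t θ y ^ 2)] at hz
      · linarith
      · intro y hy
        rw [uIcc_of_le hab.le] at hy
        simp only [hall y hy]; ring
    have := ampSq_pos hq hf t θ ha
    rw [ampSq, hall a (left_mem_Icc.2 hab.le), hd a (left_mem_Icc.2 hab.le)] at this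
    simp at this
  have hci : ContinuousOn (fun x => sol hq hf t θ x ^ 2) (uIcc (-1) 0) := by
    rw [uIcc_of_le (by norm_num)]; exact hcs.pow 2
  have hint : IntervalIntegrable (fun x => f x * sol hq hf t θ x ^ 2) volume (-1) 0 :=
    hf.intervalIntegrable.mul_continuousOn hci
  have h1 : 0 < ∫ x in a..b, c * sol hq hf t θ x ^ 2 :=
    intervalIntegral.integral_pos hab (continuousOn_const.mul ((hcs.mono hI).pow 2))
      (fun y _ => by positivity) ⟨x₀, hx₀, by positivity⟩
  have hs : uIcc a b ⊆ uIcc (-1) 0 := by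
    rw [uIcc_of_le hab.le, uIcc_of_le (by norm_num)]; exact hI
  calc 0 < ∫ x in a..b, c * sol hq hf t θ x ^ 2 := h1
    _ ≤ ∫ x in a..b, f x * sol hq hf t θ x ^ 2 := by
        refine intervalIntegral.integral_mono_on hab.le
          ((hci.mono hs).intervalIntegrable.const_mul c) (hint.mono_set hs) fun x hx => ?_
        have := hlb x
        rw [indicator_of_mem hx] at this
        gcongr
    _ ≤ _ := intervalIntegral.integral_mono_interval ha.1 hab.le hb.2
        (.of_forall fun x => mul_nonneg (hf0 x) (sq_nonneg _)) hint

end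

/-! ### Rigidity of the phase flow -/

/-- An entire function of order at most `1/2` that is bounded on the real line is constant: `G(w²)`
is of exponential type and bounded on both axes, hence bounded by the Phragmén–Lindelöf principle
in the four quadrants. -/
theorem apply_eq_apply_of_bounded_on_real {G : ℂ → ℂ} (hG : Differentiable ℂ G) {A B C : ℝ}
    (hexp : ∀ w : ℂ, ‖G (w ^ 2)‖ ≤ A * Real.exp (B * ‖w‖)) (hreal : ∀ t : ℝ, ‖G t‖ ≤ C)
    (z z' : ℂ) : G z = G z' := by
  have hd : Differentiable ℂ fun w => G (w ^ 2) := hG.comp (differentiable_pow 2)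
  have hO : ∀ l : Filter ℂ, (fun w => G (w ^ 2)) =O[l] fun w => Real.exp (B * ‖w‖ ^ (1 : ℝ)) := by
    intro l
    refine Asymptotics.IsBigO.of_bound A (.of_forall fun w => ?_)
    rw [Real.rpow_one, Real.norm_of_nonneg (Real.exp_pos _).le]
    exact hexp w
  have hr : ∀ x : ℝ, ‖G ((x : ℂ) ^ 2)‖ ≤ C := fun x => by
    have := hreal (x ^ 2)
    rwa [Complex.ofReal_pow] at this
  have hi : ∀ x : ℝ, ‖G (((x : ℂ) * Complex.I) ^ 2)‖ ≤ C := fun x => by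
    have := hreal (-x ^ 2)
    rwa [Complex.ofReal_neg, Complex.ofReal_pow, show -(x : ℂ) ^ 2 = ((x : ℂ) * Complex.I) ^ 2 by
      rw [mul_pow, Complex.I_sq]; ring] at this
  have hb : ∀ w : ℂ, ‖G (w ^ 2)‖ ≤ C := by
    intro w
    rcases le_total 0 w.re with h1 | h1 <;> rcases le_total 0 w.im with h2 | h2
    · exact PhragmenLindelof.quadrant_I (f := fun w => G (w ^ 2)) hd.diffContOnCl
        ⟨1, one_lt_two, B, hO _⟩ (fun x _ => hr x) (fun x _ => hi x) h1 h2
    · exact PhragmenLindelof.quadrant_IV (f := fun w => G (w ^ 2)) hd.diffContOnCl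
        ⟨1, one_lt_two, B, hO _⟩ (fun x _ => hr x) (fun x _ => hi x) h1 h2
    · exact PhragmenLindelof.quadrant_II (f := fun w => G (w ^ 2)) hd.diffContOnCl
        ⟨1, one_lt_two, B, hO _⟩ (fun x _ => hr x) (fun x _ => hi x) h1 h2
    · exact PhragmenLindelof.quadrant_III (f := fun w => G (w ^ 2)) hd.diffContOnCl
        ⟨1, one_lt_two, B, hO _⟩ (fun x _ => hr x) (fun x _ => hi x) h1 h2
  refine hG.apply_eq_apply_of_bounded ((Metric.isBounded_closedBall (x := (0 : ℂ)) (r := C)).subset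
    ?_) z z'
  rintro _ ⟨y, rfl⟩
  obtain ⟨w, hw⟩ := IsAlgClosed.exists_pow_nat_eq y (n := 2) two_pos
  rw [mem_closedBall_zero_iff, ← hw]
  exact hb w

section

variable {q f : ℝ → ℝ} {K F : ℝ} (hq : IsBddCoeff q K) (hf : IsBddCoeff f F)

/-- In the variable `w = √z` the exponential rate grows linearly. -/
theorem rate_sq_le (hq : IsBddCoeff q K) (hf : IsBddCoeff f F) (w : ℂ) :
    rate K F (w ^ 2) ≤ √(2 * K + 1) + √(2 * F) * ‖w‖ := by
  have := hq.nonneg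
  have := hf.nonneg
  refine Real.sqrt_le_iff.2 ⟨by positivity, ?_⟩
  have h1 : √(2 * K + 1) ^ 2 = 2 * K + 1 := Real.sq_sqrt (by positivity)
  have h2 : √(2 * F) ^ 2 = 2 * F := Real.sq_sqrt (by positivity)
  have h3 : 0 ≤ √(2 * K + 1) * (√(2 * F) * ‖w‖) := by positivity
  rw [norm_pow]
  nlinarith

/-- If `f u²` has positive integral for all couplings, then `(u(-1), u'(-1))` cannot stay bounded
as the coupling ranges over the line. -/
theorem not_bounded_ampSq (hpos : ∀ t θ, 0 < potEnergy hq hf t θ) (θ : ℝ) :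
    ¬ ∃ B, ∀ t, ampSq hq hf t θ (-1) ≤ B := by
  rintro ⟨B, hB⟩
  have hm : (-1 : ℝ) ∈ Icc (-1 : ℝ) 0 := by norm_num
  have hK := hq.nonneg
  have hF := hf.nonneg
  set a : ℂ := (Real.sin θ : ℂ)
  set b : ℂ := (Real.cos θ : ℂ)
  set X : ℝ := 2 * (‖a‖ + ‖b‖) with hX
  have hX0 : 0 ≤ X := by positivity
  have hev : ∀ {G : ℂ → C(Icc (-1 : ℝ) 0, ℂ)}, Differentiable ℂ G →
      Differentiable ℂ fun z => G z ⟨-1, hm⟩ := fun hG z =>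
    (((ContinuousMap.evalCLM ℂ _ : C(Icc (-1 : ℝ) 0, ℂ) →L[ℂ] ℂ).hasFDerivAt
      (x := _)).comp_hasDerivAt z (hG z).hasDerivAt).differentiableAt
  have hs : ∀ w : ℂ, ‖cSol hq hf a b (w ^ 2) ⟨-1, hm⟩‖ ≤
      X * Real.exp √(2 * K + 1) * Real.exp (√(2 * F) * ‖w‖) := by
    intro w
    refine (norm_cSol_le hq hf a b _ _).trans ?_
    rw [mul_assoc X, ← Real.exp_add]
    gcongr
    linarith [rate_sq_le hq hf w]
  have hc : ∀ w : ℂ, ‖cSolDeriv hq hf a b (w ^ 2) ⟨-1, hm⟩‖ ≤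
      (‖b‖ + X * Real.exp (2 * √(2 * K + 1))) * Real.exp (2 * √(2 * F) * ‖w‖) := by
    intro w
    refine (norm_cSolDeriv_le hq hf a b _ _).trans ?_
    have hr := rate_pos hq hf (w ^ 2)
    set ρ := rate K F (w ^ 2) with hρ
    have h1 : K + ‖w ^ 2‖ * F ≤ ρ * ρ := by
      have : ρ ^ 2 = 2 * (K + ‖w ^ 2‖ * F) + 1 := Real.sq_sqrt (by positivity)
      nlinarith [mul_nonneg (norm_nonneg (w ^ 2)) hF]
    have h2 : ρ ≤ Real.exp ρ := by linarith [Real.add_one_le_exp ρ]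
    have h4 : (1 : ℝ) ≤ Real.exp (2 * √(2 * F) * ‖w‖) := Real.one_le_exp (by positivity)
    calc _ ≤ ‖b‖ * 1 + (ρ * ρ) * X / ρ * Real.exp ρ := by
          rw [mul_one]
          gcongr
          simp
      _ = ‖b‖ * 1 + X * (ρ * Real.exp ρ) := by field_simp
      _ ≤ ‖b‖ * Real.exp (2 * √(2 * F) * ‖w‖) +
          X * (Real.exp (2 * √(2 * K + 1)) * Real.exp (2 * √(2 * F) * ‖w‖)) := by
          refine add_le_add (mul_le_mul_of_nonneg_left h4 (norm_nonneg _))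
            (mul_le_mul_of_nonneg_left ?_ hX0)
          calc _ ≤ Real.exp ρ * Real.exp ρ := by gcongr
            _ ≤ _ := by
              rw [← Real.exp_add, ← Real.exp_add, Real.exp_le_exp]
              linarith [rate_sq_le hq hf w]
      _ = _ := by ring
  have hsr : ∀ t : ℝ, ‖cSol hq hf a b t ⟨-1, hm⟩‖ ≤ √B := by
    intro t
    rw [← extend_of_mem _ hm, ← ofReal_sol, Complex.norm_real]
    refine Real.abs_le_sqrt ((le_add_of_nonneg_right (sq_nonneg _)).trans (hB t))
  have hcr : ∀ t : ℝ, ‖cSolDeriv hq hf a b t ⟨-1, hm⟩‖ ≤ √B := by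
    intro t
    rw [← extend_of_mem _ hm, ← ofReal_solDeriv, Complex.norm_real]
    refine Real.abs_le_sqrt ((le_add_of_nonneg_left (sq_nonneg _)).trans (hB t))
  have e1 : ∀ t : ℝ, sol hq hf t θ (-1) = sol hq hf 0 θ (-1) := fun t => by
    have := apply_eq_apply_of_bounded_on_real (hev (differentiable_cSol hq hf a b)) hs hsr t (0 : ℝ)
    simp only [← extend_of_mem _ hm] at this
    rw [← ofReal_sol, ← ofReal_sol] at this
    exact_mod_cast this
  have e2 : ∀ t : ℝ, solDeriv hq hf t θ (-1) = solDeriv hq hf 0 θ (-1) := fun t => by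
    have := apply_eq_apply_of_bounded_on_real (hev (differentiable_cSolDeriv hq hf a b)) hc hcr t
      (0 : ℝ)
    simp only [← extend_of_mem _ hm] at this
    rw [← ofReal_solDeriv, ← ofReal_solDeriv] at this
    exact_mod_cast this
  obtain ⟨s', c', h1, h2, h3⟩ := exists_hasDerivAt_coupling hq hf 0 θ
  have h4 : s' = 0 := by
    rw [funext e1] at h1
    exact h1.unique (hasDerivAt_const _ _)
  have h5 : c' = 0 := by
    rw [funext e2] at h2
    exact h2.unique (hasDerivAt_const _ _)
  have := hpos 0 θ
  rw [← h3, h4, h5] at this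
  simp at this

theorem surjective_angle (t : ℝ) : Function.Surjective fun θ => angle hq hf t θ (-1) := by
  have hm : (-1 : ℝ) ∈ Icc (-1 : ℝ) 0 := by norm_num
  have hb := fun θ => abs_le.1 (abs_angle_sub_le hq hf t θ hm)
  refine ((continuous_angle_param hq hf hm).comp (Continuous.prodMk_right t)).surjective ?_ ?_
  · exact Filter.tendsto_atTop_mono (fun θ => by simp only [Function.comp, id]; linarith [(hb θ).1])
      (Filter.tendsto_atTop_add_const_right _ (-(1 + (K + |t| * F))) Filter.tendsto_id)
  · exact Filter.tendsto_atBot_mono (fun θ => by simp only [Function.comp, id]; linarith [(hb θ).2])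
      (Filter.tendsto_atBot_add_const_right _ (1 + (K + |t| * F)) Filter.tendsto_id)

/-- The solution is linear in `(sin θ, cos θ)`, so that `∫ f u²` is a quadratic form in it. -/
theorem exists_potEnergy_quadratic (t : ℝ) : ∃ a b c : ℝ, ∀ θ, potEnergy hq hf t θ =
    a * Real.sin θ ^ 2 + b * (Real.sin θ * Real.cos θ) + c * Real.cos θ ^ 2 := by
  refine ⟨potEnergy hq hf t (Real.pi / 2),
    2 * ∫ x in (-1 : ℝ)..0, f x * (sol hq hf t (Real.pi / 2) x * sol hq hf t 0 x),
    potEnergy hq hf t 0, fun θ => ?_⟩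
  have hI : ∀ {h : ℝ → ℝ}, ContinuousOn h (Icc (-1) 0) →
      IntervalIntegrable (fun x => f x * h x) volume (-1) 0 := fun hh =>
    hf.intervalIntegrable.mul_continuousOn (by rwa [uIcc_of_le (by norm_num)])
  have h1 := continuousOn_sol hq hf t (Real.pi / 2)
  have h2 := continuousOn_sol hq hf t 0
  simp only [potEnergy]
  rw [← intervalIntegral.integral_const_mul, ← intervalIntegral.integral_mul_const,
    ← intervalIntegral.integral_mul_const, ← intervalIntegral.integral_mul_const,
    ← intervalIntegral.integral_add, ← intervalIntegral.integral_add]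
  · congr 1 with x
    rw [sol_combination hq hf t θ x]
    ring
  · exact ((hI (h1.pow 2)).mul_const _).add (((hI (h1.mul h2)).const_mul 2).mul_const _)
  · exact (hI (h2.pow 2)).mul_const _
  · exact (hI (h1.pow 2)).mul_const _
  · exact ((hI (h1.mul h2)).const_mul 2).mul_const _

/-- A quadratic form `C` in `(u(-1), u'(-1))` that expresses `∫ f u²` at the coupling `t`. It is
obtained by inverting the transfer matrix, which has determinant `1`. -/
theorem exists_quadratic_endpoint (t : ℝ) : ∃ a b c : ℝ, ∀ θ, potEnergy hq hf t θ =
    a * sol hq hf t θ (-1) ^ 2 + b * (sol hq hf t θ (-1) * solDeriv hq hf t θ (-1)) +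
      c * solDeriv hq hf t θ (-1) ^ 2 := by
  obtain ⟨a, b, c, h⟩ := exists_potEnergy_quadratic hq hf t
  have hm : (-1 : ℝ) ∈ Icc (-1 : ℝ) 0 := by norm_num
  have hW := wronskian_eq_one hq hf t 0 hm
  rw [zero_add] at hW
  set s₁ := sol hq hf t (Real.pi / 2) (-1)
  set s₂ := sol hq hf t 0 (-1)
  set c₁ := solDeriv hq hf t (Real.pi / 2) (-1)
  set c₂ := solDeriv hq hf t 0 (-1)
  refine ⟨a * c₂ ^ 2 - b * (c₂ * c₁) + c * c₁ ^ 2,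
    -2 * a * (c₂ * s₂) + b * (c₂ * s₁ + s₂ * c₁) - 2 * c * (c₁ * s₁),
    a * s₂ ^ 2 - b * (s₂ * s₁) + c * s₁ ^ 2, fun θ => ?_⟩
  set x := sol hq hf t θ (-1) with hx
  set y := solDeriv hq hf t θ (-1) with hy
  have ex : x = Real.sin θ * s₁ + Real.cos θ * s₂ := sol_combination hq hf t θ (-1)
  have ey : y = Real.sin θ * c₁ + Real.cos θ * c₂ := solDeriv_combination hq hf t θ (-1)
  have e1 : c₂ * x - s₂ * y = Real.sin θ := by rw [ex, ey]; linear_combination Real.sin θ * hW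
  have e2 : s₁ * y - c₁ * x = Real.cos θ := by rw [ex, ey]; linear_combination Real.cos θ * hW
  rw [h, ← e1, ← e2]
  ring

theorem continuous_ampSq_angle (t : ℝ) : Continuous fun θ => ampSq hq hf t θ (-1) := by
  have h := (continuous_ampSq_param hq hf (-1)).comp (Continuous.prodMk_right t)
  exact h

theorem continuous_potEnergy_angle (t : ℝ) : Continuous fun θ => potEnergy hq hf t θ := by
  have h := (continuous_potEnergy hq hf).comp (Continuous.prodMk_right t)
  exact h

/-- If `k(φ_t(θ)) = R_t(θ)² H(θ)` for all `t` in an open set, where `H(θ) ∫ f u_t(·,θ)²` does not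
depend on `θ` at some `t = t₁` of this set, then a positive definite quadratic form is constant along
`t ↦ (u_t(-1), u_t'(-1))`, first near `t₁` and then, by the identity theorem, on the whole line. -/
theorem false_of_density (hpos : ∀ t θ, 0 < potEnergy hq hf t θ) {J : Set ℝ} (hJ : IsOpen J)
    {t₁ : ℝ} (ht₁ : t₁ ∈ J) {k H : ℝ → ℝ} {c₁ : ℝ} (hc₁ : c₁ ≠ 0)
    (hk : ∀ t ∈ J, ∀ θ, k (angle hq hf t θ (-1)) = ampSq hq hf t θ (-1) * H θ)
    (hH : ∀ θ, H θ * potEnergy hq hf t₁ θ = c₁) : False := by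
  have hm : (-1 : ℝ) ∈ Icc (-1 : ℝ) 0 := by norm_num
  obtain ⟨a, b, c, hC⟩ := exists_quadratic_endpoint hq hf t₁
  have hA : ∀ t θ, 0 < ampSq hq hf t θ (-1) := fun t θ => ampSq_pos hq hf t θ hm
  -- the quadratic form is homogeneous: at equal phases its values are in the ratio of the `ampSq`
  have hform : ∀ t θ θ₁, angle hq hf t₁ θ₁ (-1) = angle hq hf t θ (-1) →
      (a * sol hq hf t θ (-1) ^ 2 + b * (sol hq hf t θ (-1) * solDeriv hq hf t θ (-1)) +
        c * solDeriv hq hf t θ (-1) ^ 2) * ampSq hq hf t₁ θ₁ (-1) =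
      ampSq hq hf t θ (-1) * potEnergy hq hf t₁ θ₁ := by
    intro t θ θ₁ h
    rw [hC θ₁, (sol_eq_sqrt_mul hq hf t θ hm).1, (sol_eq_sqrt_mul hq hf t θ hm).2,
      (sol_eq_sqrt_mul hq hf t₁ θ₁ hm).1, (sol_eq_sqrt_mul hq hf t₁ θ₁ hm).2, h]
    have e1 := Real.sq_sqrt (hA t θ).le
    have e2 := Real.sq_sqrt (hA t₁ θ₁).le
    linear_combination (a * Real.sin (angle hq hf t θ (-1)) ^ 2 +
      b * (Real.sin (angle hq hf t θ (-1)) * Real.cos (angle hq hf t θ (-1))) +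
      c * Real.cos (angle hq hf t θ (-1)) ^ 2) *
      (ampSq hq hf t₁ θ₁ (-1) * e1 - ampSq hq hf t θ (-1) * e2)
  have hloc : ∀ t ∈ J, ∀ θ, a * sol hq hf t θ (-1) ^ 2 +
      b * (sol hq hf t θ (-1) * solDeriv hq hf t θ (-1)) + c * solDeriv hq hf t θ (-1) ^ 2 =
      potEnergy hq hf t₁ θ := by
    intro t ht θ
    obtain ⟨θ₁, h⟩ := surjective_angle hq hf t₁ (angle hq hf t θ (-1))
    have h1 := hform t θ θ₁ h
    have h2 := hk t ht θ
    rw [← h] at h2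
    have h3 := hk t₁ ht₁ θ₁
    rw [h3] at h2
    have hne := (hA t₁ θ₁).ne'
    have hHne : H θ ≠ 0 := fun h0 => hc₁ (by rw [← hH θ, h0, zero_mul])
    refine mul_right_cancel₀ (mul_ne_zero hne hHne) ?_
    linear_combination H θ * h1 - potEnergy hq hf t₁ θ₁ * h2 +
      ampSq hq hf t₁ θ₁ (-1) * (hH θ₁) - ampSq hq hf t₁ θ₁ (-1) * (hH θ)
  have hglob : ∀ t : ℝ, a * sol hq hf t 0 (-1) ^ 2 +
      b * (sol hq hf t 0 (-1) * solDeriv hq hf t 0 (-1)) + c * solDeriv hq hf t 0 (-1) ^ 2 =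
      potEnergy hq hf t₁ 0 := by
    set α : ℂ := (Real.sin 0 : ℂ)
    set β : ℂ := (Real.cos 0 : ℂ)
    have hev : ∀ {G : ℂ → C(Icc (-1 : ℝ) 0, ℂ)}, Differentiable ℂ G →
        Differentiable ℂ fun z => G z ⟨-1, hm⟩ := fun hG z =>
      (((ContinuousMap.evalCLM ℂ _ : C(Icc (-1 : ℝ) 0, ℂ) →L[ℂ] ℂ).hasFDerivAt
        (x := _)).comp_hasDerivAt z (hG z).hasDerivAt).differentiableAt
    have d1 := hev (differentiable_cSol hq hf α β)
    have d2 := hev (differentiable_cSolDeriv hq hf α β)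
    set G : ℂ → ℂ := fun z => a * cSol hq hf α β z ⟨-1, hm⟩ ^ 2 +
      b * (cSol hq hf α β z ⟨-1, hm⟩ * cSolDeriv hq hf α β z ⟨-1, hm⟩) +
      c * cSolDeriv hq hf α β z ⟨-1, hm⟩ ^ 2 with hG
    have hGd : Differentiable ℂ G := by fun_prop
    have hreal : ∀ t : ℝ, G t = ((a * sol hq hf t 0 (-1) ^ 2 +
        b * (sol hq hf t 0 (-1) * solDeriv hq hf t 0 (-1)) +
        c * solDeriv hq hf t 0 (-1) ^ 2 : ℝ) : ℂ) := by
      intro t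
      push_cast
      rw [ofReal_sol, ofReal_solDeriv, extend_of_mem _ hm, extend_of_mem _ hm]
    have hfreq : ∃ᶠ z in nhdsWithin (t₁ : ℂ) {(t₁ : ℂ)}ᶜ,
        G z = (fun _ : ℂ => (potEnergy hq hf t₁ 0 : ℂ)) z := by
      have htend : Filter.Tendsto (fun t : ℝ => (t : ℂ)) (nhdsWithin t₁ {t₁}ᶜ)
          (nhdsWithin (t₁ : ℂ) {(t₁ : ℂ)}ᶜ) :=
        Complex.continuous_ofReal.continuousWithinAt.tendsto_nhdsWithin fun t ht => by
          simpa using ht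
      refine htend.frequently (Filter.Eventually.frequently ?_)
      filter_upwards [mem_nhdsWithin_of_mem_nhds (hJ.mem_nhds ht₁)] with t ht
      rw [hreal, hloc t ht 0]
    have hEq := AnalyticOnNhd.eq_of_frequently_eq (fun z _ => hGd.analyticAt z)
      (fun z _ => analyticAt_const) hfreq
    intro t
    have := congrFun hEq t
    rw [hreal] at this
    exact_mod_cast this
  -- positive definiteness of the quadratic form: it bounds `u² + u'²`, as `ampSq / potEnergy` is
  -- continuous and periodic in the initial phase
  obtain ⟨B, hB⟩ : ∃ B, ∀ θ, ampSq hq hf t₁ θ (-1) / potEnergy hq hf t₁ θ ≤ B := by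
    have hcont : Continuous fun θ => ampSq hq hf t₁ θ (-1) / potEnergy hq hf t₁ θ :=
      (continuous_ampSq_angle hq hf t₁).div (continuous_potEnergy_angle hq hf t₁)
        fun θ => (hpos t₁ θ).ne'
    have hper : Function.Periodic (fun θ => ampSq hq hf t₁ θ (-1) / potEnergy hq hf t₁ θ)
        (2 * Real.pi) := fun θ => by
      simp only [ampSq_add_two_pi, potEnergy_add_two_pi]
    obtain ⟨B, hB⟩ := (isCompact_Icc (a := (0 : ℝ)) (b := 0 + 2 * Real.pi)).bddAbove_image
      hcont.continuousOn
    refine ⟨B, fun θ => ?_⟩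
    obtain ⟨y, hy, e⟩ := hper.exists_mem_Ico Real.two_pi_pos θ 0
    rw [e]
    exact hB ⟨y, Ico_subset_Icc_self hy, rfl⟩
  refine not_bounded_ampSq hq hf hpos 0 ⟨potEnergy hq hf t₁ 0 * B, fun t => ?_⟩
  obtain ⟨θ₁, h⟩ := surjective_angle hq hf t₁ (angle hq hf t 0 (-1))
  have h1 := hform t 0 θ₁ h
  rw [hglob t] at h1
  have h2 : ampSq hq hf t 0 (-1) =
      potEnergy hq hf t₁ 0 * (ampSq hq hf t₁ θ₁ (-1) / potEnergy hq hf t₁ θ₁) := by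
    have := (hpos t₁ θ₁).ne'
    field_simp
    linarith
  rw [h2]
  exact mul_le_mul_of_nonneg_left (hB θ₁) (hpos t₁ 0).le

/-- A nonzero continuous `k` cannot satisfy `k(φ_t(θ)) = R_t(θ)² H(θ)` for all `t` in a nonempty
open set: a primitive of `k` would conjugate the maps `φ_t` to translates of each other, and
differentiation in `t` shows that `H(θ) ∫ f u_t(·,θ)²` is independent of `θ`. -/
theorem density_eq_zero (hpos : ∀ t θ, 0 < potEnergy hq hf t θ) {J : Set ℝ} (hJ : IsOpen J)
    {t₁ : ℝ} (ht₁ : t₁ ∈ J) {k H : ℝ → ℝ} (hkc : Continuous k)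
    (hk : ∀ t ∈ J, ∀ θ, k (angle hq hf t θ (-1)) = ampSq hq hf t θ (-1) * H θ) (θ₀ : ℝ) :
    k θ₀ = 0 := by
  have hm : (-1 : ℝ) ∈ Icc (-1 : ℝ) 0 := by norm_num
  have hA : ∀ t θ, 0 < ampSq hq hf t θ (-1) := fun t θ => ampSq_pos hq hf t θ hm
  have hHk : ∀ t ∈ J, ∀ θ, H θ = k (angle hq hf t θ (-1)) / ampSq hq hf t θ (-1) := by
    intro t ht θ
    rw [hk t ht θ, mul_div_cancel_left₀ _ (hA t θ).ne']
  have hHc : Continuous H := by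
    rw [show H = fun θ => k (angle hq hf t₁ θ (-1)) / ampSq hq hf t₁ θ (-1) from
      funext (hHk t₁ ht₁)]
    exact (hkc.comp ((continuous_angle_param hq hf hm).comp (Continuous.prodMk_right t₁))).div
      (continuous_ampSq_angle hq hf t₁) fun θ => (hA t₁ θ).ne'
  have hprim : ∀ (h : ℝ → ℝ), Continuous h → ∀ x, HasDerivAt (fun y => ∫ s in (0 : ℝ)..y, h s)
      (h x) x := fun h hh x => intervalIntegral.integral_hasDerivAt_right
    (hh.intervalIntegrable _ _) (hh.stronglyMeasurableAtFilter _ _) hh.continuousAt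
  -- a primitive of `k` conjugates `φ_t` to a primitive of `H`, up to a translation
  have hconj : ∀ t ∈ J, ∀ θ, (∫ s in (0 : ℝ)..angle hq hf t θ (-1), k s)
      - (∫ s in (0 : ℝ)..angle hq hf t 0 (-1), k s) = ∫ s in (0 : ℝ)..θ, H s := by
    intro t ht θ
    have hd : ∀ θ, HasDerivAt (fun θ => (∫ s in (0 : ℝ)..angle hq hf t θ (-1), k s)
        - ∫ s in (0 : ℝ)..θ, H s) 0 θ := fun θ => by
      refine (((hprim k hkc _).comp θ (hasDerivAt_angle_angle hq hf t θ)).sub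
        (hprim H hHc θ)).congr_deriv ?_
      rw [hHk t ht θ]; ring
    have := is_const_of_deriv_eq_zero (fun θ => (hd θ).differentiableAt) (fun θ => (hd θ).deriv) θ 0
    simp only [intervalIntegral.integral_same] at this
    linarith
  have hconst : ∀ θ, H θ * potEnergy hq hf t₁ θ = H 0 * potEnergy hq hf t₁ 0 := by
    intro θ
    have hd : ∀ θ, HasDerivAt (fun t => ∫ s in (0 : ℝ)..angle hq hf t θ (-1), k s)
        (H θ * potEnergy hq hf t₁ θ) t₁ := fun θ => by
      refine ((hprim k hkc _).comp t₁ (hasDerivAt_angle_coupling hq hf t₁ θ)).congr_deriv ?_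
      rw [hHk t₁ ht₁ θ]; ring
    have h1 := (hd θ).sub (hd 0)
    have h2 := h1.congr_of_eventuallyEq (f₁ := fun _ => ∫ s in (0 : ℝ)..θ, H s) (by
      filter_upwards [hJ.mem_nhds ht₁] with t ht
      exact (hconj t ht θ).symm)
    linarith [h2.unique (hasDerivAt_const t₁ _)]
  by_contra hne
  obtain ⟨θ, hθ⟩ := surjective_angle hq hf t₁ θ₀
  have hne' : H θ * potEnergy hq hf t₁ θ ≠ 0 := by
    refine mul_ne_zero (fun h0 => hne ?_) (hpos t₁ θ).ne'
    have := hk t₁ ht₁ θ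
    simp only at hθ
    rw [hθ, h0, mul_zero] at this
    exact this
  rw [hconst θ] at hne'
  exact false_of_density hq hf hpos hJ ht₁ hne' hk hconst

end

/-! ### Integral operators with bounded kernel -/

section

variable {X : Type*} [MeasurableSpace X] {μ : Measure X} {k : X → X → ℝ} {C : ℝ}

theorem norm_sq_eq_integral (F : Lp ℂ 2 μ) : ‖F‖ ^ 2 = ∫ x, ‖F x‖ ^ 2 ∂μ := by
  have h : inner ℂ F F = ((‖F‖ ^ 2 : ℝ) : ℂ) := by
    rw [inner_self_eq_norm_sq_to_K]; norm_cast
  rw [L2.inner_def] at h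
  have h2 : ∀ x, inner ℂ (F x) (F x) = ((‖F x‖ ^ 2 : ℝ) : ℂ) := fun x => by
    rw [inner_self_eq_norm_sq_to_K]; norm_cast
  simp only [h2] at h
  rw [integral_complex_ofReal] at h
  exact_mod_cast h.symm

theorem integrable_of_L2 [IsFiniteMeasure μ] (F : Lp ℂ 2 μ) : Integrable F μ :=
  (Lp.memLp F).integrable (by norm_num)

theorem exists_integral_norm_le [IsFiniteMeasure μ] :
    ∃ D : ℝ, 0 ≤ D ∧ ∀ F : Lp ℂ 2 μ, ∫ x, ‖F x‖ ∂μ ≤ D * ‖F‖ := by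
  refine ⟨(μ univ ^ ((1 : ℝ) / 2)).toReal, ENNReal.toReal_nonneg, fun F => ?_⟩
  have h := eLpNorm_le_eLpNorm_mul_rpow_measure_univ (μ := μ) (f := F) (p := 1) (q := 2)
    (by norm_num) (Lp.aestronglyMeasurable F)
  have hfin : μ univ ^ ((1 : ℝ) / 2) ≠ ⊤ :=
    ENNReal.rpow_ne_top_of_nonneg (by norm_num) (measure_ne_top _ _)
  rw [integral_norm_eq_lintegral_enorm (Lp.aestronglyMeasurable F), ← eLpNorm_one_eq_lintegral_enorm,
    Lp.norm_def, mul_comm, ← ENNReal.toReal_mul]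
  refine ENNReal.toReal_mono (ENNReal.mul_ne_top (Lp.eLpNorm_ne_top F) hfin) (h.trans (le_of_eq ?_))
  norm_num

theorem aestronglyMeasurable_kernel (hk : Measurable (Function.uncurry k)) (β : X) :
    AEStronglyMeasurable (fun α => (k β α : ℂ)) μ :=
  (Complex.measurable_ofReal.comp (hk.comp measurable_prodMk_left)).aestronglyMeasurable

theorem integrable_kernel_mul (hk : Measurable (Function.uncurry k)) (hC : ∀ β α, |k β α| ≤ C)
    {F : X → ℂ} (hF : Integrable F μ) (β : X) : Integrable (fun α => (k β α : ℂ) * F α) μ :=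
  hF.bdd_mul (aestronglyMeasurable_kernel hk β) (.of_forall fun α => by
    rw [Complex.norm_real]; exact hC β α)

theorem norm_integral_kernel_le (hC : ∀ β α, |k β α| ≤ C)
    {F : X → ℂ} (hF : Integrable F μ) (β : X) :
    ‖∫ α, (k β α : ℂ) * F α ∂μ‖ ≤ C * ∫ α, ‖F α‖ ∂μ := by
  rw [← integral_const_mul]
  refine norm_integral_le_of_norm_le (hF.norm.const_mul C) (.of_forall fun α => ?_)
  rw [norm_mul, Complex.norm_real]
  exact mul_le_mul_of_nonneg_right (hC β α) (norm_nonneg _)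

theorem stronglyMeasurable_integral_kernel [IsFiniteMeasure μ]
    (hk : Measurable (Function.uncurry k))
    {F : X → ℂ} (hF : StronglyMeasurable F) :
    StronglyMeasurable fun β => ∫ α, (k β α : ℂ) * F α ∂μ :=
  StronglyMeasurable.integral_prod_right (f := fun β α => (k β α : ℂ) * F α)
    ((Complex.measurable_ofReal.comp hk).mul (hF.measurable.comp measurable_snd)).stronglyMeasurable

/-- A bounded measurable kernel on a finite measure space defines a bounded operator on `L²`. -/
theorem exists_isIntegralOperator [IsFiniteMeasure μ] (hk : Measurable (Function.uncurry k))
    (hC : ∀ β α, |k β α| ≤ C) : ∃ T, IsIntegralOperator μ k T := by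
  obtain ⟨D, hD0, hD⟩ := exists_integral_norm_le (μ := μ)
  have hC' : ∀ β α, |k β α| ≤ |C| := fun β α => (hC β α).trans (le_abs_self C)
  have hmem : ∀ F : Lp ℂ 2 μ, MemLp (fun β => ∫ α, (k β α : ℂ) * F α ∂μ) 2 μ := fun F =>
    MemLp.of_bound (stronglyMeasurable_integral_kernel hk
      (Lp.stronglyMeasurable F)).aestronglyMeasurable _
      (.of_forall fun β => norm_integral_kernel_le hC (integrable_of_L2 F) β)
  let L : Lp ℂ 2 μ →ₗ[ℂ] Lp ℂ 2 μ :=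
    { toFun := fun F => (hmem F).toLp _
      map_add' := fun F G => by
        rw [← MemLp.toLp_add]
        refine MemLp.toLp_congr _ _ (.of_forall fun β => ?_)
        simp only [Pi.add_apply]
        rw [← integral_add (integrable_kernel_mul hk hC (integrable_of_L2 F) β)
          (integrable_kernel_mul hk hC (integrable_of_L2 G) β)]
        refine integral_congr_ae ?_
        filter_upwards [Lp.coeFn_add F G] with α h
        rw [h, Pi.add_apply, mul_add]
      map_smul' := fun c F => by
        rw [RingHom.id_apply, ← MemLp.toLp_const_smul]
        refine MemLp.toLp_congr _ _ (.of_forall fun β => ?_)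
        simp only [Pi.smul_apply, smul_eq_mul]
        rw [← integral_const_mul]
        refine integral_congr_ae ?_
        filter_upwards [Lp.coeFn_smul c F] with α h
        rw [h, Pi.smul_apply, smul_eq_mul]
        ring }
  refine ⟨L.mkContinuous ((measureUnivNNReal μ : ℝ) ^ (2 : ℝ≥0∞).toReal⁻¹ * (|C| * D)) fun F => ?_,
    fun F => ⟨.of_forall fun β => integrable_kernel_mul hk hC (integrable_of_L2 F) β,
      MemLp.coeFn_toLp (hmem F)⟩⟩
  rw [mul_assoc]
  refine Lp.norm_le_of_ae_bound (by positivity) ?_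
  filter_upwards [MemLp.coeFn_toLp (hmem F)] with β h
  change ‖(hmem F).toLp _ β‖ ≤ _
  rw [h, mul_assoc]
  exact (norm_integral_kernel_le hC' (integrable_of_L2 F) β).trans
    (mul_le_mul_of_nonneg_left (hD F) (abs_nonneg C))

/-- The adjoint of an integral operator has the transposed kernel. -/
theorem IsIntegralOperator.eq_adjoint [IsFiniteMeasure μ] (hk : Measurable (Function.uncurry k))
    (hC : ∀ β α, |k β α| ≤ C) {T S : Lp ℂ 2 μ →L[ℂ] Lp ℂ 2 μ} (hT : IsIntegralOperator μ k T)
    (hS : IsIntegralOperator μ (fun α β => k β α) S) : S = ContinuousLinearMap.adjoint T := by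
  rw [ContinuousLinearMap.eq_adjoint_iff]
  intro F G
  rw [L2.inner_def, L2.inner_def]
  have hF := integrable_of_L2 F
  have hG := integrable_of_L2 G
  have e1 : ∫ α, inner ℂ (S F α) (G α) ∂μ =
      ∫ α, ∫ β, (k β α : ℂ) * (G α * (starRingEnd ℂ) (F β)) ∂μ ∂μ := by
    refine integral_congr_ae ?_
    filter_upwards [(hS F).2] with α h
    rw [h, RCLike.inner_apply, ← integral_conj, ← integral_const_mul]
    congr 1 with β
    rw [map_mul, Complex.conj_ofReal]; ring
  have e2 : ∫ β, inner ℂ (F β) (T G β) ∂μ =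
      ∫ β, ∫ α, (k β α : ℂ) * (G α * (starRingEnd ℂ) (F β)) ∂μ ∂μ := by
    refine integral_congr_ae ?_
    filter_upwards [(hT G).2] with β h
    rw [h, RCLike.inner_apply, ← integral_mul_const]
    congr 1 with α
    ring
  rw [e1, e2]
  refine integral_integral_swap ?_
  have hF' : Integrable (fun β => (starRingEnd ℂ) (F β)) μ :=
    (LinearIsometryEquiv.integrable_comp_iff (Complex.conjLIE)).2 hF
  refine (hG.mul_prod hF').bdd_mul (f := fun z : X × X => (k z.2 z.1 : ℂ)) (c := C)
    (Complex.measurable_ofReal.comp (hk.comp measurable_swap)).aestronglyMeasurable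
    (.of_forall fun z => ?_)
  rw [Complex.norm_real]; exact hC _ _

/-- An integral operator with bounded kernel on a finite measure space maps weakly convergent
sequences to norm convergent ones, so that it attains its norm on the unit ball. -/
theorem IsIntegralOperator.exists_norm_attained [IsFiniteMeasure μ]
    [TopologicalSpace.SeparableSpace (Lp ℂ 2 μ)]
    (hk : Measurable (Function.uncurry k)) (hC : ∀ β α, |k β α| ≤ C)
    {T : Lp ℂ 2 μ →L[ℂ] Lp ℂ 2 μ} (hT : IsIntegralOperator μ k T) :
    ∃ F : Lp ℂ 2 μ, ‖F‖ ≤ 1 ∧ ‖T F‖ = ‖T‖ := by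
  obtain ⟨D, hD0, hD⟩ := exists_integral_norm_le (μ := μ)
  have hC' : ∀ β α, |k β α| ≤ |C| := fun β α => (hC β α).trans (le_abs_self C)
  have hseq : ∀ n : ℕ, ∃ x : Lp ℂ 2 μ, ‖x‖ < 1 ∧ ‖T‖ - 1 / ((n : ℝ) + 1) < ‖T x‖ := fun n =>
    ContinuousLinearMap.exists_lt_apply_of_lt_opNorm T (sub_lt_self _ (by positivity))
  choose x hx1 hx2 using hseq
  have hlim : Filter.Tendsto (fun n => ‖T (x n)‖) Filter.atTop (nhds ‖T‖) := by
    refine tendsto_of_tendsto_of_tendsto_of_le_of_le (g := fun n : ℕ => ‖T‖ - 1 / ((n : ℝ) + 1))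
      (h := fun _ => ‖T‖) ?_ tendsto_const_nhds (fun n => (hx2 n).le) (fun n => ?_)
    · simpa using (tendsto_const_nhds (x := ‖T‖)).sub tendsto_one_div_add_atTop_nhds_zero_nat
    · exact (T.le_opNorm _).trans (mul_le_of_le_one_right (norm_nonneg _) (hx1 n).le)
  obtain ⟨φ, hφ, σ, hσ, hconv⟩ := WeakDual.isSeqCompact_closedBall ℂ (Lp ℂ 2 μ) 0 1
    (x := fun n => StrongDual.toWeakDual (InnerProductSpace.toDual ℂ (Lp ℂ 2 μ) (x n)))
    (fun n => by
      change InnerProductSpace.toDual ℂ (Lp ℂ 2 μ) (x n) ∈ Metric.closedBall 0 1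
      rw [mem_closedBall_zero_iff, LinearIsometryEquiv.norm_map]
      exact (hx1 n).le)
  set F := (InnerProductSpace.toDual ℂ (Lp ℂ 2 μ)).symm (WeakDual.toStrongDual φ) with hF
  have hFn : ‖F‖ ≤ 1 := by
    have h : WeakDual.toStrongDual φ ∈ Metric.closedBall (0 : StrongDual ℂ (Lp ℂ 2 μ)) 1 := hφ
    rw [mem_closedBall_zero_iff] at h
    rw [hF, LinearIsometryEquiv.norm_map]
    exact h
  have hweak : ∀ y : Lp ℂ 2 μ, Filter.Tendsto (fun n => inner ℂ (x (σ n)) y) Filter.atTop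
      (nhds (inner ℂ F y)) := by
    intro y
    have h := ((WeakDual.eval_continuous y).tendsto φ).comp hconv
    have e : inner ℂ F y = φ y := by
      rw [hF]
      exact InnerProductSpace.toDual_symm_apply
    rw [e]
    exact h
  have hpt : ∀ β, Filter.Tendsto (fun n => ∫ α, (k β α : ℂ) * x (σ n) α ∂μ) Filter.atTop
      (nhds (∫ α, (k β α : ℂ) * F α ∂μ)) := by
    intro β
    have hmem : MemLp (fun α => (k β α : ℂ)) 2 μ :=
      MemLp.of_bound (aestronglyMeasurable_kernel hk β) C (.of_forall fun α => by
        rw [Complex.norm_real]; exact hC β α)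
    have e : ∀ G : Lp ℂ 2 μ, ∫ α, (k β α : ℂ) * G α ∂μ =
        (starRingEnd ℂ) (inner ℂ G (hmem.toLp _)) := by
      intro G
      rw [inner_conj_symm, L2.inner_def]
      refine integral_congr_ae ?_
      filter_upwards [hmem.coeFn_toLp] with α h
      rw [h, RCLike.inner_apply, Complex.conj_ofReal, mul_comm]
    simp only [e]
    exact (Complex.continuous_conj.tendsto _).comp (hweak _)
  have hsq : Filter.Tendsto (fun n => ‖T (x (σ n))‖ ^ 2) Filter.atTop (nhds (‖T F‖ ^ 2)) := by
    have e : ∀ G : Lp ℂ 2 μ, ‖T G‖ ^ 2 = ∫ β, ‖∫ α, (k β α : ℂ) * G α ∂μ‖ ^ 2 ∂μ := by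
      intro G
      rw [norm_sq_eq_integral]
      refine integral_congr_ae ?_
      filter_upwards [(hT G).2] with β h
      rw [h]
    simp only [e]
    refine tendsto_integral_of_dominated_convergence (fun _ => (|C| * D) ^ 2) (fun n => ?_)
      (integrable_const _) (fun n => .of_forall fun β => ?_)
      (.of_forall fun β => ((hpt β).norm.pow 2))
    · exact ((stronglyMeasurable_integral_kernel hk
        (Lp.stronglyMeasurable _)).norm.pow 2).aestronglyMeasurable
    · rw [norm_pow, norm_norm]
      gcongr
      refine (norm_integral_kernel_le hC' (integrable_of_L2 _) β).trans ?_
      gcongr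
      refine (hD _).trans (mul_le_of_le_one_right hD0 (hx1 _).le)
  refine ⟨F, hFn, ?_⟩
  have h := tendsto_nhds_unique hsq ((hlim.comp hσ.tendsto_atTop).pow 2)
  exact (sq_eq_sq₀ (norm_nonneg _) (norm_nonneg _)).1 h

end

theorem separableSpace_L2_circle (N : ℕ+) :
    TopologicalSpace.SeparableSpace (Lp ℂ 2 (volume : Measure (Circle N))) := by
  have : Fact ((2 : ℝ≥0∞) ≠ ⊤) := ⟨by norm_num⟩
  have : SecondCountableTopology (Lp ℂ 2 (volume : Measure (Circle N))) := inferInstance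
  infer_instance

/-! ### Phase flows and their kernels -/

/-- What the integral operator sees of the Prüfer variables at `-1`: the phase `Φ t θ`, the squared
amplitude `A t θ` and the energy `Q t θ = ∫ f u²`, as functions of the coupling `t` and of the
initial phase `θ`, where `T` is the length of the circle. For couplings in `[-M, M]` the phase moves
by less than half of the circle. -/
structure IsPhaseFlow (T M : ℝ) (Φ A Q : ℝ → ℝ → ℝ) : Prop where
  continuous_phase : Continuous fun y : ℝ × ℝ => Φ y.1 y.2
  continuous_amp : Continuous fun y : ℝ × ℝ => A y.1 y.2
  continuous_energy : Continuous fun y : ℝ × ℝ => Q y.1 y.2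
  amp_pos : ∀ t θ, 0 < A t θ
  energy_pos : ∀ t θ, 0 < Q t θ
  hasDerivAt_angle : ∀ t θ, HasDerivAt (Φ t) (1 / A t θ) θ
  hasDerivAt_coupling : ∀ t θ, HasDerivAt (fun t => Φ t θ) (Q t θ / A t θ) t
  phase_add : ∀ t θ, Φ t (θ + T) = Φ t θ + T
  amp_add : ∀ t θ, A t (θ + T) = A t θ
  surjective : ∀ t, Function.Surjective (Φ t)
  abs_sub_lt : ∀ t ∈ Icc (-M) M, ∀ θ, |Φ t θ - θ| < T / 2

/-- The representative in `[0, T)` of a point of the circle. -/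
def baseRep {T : ℝ} [Fact (0 < T)] (α : AddCircle T) : ℝ := (AddCircle.equivIco T 0 α : ℝ)

/-- The kernel with value `√A · r / Q` at the pairs `(β, α)` for which `β` is the phase reached from
`α` with a coupling in `[-M, M]`, and `0` at all other pairs. -/
structure IsFlowKernel {T : ℝ} [Fact (0 < T)] (M : ℝ) (Φ A Q : ℝ → ℝ → ℝ) (r : ℝ → ℝ)
    (k : AddCircle T → AddCircle T → ℝ) : Prop where
  apply_phase : ∀ t ∈ Icc (-M) M, ∀ α,
    k (Φ t (baseRep α) : ℝ) α = √(A t (baseRep α)) * r t / Q t (baseRep α)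
  eq_zero : ∀ β α, (∀ t ∈ Icc (-M) M, ((Φ t (baseRep α) : ℝ) : AddCircle T) ≠ β) → k β α = 0

namespace IsPhaseFlow

variable {T M : ℝ} {Φ A Q : ℝ → ℝ → ℝ}

theorem strictMono_coupling (hΦ : IsPhaseFlow T M Φ A Q) (θ : ℝ) : StrictMono fun t => Φ t θ :=
  strictMono_of_deriv_pos fun t => by
    rw [(hΦ.hasDerivAt_coupling t θ).deriv]
    exact div_pos (hΦ.energy_pos t θ) (hΦ.amp_pos t θ)

theorem strictMono_angle (hΦ : IsPhaseFlow T M Φ A Q) (t : ℝ) : StrictMono (Φ t) :=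
  strictMono_of_deriv_pos fun θ => by
    rw [(hΦ.hasDerivAt_angle t θ).deriv]
    exact one_div_pos.2 (hΦ.amp_pos t θ)

theorem continuous_angle (hΦ : IsPhaseFlow T M Φ A Q) (t : ℝ) : Continuous (Φ t) :=
  hΦ.continuous_phase.comp (Continuous.prodMk_right t)

theorem continuous_sqrt_amp (hΦ : IsPhaseFlow T M Φ A Q)
    : Continuous fun y : ℝ × ℝ => √(A y.1 y.2) :=
  hΦ.continuous_amp.sqrt

theorem sqrt_amp_pos (hΦ : IsPhaseFlow T M Φ A Q)
    (t θ : ℝ) : 0 < √(A t θ) := Real.sqrt_pos.2 (hΦ.amp_pos t θ)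

/-- Differentiable maps carry null sets to null sets. -/
theorem ae_of_ae_comp_phase (hΦ : IsPhaseFlow T M Φ A Q)
    (t : ℝ) {p : ℝ → Prop} (h : ∀ᵐ θ, p (Φ t θ)) : ∀ᵐ x, p x := by
  rw [ae_iff] at h ⊢
  refine measure_mono_null ?_ (addHaar_image_eq_zero_of_differentiableOn_of_addHaar_eq_zero volume
    (f := Φ t) (fun θ _ => (hΦ.hasDerivAt_angle t θ).differentiableAt.differentiableWithinAt) h)
  intro x hx
  obtain ⟨θ, rfl⟩ := hΦ.surjective t x
  exact ⟨θ, hx, rfl⟩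

/-- The preimage under `Φ t` of a null set is null, as the derivative of `Φ t` has no zeros. -/
theorem ae_comp_phase (hΦ : IsPhaseFlow T M Φ A Q)
    (t : ℝ) {p : ℝ → Prop} (h : ∀ᵐ x, p x) : ∀ᵐ θ, p (Φ t θ) := by
  rw [ae_iff] at h ⊢
  set Z := toMeasurable volume {x | ¬ p x} with hZ
  have hZ0 : volume Z = 0 := by rw [hZ, measure_toMeasurable, h]
  have hs : MeasurableSet (Φ t ⁻¹' Z) :=
    (hΦ.continuous_angle t).measurable (measurableSet_toMeasurable _ _)
  refine measure_mono_null (t := Φ t ⁻¹' Z)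
    (fun θ hθ => subset_toMeasurable volume {x | ¬ p x} hθ) ?_
  have h1 := lintegral_image_eq_lintegral_abs_deriv_mul hs
    (fun θ _ => (hΦ.hasDerivAt_angle t θ).hasDerivWithinAt)
    (hΦ.strictMono_angle t).injective.injOn (fun _ => 1)
  rw [setLIntegral_measure_zero _ _ (measure_mono_null (image_preimage_subset _ _) hZ0)] at h1
  have hm : Measurable fun θ => ENNReal.ofReal |1 / A t θ| * 1 := by
    have : Continuous fun θ => A t θ := hΦ.continuous_amp.comp (Continuous.prodMk_right t)
    exact ((measurable_const.div this.measurable).abs.ennreal_ofReal).mul_const _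
  rw [eq_comm, lintegral_eq_zero_iff hm] at h1
  rw [← Measure.restrict_apply_univ, Measure.measure_univ_eq_zero, ← ae_eq_bot,
    ← Filter.eventually_false_iff_eq_bot]
  filter_upwards [h1] with θ h2
  have := one_div_pos.2 (hΦ.amp_pos t θ)
  simp only [mul_one, Pi.zero_apply, ENNReal.ofReal_eq_zero] at h2
  exact absurd (abs_pos.2 this.ne') (not_lt.2 h2)

end IsPhaseFlow

section

variable {T : ℝ} [hT : Fact (0 < T)]

theorem coe_baseRep (α : AddCircle T) : (baseRep α : AddCircle T) = α :=
  (AddCircle.equivIco T 0).symm_apply_apply α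

theorem baseRep_mem (α : AddCircle T) : baseRep α ∈ Ico 0 T := by
  have h : baseRep α ∈ Ico 0 (0 + T) := (AddCircle.equivIco T 0 α).2
  rwa [zero_add] at h

theorem measurable_baseRep : Measurable (baseRep : AddCircle T → ℝ) :=
  measurable_subtype_coe.comp (AddCircle.measurableEquivIco T 0).measurable

theorem eq_of_periodic {Y : Type*} {p : ℝ → Y} (hp : ∀ θ, p (θ + T) = p θ) (θ : ℝ) :
    p (baseRep (θ : AddCircle T)) = p θ := by
  have h : Function.Periodic p T := hp
  rw [← h.lift_coe, coe_baseRep, h.lift_coe]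

theorem eq_of_coe_eq {x y θ : ℝ} (hx : |x - θ| < T / 2) (hy : |y - θ| < T / 2)
    (h : (x : AddCircle T) = y) : x = y := by
  rw [abs_lt] at hx hy
  refine (AddCircle.coe_eq_coe_iff_of_mem_Ico (a := θ - T / 2) ?_ ?_).1 h <;>
  constructor <;> linarith

/-- A periodic property that holds almost everywhere on a period holds almost everywhere. -/
theorem ae_of_periodic {p : ℝ → Prop} (hp : ∀ θ, p (θ + T) ↔ p θ)
    (h : ∀ᵐ θ ∂volume.restrict (Ioc 0 T), p θ) : ∀ᵐ θ, p θ := by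
  have h0 : ∀ n : ℤ, ∀ θ, p (θ + n • T) ↔ p θ := fun n θ => by
    have : Function.Periodic p T := fun θ => propext (hp θ)
    exact iff_of_eq (this.zsmul n θ)
  rw [ae_restrict_iff' measurableSet_Ioc] at h
  have h1 : ∀ n : ℤ, ∀ᵐ θ : ℝ, θ + n • T ∈ Ioc 0 T → p (θ + n • T) := fun n =>
    (measurePreserving_add_right volume (n • T)).quasiMeasurePreserving.ae h
  filter_upwards [ae_all_iff.2 h1] with θ h2
  obtain ⟨n, hn, -⟩ := existsUnique_add_zsmul_mem_Ioc hT.out θ 0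
  rw [zero_add] at hn
  exact (h0 n θ).1 (h2 n hn)

variable {M : ℝ} {Φ A Q : ℝ → ℝ → ℝ} {r : ℝ → ℝ} {k : AddCircle T → AddCircle T → ℝ}

namespace IsPhaseFlow

theorem coupling_unique (hΦ : IsPhaseFlow T M Φ A Q)
    {s t θ : ℝ} (hs : s ∈ Icc (-M) M) (ht : t ∈ Icc (-M) M)
    (h : ((Φ s θ : ℝ) : AddCircle T) = (Φ t θ : ℝ)) : s = t :=
  (hΦ.strictMono_coupling θ).injective
    (eq_of_coe_eq (hΦ.abs_sub_lt s hs θ) (hΦ.abs_sub_lt t ht θ) h)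

/-- The phase at a fixed coupling carries the density `1 / A` over a period to the length measure
of the circle. -/
theorem lintegral_comp_phase (hΦ : IsPhaseFlow T M Φ A Q) (t : ℝ) (G : AddCircle T → ℝ≥0∞) :
    ∫⁻ θ in Ioc 0 T, ENNReal.ofReal (1 / A t θ) * G (Φ t θ : ℝ) = ∫⁻ β, G β := by
  have himg : Φ t '' Ioc 0 T = Ioc (Φ t 0) (Φ t 0 + T) := by
    rw [← hΦ.phase_add t 0, zero_add]
    ext x
    constructor
    · rintro ⟨θ, hθ, rfl⟩
      exact ⟨hΦ.strictMono_angle t hθ.1, (hΦ.strictMono_angle t).monotone hθ.2⟩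
    · rintro ⟨h1, h2⟩
      obtain ⟨θ, rfl⟩ := hΦ.surjective t x
      exact ⟨θ, ⟨(hΦ.strictMono_angle t).lt_iff_lt.1 h1,
        (hΦ.strictMono_angle t).le_iff_le.1 h2⟩, rfl⟩
  rw [← AddCircle.lintegral_preimage T (Φ t 0), ← himg,
    lintegral_image_eq_lintegral_abs_deriv_mul measurableSet_Ioc
      (fun θ _ => (hΦ.hasDerivAt_angle t θ).hasDerivWithinAt)
      (hΦ.strictMono_angle t).injective.injOn]
  refine lintegral_congr fun θ => ?_
  rw [abs_of_pos (one_div_pos.2 (hΦ.amp_pos t θ))]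

/-- The pairs that carry the kernel are the image of a measurable injective map, which sends Borel sets
to Borel sets. -/
theorem measurable_kernel (hΦ : IsPhaseFlow T M Φ A Q)
    (hk : IsFlowKernel M Φ A Q r k) (hr : Continuous r) : Measurable (Function.uncurry k) := by
  set Ψ : Icc (-M) M × AddCircle T → AddCircle T × AddCircle T :=
    fun z => ((Φ z.1 (baseRep z.2) : ℝ), z.2)
  have hb : Measurable fun z : Icc (-M) M × AddCircle T => ((z.1 : ℝ), baseRep z.2) :=
    (measurable_subtype_coe.comp measurable_fst).prodMk (measurable_baseRep.comp measurable_snd)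
  have hΨ : Measurable Ψ :=
    (AddCircle.measurable_mk'.comp (hΦ.continuous_phase.measurable.comp hb)).prodMk measurable_snd
  have hinj : Function.Injective Ψ := by
    rintro ⟨s, α⟩ ⟨t, α'⟩ h
    obtain ⟨h1, h2⟩ := Prod.mk.inj h
    simp only at h1 h2
    subst h2
    rw [Prod.mk.injEq]
    exact ⟨Subtype.ext (hΦ.coupling_unique s.2 t.2 h1), rfl⟩
  have hκ : Measurable fun z : Icc (-M) M × AddCircle T =>
      √(A z.1 (baseRep z.2)) * r z.1 / Q z.1 (baseRep z.2) :=
    ((hΦ.continuous_sqrt_amp.measurable.comp hb).mul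
      (hr.measurable.comp (measurable_subtype_coe.comp measurable_fst))).div
      (hΦ.continuous_energy.measurable.comp hb)
  have hext := (hΨ.measurableEmbedding hinj).measurable_extend hκ
    (g' := fun _ => 0) measurable_const
  convert hext using 1
  ext ⟨β, α⟩
  by_cases h : ∃ z, Ψ z = (β, α)
  · obtain ⟨z, hz⟩ := h
    rw [← hz, hinj.extend_apply]
    exact hk.apply_phase z.1 z.1.2 z.2
  · rw [Function.extend_apply' _ _ _ h]
    refine hk.eq_zero β α fun t ht hβ => h ⟨(⟨t, ht⟩, α), ?_⟩
    rw [← hβ]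

theorem exists_kernel_le (hΦ : IsPhaseFlow T M Φ A Q)
    (hk : IsFlowKernel M Φ A Q r k) (hr : Continuous r) : ∃ C, ∀ β α, |k β α| ≤ C := by
  have hc : Continuous fun y : ℝ × ℝ => √(A y.1 y.2) * r y.1 / Q y.1 y.2 :=
    (hΦ.continuous_sqrt_amp.mul (hr.comp continuous_fst)).div hΦ.continuous_energy
      fun y => (hΦ.energy_pos _ _).ne'
  obtain ⟨C, hC⟩ := (isCompact_Icc (a := -M) (b := M)).prod (isCompact_Icc (a := 0) (b := T))
    |>.exists_bound_of_continuousOn hc.continuousOn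
  refine ⟨max C 0, fun β α => ?_⟩
  by_cases h : ∃ t ∈ Icc (-M) M, ((Φ t (baseRep α) : ℝ) : AddCircle T) = β
  · obtain ⟨t, ht, rfl⟩ := h
    rw [hk.apply_phase t ht α]
    exact (hC (t, baseRep α) ⟨ht, Ico_subset_Icc_self (baseRep_mem α)⟩).trans (le_max_left _ _)
  · push Not at h
    rw [hk.eq_zero β α h, abs_zero]
    exact le_max_right _ _

/-- Change of variables from the phase to the coupling, at a fixed initial phase. -/
theorem integral_kernel_mul (hΦ : IsPhaseFlow T M Φ A Q)
    (hk : IsFlowKernel M Φ A Q r k) (α : AddCircle T) (G : AddCircle T → ℂ) :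
    ∫ β, (k β α : ℂ) * G β = ∫ t in Icc (-M) M,
      ((r t / √(A t (baseRep α)) : ℝ) : ℂ) * G (Φ t (baseRep α) : ℝ) := by
  set θ := baseRep α
  have hsub : (fun t => Φ t θ) '' Icc (-M) M ⊆ Ioc (θ - T / 2) (θ - T / 2 + T) := by
    rintro _ ⟨t, ht, rfl⟩
    have := abs_lt.1 (hΦ.abs_sub_lt t ht θ)
    constructor <;> linarith
  rw [← AddCircle.integral_preimage T (θ - T / 2) fun β => (k β α : ℂ) * G β,
    setIntegral_eq_of_subset_of_forall_sdiff_eq_zero measurableSet_Ioc hsub,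
    integral_image_eq_integral_abs_deriv_smul measurableSet_Icc
      (fun t _ => (hΦ.hasDerivAt_coupling t θ).hasDerivWithinAt)
      (hΦ.strictMono_coupling θ).injective.injOn]
  · refine setIntegral_congr_fun measurableSet_Icc fun t ht => ?_
    have hA := hΦ.amp_pos t θ
    have hQ := hΦ.energy_pos t θ
    rw [hk.apply_phase t ht α, abs_of_pos (div_pos hQ hA), Complex.real_smul, ← mul_assoc,
      ← Complex.ofReal_mul]
    congr 2
    have hs := hΦ.sqrt_amp_pos t θ
    have : A t θ = √(A t θ) * √(A t θ) := (Real.mul_self_sqrt hA.le).symm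
    change Q t θ / A t θ * (√(A t θ) * r t / Q t θ) = r t / √(A t θ)
    rw [div_mul_div_comm, div_eq_div_iff (by positivity) hs.ne']
    conv_rhs => rw [this]
    ring
  · rintro x ⟨hx, hx'⟩
    rw [hk.eq_zero x α, Complex.ofReal_zero, zero_mul]
    intro t ht h
    refine hx' ⟨t, ht, ?_⟩
    have h1 := hsub ⟨t, ht, rfl⟩
    have hper : ∀ y, y ∈ Ioc (θ - T / 2) (θ - T / 2 + T) → ∀ z ∈ Ioc (θ - T / 2) (θ - T / 2 + T),
        (y : AddCircle T) = z → y = z := fun y hy z hz hyz => by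
      have := (AddCircle.equivIoc T (θ - T / 2)).symm.injective.eq_iff
        (a := ⟨y, hy⟩) (b := ⟨z, hz⟩)
      exact congrArg Subtype.val (this.1 hyz)
    exact hper _ h1 _ hx h

end IsPhaseFlow

end

/-! ### Functions whose norm is preserved, and strict contraction -/

theorem integral_norm_sub_mean_sq {Ω : Type*} [MeasurableSpace Ω] {ρ : Measure Ω}
    [IsProbabilityMeasure ρ] {h : Ω → ℂ} (h1 : Integrable h ρ)
    (h2 : Integrable (fun t => ‖h t‖ ^ 2) ρ) :
    ∫ t, ‖h t - ∫ s, h s ∂ρ‖ ^ 2 ∂ρ = ∫ t, ‖h t‖ ^ 2 ∂ρ - ‖∫ s, h s ∂ρ‖ ^ 2 := by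
  set m := ∫ s, h s ∂ρ with hm
  have h3 : Integrable (fun t => (starRingEnd ℂ) m * h t) ρ := h1.const_mul _
  have h4 : Integrable (fun t => 2 * ((starRingEnd ℂ) m * h t).re) ρ := h3.re.const_mul 2
  have e : ∀ t, ‖h t - m‖ ^ 2 = ‖h t‖ ^ 2 - 2 * ((starRingEnd ℂ) m * h t).re + ‖m‖ ^ 2 := by
    intro t
    rw [← Complex.normSq_eq_norm_sq, ← Complex.normSq_eq_norm_sq, ← Complex.normSq_eq_norm_sq,
      Complex.normSq_sub, mul_comm (h t)]
    ring
  simp only [e]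
  have h5 : Integrable (fun t => ‖h t‖ ^ 2 - 2 * ((starRingEnd ℂ) m * h t).re) ρ := h2.sub h4
  rw [integral_add h5 (integrable_const _), integral_sub h2 h4, integral_const_mul]
  have e2 : ∫ t, ((starRingEnd ℂ) m * h t).re ∂ρ = ‖m‖ ^ 2 := by
    have := integral_re h3
    change ∫ t, ((starRingEnd ℂ) m * h t).re ∂ρ = Complex.re _ at this
    rw [this, integral_const_mul, ← hm, ← Complex.normSq_eq_conj_mul_self, Complex.ofReal_re,
      Complex.normSq_eq_norm_sq]
  rw [e2]
  simp
  ring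

/-- Equality in the inequality `‖∫ h(t, ·) dρ(t)‖ ≤ ‖h‖` of `L²` norms, for a probability measure
`ρ`, forces `h(t, ·)` to be independent of `t`. -/
theorem ae_eq_mean {Ω X : Type*} [MeasurableSpace Ω] [MeasurableSpace X] {ρ : Measure Ω}
    [IsProbabilityMeasure ρ] {ν : Measure X} [IsFiniteMeasure ν] {h : Ω × X → ℂ}
    (hh : MemLp h 2 (ρ.prod ν))
    (hle : ∫ z, ‖h z‖ ^ 2 ∂(ρ.prod ν) ≤ ∫ x, ‖∫ t, h (t, x) ∂ρ‖ ^ 2 ∂ν) :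
    ∀ᵐ t ∂ρ, ∀ᵐ x ∂ν, h (t, x) = ∫ s, h (s, x) ∂ρ := by
  set m : X → ℂ := fun x => ∫ s, h (s, x) ∂ρ
  have hsq : Integrable (fun z => ‖h z‖ ^ 2) (ρ.prod ν) :=
    (memLp_two_iff_integrable_sq_norm hh.1).1 hh
  have hint : Integrable h (ρ.prod ν) := hh.integrable (by norm_num)
  have hms : AEStronglyMeasurable m ν := hh.1.prod_swap.integral_prod_right'
  have hvar : ∀ᵐ x ∂ν, ∫ t, ‖h (t, x) - m x‖ ^ 2 ∂ρ = ∫ t, ‖h (t, x)‖ ^ 2 ∂ρ - ‖m x‖ ^ 2 := by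
    filter_upwards [hsq.prod_left_ae, hint.prod_left_ae] with x h1 h2
    exact integral_norm_sub_mean_sq h2 h1
  have hm2 : Integrable (fun x => ‖m x‖ ^ 2) ν := by
    refine hsq.integral_prod_right.mono (hms.norm.pow 2) ?_
    filter_upwards [hvar] with x hx
    have h0 : 0 ≤ ∫ t, ‖h (t, x) - m x‖ ^ 2 ∂ρ := integral_nonneg fun t => by positivity
    rw [Real.norm_of_nonneg (by positivity)]
    exact (by linarith : ‖m x‖ ^ 2 ≤ ∫ t, ‖h (t, x)‖ ^ 2 ∂ρ).trans (Real.le_norm_self _)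
  have hmL : MemLp (fun z : Ω × X => m z.2) 2 (ρ.prod ν) :=
    ((memLp_two_iff_integrable_sq_norm hms).2 hm2).comp_snd ρ
  have hD : Integrable (fun z : Ω × X => ‖h z - m z.2‖ ^ 2) (ρ.prod ν) :=
    (memLp_two_iff_integrable_sq_norm (hh.sub hmL).1).1 (hh.sub hmL)
  have h0 : ∫ z, ‖h z - m z.2‖ ^ 2 ∂(ρ.prod ν) = 0 := by
    refine le_antisymm ?_ (integral_nonneg fun z => by positivity)
    rw [integral_prod_symm _ hD, integral_congr_ae hvar,
      integral_sub hsq.integral_prod_right hm2, ← integral_prod_symm _ hsq]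
    linarith
  have h1 := (integral_eq_zero_iff_of_nonneg (fun z => by positivity) hD).1 h0
  refine (Measure.ae_ae_of_ae_prod h1).mono fun t ht => ht.mono fun x hx => ?_
  have : ‖h (t, x) - m x‖ ^ 2 = 0 := hx
  rwa [sq_eq_zero_iff, norm_eq_zero, sub_eq_zero] at this

namespace IsCouplingDensity

variable {r : ℝ → ℝ}

/-- The probability measure with density `r`. -/
def law (r : ℝ → ℝ) : Measure ℝ := volume.withDensity fun t => ENNReal.ofReal (r t)

theorem isProbabilityMeasure_law (hr : IsCouplingDensity r) : IsProbabilityMeasure (law r) :=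
  ⟨by
    rw [law, withDensity_apply _ MeasurableSet.univ, Measure.restrict_univ,
      ← ofReal_integral_eq_lintegral_ofReal
        (hr.continuous.integrable_of_hasCompactSupport hr.compactSupport) (.of_forall hr.nonneg),
      hr.integral_eq_one, ENNReal.ofReal_one]⟩

theorem integral_law (hr : IsCouplingDensity r) {M : ℝ} (hrM : tsupport r ⊆ Icc (-M) M)
    (h : ℝ → ℂ) : ∫ t, h t ∂law r = ∫ t in Icc (-M) M, (r t : ℂ) * h t := by
  rw [law, integral_withDensity_eq_integral_toReal_smul hr.continuous.measurable.ennreal_ofReal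
    (.of_forall fun _ => ENNReal.ofReal_lt_top),
    setIntegral_eq_integral_of_forall_compl_eq_zero]
  · congr 1 with t
    rw [ENNReal.toReal_ofReal (hr.nonneg t), Complex.real_smul]
  · intro t ht
    rw [image_eq_zero_of_notMem_tsupport fun h => ht (hrM h), Complex.ofReal_zero, zero_mul]

theorem ae_law_iff (hr : IsCouplingDensity r) {p : ℝ → Prop} :
    (∀ᵐ t ∂law r, p t) ↔ ∀ᵐ t, 0 < r t → p t := by
  rw [law, ae_withDensity_iff hr.continuous.measurable.ennreal_ofReal]
  refine Filter.eventually_congr (.of_forall fun t => ?_)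
  rw [ne_eq, ENNReal.ofReal_eq_zero, not_le]

theorem exists_pos (hr : IsCouplingDensity r) : ∃ t, 0 < r t := by
  by_contra! h
  have : ∀ t, r t = 0 := fun t => le_antisymm (h t) (hr.nonneg t)
  have h1 := hr.integral_eq_one
  simp [this] at h1

/-- A continuous identity that holds for almost every coupling holds wherever `r > 0`. -/
theorem eq_of_ae_law (hr : IsCouplingDensity r) {p s : ℝ → ℂ} (hp : Continuous p)
    (hs : Continuous s) (h : ∀ᵐ t ∂law r, p t = s t) {t : ℝ} (ht : 0 < r t) : p t = s t := by
  rw [hr.ae_law_iff] at h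
  by_contra hne
  have hU : IsOpen ({t | 0 < r t} ∩ {t | p t ≠ s t}) :=
    (isOpen_lt continuous_const hr.continuous).inter (isOpen_ne_fun hp hs)
  refine (hU.measure_pos volume ⟨t, ht, hne⟩).ne' ?_
  rw [ae_iff] at h
  refine measure_mono_null ?_ h
  rintro x ⟨h1, h2⟩ h3
  exact h2 (h3 h1)

end IsCouplingDensity

/-- The transposed operator, expressed in the coupling variable: the mean of `F ∘ Φ t / √A` over the
law of the coupling `t`. -/
def flowMean {T : ℝ} (M : ℝ) (Φ A : ℝ → ℝ → ℝ) (r : ℝ → ℝ) (F : AddCircle T → ℂ) (θ : ℝ) : ℂ :=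
  ∫ t in Icc (-M) M, ((r t / √(A t θ) : ℝ) : ℂ) * F (Φ t θ : ℝ)

namespace IsPhaseFlow

variable {T M : ℝ} {Φ A Q : ℝ → ℝ → ℝ} {r : ℝ → ℝ} {k : AddCircle T → AddCircle T → ℝ}

theorem flowMean_add (hΦ : IsPhaseFlow T M Φ A Q) (F : AddCircle T → ℂ) (θ : ℝ) :
    flowMean M Φ A r F (θ + T) = flowMean M Φ A r F θ := by
  simp only [flowMean, hΦ.phase_add, hΦ.amp_add, AddCircle.coe_add_period]

theorem continuous_flowMean_of_continuous (hΦ : IsPhaseFlow T M Φ A Q) (hr : Continuous r)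
    {F : AddCircle T → ℂ} (hF : Continuous F) : Continuous (flowMean M Φ A r F) := by
  refine continuous_parametric_integral_of_continuous (s := Icc (-M) M)
    (f := fun θ t => ((r t / √(A t θ) : ℝ) : ℂ) * F (Φ t θ : ℝ)) ?_ isCompact_Icc
  have h1 : Continuous fun y : ℝ × ℝ => r y.2 / √(A y.2 y.1) :=
    (hr.comp continuous_snd).div (hΦ.continuous_sqrt_amp.comp continuous_swap)
      fun y => (hΦ.sqrt_amp_pos _ _).ne'
  exact (Complex.continuous_ofReal.comp h1).mul (hF.comp
    ((AddCircle.continuous_mk' T).comp (hΦ.continuous_phase.comp continuous_swap)))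

variable [Fact (0 < T)]

theorem flowMean_baseRep (hΦ : IsPhaseFlow T M Φ A Q) (F : AddCircle T → ℂ) (θ : ℝ) :
    flowMean M Φ A r F (baseRep (θ : AddCircle T)) = flowMean M Φ A r F θ :=
  eq_of_periodic (hΦ.flowMean_add F) θ

/-- As the kernel is bounded, the mean is a continuous function even for an integrable `F`. -/
theorem continuous_flowMean (hΦ : IsPhaseFlow T M Φ A Q) (hk : IsFlowKernel M Φ A Q r k)
    (hr : Continuous r) {F : AddCircle T → ℂ} (hF : Integrable F) :
    Continuous (flowMean M Φ A r F) := by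
  obtain ⟨C, hC⟩ := hΦ.exists_kernel_le hk hr
  have hm := hΦ.measurable_kernel hk hr
  have hm' : Measurable (Function.uncurry fun α β => k β α) := hm.comp measurable_swap
  refine continuous_of_uniform_approx_of_continuous fun u hu => ?_
  obtain ⟨ε, hε, hεu⟩ := Metric.mem_uniformity_dist.1 hu
  obtain ⟨G, hG, hGi⟩ := hF.exists_boundedContinuous_integral_sub_le
    (ε := ε / (2 * (|C| + 1))) (by positivity)
  refine ⟨flowMean M Φ A r G, hΦ.continuous_flowMean_of_continuous hr G.continuous,
    fun θ => hεu ?_⟩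
  rw [← hΦ.flowMean_baseRep F θ, ← hΦ.flowMean_baseRep G θ, flowMean, flowMean,
    ← hΦ.integral_kernel_mul hk, ← hΦ.integral_kernel_mul hk, dist_eq_norm,
    ← integral_sub (integrable_kernel_mul (k := fun α β => k β α) hm' (fun α β => hC β α) hF _)
      (integrable_kernel_mul (k := fun α β => k β α) hm' (fun α β => hC β α) hGi _)]
  simp only [← mul_sub]
  refine (norm_integral_kernel_le (k := fun α β => k β α) (fun α β => (hC β α).trans
    (le_abs_self C)) (hF.sub hGi) _).trans_lt ?_
  calc |C| * ∫ α, ‖F α - G α‖ ≤ |C| * (ε / (2 * (|C| + 1))) := by gcongr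
    _ ≤ (|C| + 1) * (ε / (2 * (|C| + 1))) := by gcongr; linarith
    _ = ε / 2 := by field_simp
    _ < ε := by linarith

/-- If the transposed operator does not decrease the norm of `F`, then `F ∘ Φ t = √A · m` with one
function `m` for almost all couplings `t`. -/
theorem ae_eq_of_norm_le (hΦ : IsPhaseFlow T M Φ A Q) (hk : IsFlowKernel M Φ A Q r k)
    (hr : IsCouplingDensity r) (hrM : tsupport r ⊆ Icc (-M) M)
    {S : Lp ℂ 2 (volume : Measure (AddCircle T)) →L[ℂ] Lp ℂ 2 (volume : Measure (AddCircle T))}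
    (hS : IsIntegralOperator volume (fun α β => k β α) S)
    {F : Lp ℂ 2 (volume : Measure (AddCircle T))} (hF : ‖F‖ ≤ ‖S F‖) :
    ‖S F‖ ^ 2 = ∫ θ in Ioc 0 T, ‖flowMean M Φ A r F θ‖ ^ 2 ∧
      ∀ᵐ t ∂IsCouplingDensity.law r, ∀ᵐ θ : ℝ,
        F (Φ t θ : ℝ) = (√(A t θ) : ℂ) * flowMean M Φ A r F θ := by
  have := hr.isProbabilityMeasure_law
  set ρ := IsCouplingDensity.law r
  set ν : Measure ℝ := volume.restrict (Ioc 0 T)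
  have hFm := Lp.stronglyMeasurable F
  have hSF : ‖S F‖ ^ 2 = ∫ θ in Ioc 0 T, ‖flowMean M Φ A r F θ‖ ^ 2 := by
    have e : ∀ᵐ α, ‖S F α‖ ^ 2 = ‖flowMean M Φ A r F (baseRep α)‖ ^ 2 := by
      filter_upwards [(hS F).2] with α h
      rw [h, hΦ.integral_kernel_mul hk α F, flowMean]
    rw [norm_sq_eq_integral, integral_congr_ae e]
    have := AddCircle.integral_preimage T 0
      fun α : AddCircle T => ‖flowMean M Φ A r F (baseRep α)‖ ^ 2
    rw [zero_add] at this
    rw [← this]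
    simp only [hΦ.flowMean_baseRep]
  refine ⟨hSF, ?_⟩
  -- `h t` is the isometric image of `F` at the coupling `t`
  set h : ℝ × ℝ → ℂ := fun z => ((√(A z.1 z.2) : ℝ) : ℂ)⁻¹ * F (Φ z.1 z.2 : ℝ) with hh
  have hmeas : Measurable h :=
    (Complex.measurable_ofReal.comp hΦ.continuous_sqrt_amp.measurable).inv.mul
      (hFm.measurable.comp (AddCircle.measurable_mk'.comp hΦ.continuous_phase.measurable))
  have hmean : ∀ θ, ∫ t, h (t, θ) ∂ρ = flowMean M Φ A r F θ := fun θ => by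
    rw [hr.integral_law hrM, flowMean]
    congr 1 with t
    rw [hh]
    push_cast
    ring
  have hlint : ∫⁻ z, ENNReal.ofReal (‖h z‖ ^ 2) ∂(ρ.prod ν) = ∫⁻ α, ENNReal.ofReal (‖F α‖ ^ 2) := by
    rw [lintegral_prod _ (hmeas.norm.pow_const 2).ennreal_ofReal.aemeasurable]
    have e : ∀ t, ∫⁻ θ, ENNReal.ofReal (‖h (t, θ)‖ ^ 2) ∂ν = ∫⁻ α, ENNReal.ofReal (‖F α‖ ^ 2) := by
      intro t
      rw [← hΦ.lintegral_comp_phase t]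
      refine lintegral_congr fun θ => ?_
      rw [← ENNReal.ofReal_mul (one_div_pos.2 (hΦ.amp_pos t θ)).le, hh]
      congr 1
      dsimp only
      rw [norm_mul, norm_inv, Complex.norm_real, Real.norm_of_nonneg (Real.sqrt_nonneg _), mul_pow,
        inv_pow, Real.sq_sqrt (hΦ.amp_pos t θ).le, one_div]
    simp only [e, lintegral_const, measure_univ, mul_one]
  have hFsq : Integrable fun α => ‖F α‖ ^ 2 :=
    (memLp_two_iff_integrable_sq_norm hFm.aestronglyMeasurable).1 (Lp.memLp F)
  have hnn : ∀ z, 0 ≤ ‖h z‖ ^ 2 := fun z => by positivity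
  have hsqm : AEStronglyMeasurable (fun z => ‖h z‖ ^ 2) (ρ.prod ν) :=
    (hmeas.norm.pow_const 2).aestronglyMeasurable
  have hmem : MemLp h 2 (ρ.prod ν) := by
    refine (memLp_two_iff_integrable_sq_norm hmeas.aestronglyMeasurable).2 ⟨hsqm, ?_⟩
    rw [hasFiniteIntegral_iff_ofReal (.of_forall hnn), hlint]
    exact (hasFiniteIntegral_iff_ofReal (.of_forall fun α => by positivity)).1 hFsq.2
  have hint : ∫ z, ‖h z‖ ^ 2 ∂(ρ.prod ν) = ‖F‖ ^ 2 := by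
    rw [integral_eq_lintegral_of_nonneg_ae (.of_forall hnn) hsqm, hlint, norm_sq_eq_integral,
      integral_eq_lintegral_of_nonneg_ae (.of_forall fun α => by positivity) hFsq.1]
  have hmain := ae_eq_mean hmem (by
    simp only [hmean]
    rw [hint, ← hSF]
    gcongr)
  refine hmain.mono fun t ht => ?_
  refine ae_of_periodic (T := T) (fun θ => ?_) (ht.mono fun θ hθ => ?_)
  · rw [hΦ.phase_add, hΦ.amp_add, hΦ.flowMean_add, AddCircle.coe_add_period]
  · rw [hmean] at hθ
    have hne : ((√(A t θ) : ℝ) : ℂ) ≠ 0 := Complex.ofReal_ne_zero.2 (hΦ.sqrt_amp_pos t θ).ne'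
    rw [← hθ, hh]
    dsimp only
    rw [mul_inv_cancel_left₀ hne]

/-- The operator is a strict contraction, provided that no nonzero continuous density is
transported by the phase flow to densities `H` that do not depend on the coupling. -/
theorem norm_lt_one (hΦ : IsPhaseFlow T M Φ A Q) (hk : IsFlowKernel M Φ A Q r k)
    (hr : IsCouplingDensity r) (hrM : tsupport r ⊆ Icc (-M) M)
    (hrig : ∀ (J : Set ℝ) (t₁ : ℝ) (p H : ℝ → ℝ), IsOpen J → t₁ ∈ J → Continuous p →
      (∀ t ∈ J, ∀ θ, p (Φ t θ) = A t θ * H θ) → ∀ x, p x = 0)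
    [TopologicalSpace.SeparableSpace (Lp ℂ 2 (volume : Measure (AddCircle T)))] :
    ∃ S : Lp ℂ 2 (volume : Measure (AddCircle T)) →L[ℂ] Lp ℂ 2 (volume : Measure (AddCircle T)),
      IsIntegralOperator volume k S ∧ ‖S‖ < 1 := by
  obtain ⟨C, hC⟩ := hΦ.exists_kernel_le hk hr.continuous
  have hm := hΦ.measurable_kernel hk hr.continuous
  have hm' : Measurable (Function.uncurry fun α β => k β α) := hm.comp measurable_swap
  have hC' : ∀ α β, |(fun α β => k β α) α β| ≤ C := fun α β => hC β α
  obtain ⟨R, hR⟩ := exists_isIntegralOperator (μ := volume) hm hC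
  obtain ⟨S, hS⟩ := exists_isIntegralOperator (μ := volume) hm' hC'
  refine ⟨R, hR, ?_⟩
  have hnorm : ‖R‖ = ‖S‖ := by
    rw [hR.eq_adjoint hm hC hS, LinearIsometryEquiv.norm_map]
  rw [hnorm]
  by_contra! hge
  obtain ⟨F, hF1, hF2⟩ := hS.exists_norm_attained hm' hC'
  obtain ⟨hSF, hae⟩ := hΦ.ae_eq_of_norm_le hk hr hrM hS
    (hF1.trans (hge.trans hF2.ge))
  set m := flowMean M Φ A r F with hmdef
  have hmc : Continuous m := hΦ.continuous_flowMean hk hr.continuous (integrable_of_L2 F)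
  have := hr.isProbabilityMeasure_law
  obtain ⟨t₂, ht₂⟩ := hae.exists
  let e : ℝ ≃o ℝ := (hΦ.strictMono_angle t₂).orderIsoOfSurjective _ (hΦ.surjective t₂)
  have hec : Continuous e.symm := e.symm.toHomeomorph.continuous
  have hsymm : ∀ θ, e.symm (Φ t₂ θ) = θ := fun θ => e.symm_apply_apply θ
  -- `P` is the continuous version of `F`, read off from a single coupling `t₂`
  set P : ℝ → ℂ := fun x => (√(A t₂ (e.symm x)) : ℂ) * m (e.symm x) with hP
  have hPc : Continuous P :=
    (Complex.continuous_ofReal.comp (hΦ.continuous_sqrt_amp.comp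
      (continuous_const.prodMk hec))).mul (hmc.comp hec)
  have hPF : ∀ᵐ x : ℝ, F (x : AddCircle T) = P x :=
    hΦ.ae_of_ae_comp_phase t₂ (ht₂.mono fun θ hθ => by rw [hθ, hP]; simp only [hsymm])
  have hsqrt : ∀ θ, Continuous fun t => (√(A t θ) : ℂ) := fun θ =>
    Complex.continuous_ofReal.comp (hΦ.continuous_sqrt_amp.comp (Continuous.prodMk_left θ))
  have hPm : ∀ᵐ t ∂IsCouplingDensity.law r, ∀ θ, P (Φ t θ) = (√(A t θ) : ℂ) * m θ := by
    filter_upwards [hae] with t ht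
    have hcr : Continuous fun θ => (√(A t θ) : ℂ) * m θ :=
      (Complex.continuous_ofReal.comp (hΦ.continuous_sqrt_amp.comp
        (Continuous.prodMk_right t))).mul hmc
    have h1 : (fun θ => P (Φ t θ)) =ᵐ[volume] fun θ => (√(A t θ) : ℂ) * m θ := by
      filter_upwards [ht, hΦ.ae_comp_phase t hPF] with θ h2 h3
      rw [← h3, h2]
    exact fun θ => congrFun
      (((hPc.comp (hΦ.continuous_angle t)).ae_eq_iff_eq volume hcr).1 h1) θ
  have hJ : ∀ t, 0 < r t → ∀ θ, P (Φ t θ) = (√(A t θ) : ℂ) * m θ := fun t ht θ =>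
    hr.eq_of_ae_law (p := fun t => P (Φ t θ)) (s := fun t => (√(A t θ) : ℂ) * m θ)
      (hPc.comp (hΦ.continuous_phase.comp (Continuous.prodMk_left θ)))
      ((hsqrt θ).mul continuous_const) (hPm.mono fun t h => h θ) ht
  obtain ⟨t₁, ht₁⟩ := hr.exists_pos
  have hzero : ∀ x, ‖P x‖ ^ 2 = 0 := hrig {t | 0 < r t} t₁ (fun x => ‖P x‖ ^ 2)
    (fun θ => ‖m θ‖ ^ 2) (isOpen_lt continuous_const hr.continuous) ht₁ (hPc.norm.pow 2)
    fun t ht θ => by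
      rw [hJ t ht θ, norm_mul, Complex.norm_real, Real.norm_of_nonneg (Real.sqrt_nonneg _),
        mul_pow, Real.sq_sqrt (hΦ.amp_pos t θ).le]
  have hm0 : ∀ θ, ‖m θ‖ ^ 2 = 0 := fun θ => by
    have h1 := hzero (Φ t₁ θ)
    rw [hJ t₁ ht₁ θ, norm_mul, Complex.norm_real, Real.norm_of_nonneg (Real.sqrt_nonneg _),
      mul_pow, Real.sq_sqrt (hΦ.amp_pos t₁ θ).le] at h1
    exact (mul_eq_zero.1 h1).resolve_left (hΦ.amp_pos t₁ θ).ne'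
  simp only [hm0, integral_zero] at hSF
  have h1 : (1 : ℝ) ≤ ‖S F‖ := hge.trans hF2.ge
  nlinarith

end IsPhaseFlow

/-! ### The Prüfer variables as a phase flow -/

section

theorem isBddCoeff_background (g : Background) (E : ℝ) :
    IsBddCoeff (fun x => g x - E) (‖g‖ + |E|) := by
  have hae : ∀ᵐ x ∂volume.restrict (Ioc (-1 : ℝ) 0), |g x - E| ≤ ‖g‖ + |E| := by
    rw [← Measure.restrict_congr_set Ioo_ae_eq_Ioc]
    have h := ae_le_eLpNormEssSup (f := g) (μ := volume.restrict (Ioo (-1 : ℝ) 0))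
    filter_upwards [h] with x hx
    rw [← eLpNorm_exponent_top] at hx
    have h1 : ‖g x‖ ≤ ‖g‖ := by
      rw [Lp.norm_def, ← toReal_enorm]
      exact ENNReal.toReal_mono (Lp.eLpNorm_ne_top g) hx
    exact (abs_sub _ _).trans (add_le_add_left h1 _)
  refine ⟨by positivity, ?_, (ae_restrict_iff' measurableSet_Ioc).1 hae⟩
  rw [intervalIntegrable_iff_integrableOn_Ioc_of_le (by norm_num)]
  refine Integrable.of_bound ?_ _ hae
  rw [← Measure.restrict_congr_set Ioo_ae_eq_Ioc]
  exact (Lp.aestronglyMeasurable g).sub aestronglyMeasurable_const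

theorem isBddCoeff_singleSite {f : ℝ → ℝ} (hf : IsSingleSitePotential f) :
    IsBddCoeff f (eLpNorm f ⊤ volume).toReal := by
  obtain ⟨c, C, p, q, hc, hcC, hpq, -, hb⟩ := hf.bounds
  have hfin : eLpNorm f ⊤ volume ≠ ⊤ := by
    refine (memLp_top_of_bound hf.aemeasurable.aestronglyMeasurable C (.of_forall fun x => ?_)).2.ne
    have h0 : 0 ≤ f x := (indicator_nonneg (fun _ _ => hc.le) x).trans (hb x).1
    rw [Real.norm_of_nonneg h0]
    exact (hb x).2.trans (indicator_le_self' (fun _ _ => hc.le.trans hcC) x)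
  have hae : ∀ᵐ x : ℝ, |f x| ≤ (eLpNorm f ⊤ volume).toReal := by
    filter_upwards [ae_le_eLpNormEssSup (f := f) (μ := volume)] with x hx
    rw [← eLpNorm_exponent_top] at hx
    rw [← Real.norm_eq_abs, ← toReal_enorm]
    exact ENNReal.toReal_mono hfin hx
  refine ⟨ENNReal.toReal_nonneg, ?_, hae.mono fun x h _ => h⟩
  rw [intervalIntegrable_iff_integrableOn_Ioc_of_le (by norm_num)]
  exact Integrable.of_bound hf.aemeasurable.aestronglyMeasurable.restrict _ (ae_restrict_of_ae hae)

variable {q f : ℝ → ℝ} {K F : ℝ}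

/-- The Prüfer variables at `-1` form a phase flow on `ℝ / 2πNℤ` if `N` is large. -/
theorem isPhaseFlow (hq : IsBddCoeff q K) (hf : IsBddCoeff f F)
    (hpos : ∀ t θ, 0 < potEnergy hq hf t θ) {M : ℝ} {N : ℕ+}
    (hN : 1 + (K + M * F) < ((N : ℕ) : ℝ) * Real.pi) :
    IsPhaseFlow (2 * Real.pi * ((N : ℕ) : ℝ)) M (fun t θ => angle hq hf t θ (-1))
      (fun t θ => ampSq hq hf t θ (-1)) (potEnergy hq hf) := by
  have hm : (-1 : ℝ) ∈ Icc (-1 : ℝ) 0 := ⟨le_rfl, by norm_num⟩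
  have hper : ∀ {p : ℝ → ℝ}, (∀ θ, p (θ + 2 * Real.pi) = p θ) →
      ∀ θ, p (θ + 2 * Real.pi * ((N : ℕ) : ℝ)) = p θ := fun {p} hp θ => by
    have h : Function.Periodic p (2 * Real.pi) := hp
    rw [mul_comm]
    exact h.nat_mul N θ
  refine ⟨continuous_angle_param hq hf hm, continuous_ampSq_param hq hf (-1),
    continuous_potEnergy hq hf, fun t θ => ampSq_pos hq hf t θ hm, hpos,
    hasDerivAt_angle_angle hq hf, hasDerivAt_angle_coupling hq hf, fun t θ => ?_,
    fun t => hper (p := fun θ => ampSq hq hf t θ (-1)) fun θ =>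
      ampSq_add_two_pi hq hf t θ (-1),
    surjective_angle hq hf, fun t ht θ => ?_⟩
  · have h := hper (p := fun θ => angle hq hf t θ (-1) - θ)
      (fun θ => by rw [angle_add_two_pi hq hf t θ (-1)]; ring) θ
    linarith
  · have h1 : |t| * F ≤ M * F := mul_le_mul_of_nonneg_right (abs_le.2 ht) hf.nonneg
    have := abs_angle_sub_le hq hf t θ hm
    linarith

/-- The kernel `T₁` is the kernel of the flow of the Prüfer variables. -/
theorem isFlowKernel_kernelT₁ {N : ℕ+} {M : ℝ} {g : Background} {E : ℝ} {r f : ℝ → ℝ} {K F : ℝ}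
    (hq : IsBddCoeff (fun x => g x - E) K) (hf : IsBddCoeff f F)
    (hΦ : IsPhaseFlow (2 * Real.pi * ((N : ℕ) : ℝ)) M (fun t θ => angle hq hf t θ (-1))
      (fun t θ => ampSq hq hf t θ (-1)) (potEnergy hq hf)) :
    IsFlowKernel M (fun t θ => angle hq hf t θ (-1)) (fun t θ => ampSq hq hf t θ (-1))
      (potEnergy hq hf) r (kernelT₁ r f M N g E) := by
  have hm : (-1 : ℝ) ∈ Icc (-1 : ℝ) 0 := ⟨le_rfl, by norm_num⟩
  have hpot : ∀ t, potential f g E t = fun x => (g x - E) + t * f x := fun t => by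
    ext x; rw [potential]; ring
  have hiff : ∀ β α t, IsCoupling f M N g E β α t ↔
      t ∈ Icc (-M) M ∧ ((angle hq hf t (baseRep α) (-1) : ℝ) : Circle N) = β := fun β α t => by
    rw [IsCoupling, hpot, phase_eq hq hf t _ hm]; rfl
  refine ⟨fun t ht α => ?_, fun β α h => ?_⟩
  · set β : Circle N := ((angle hq hf t (baseRep α) (-1) : ℝ) : Circle N)
    have hex : ∃ s, IsCoupling f M N g E β α s := ⟨t, (hiff β α t).2 ⟨ht, rfl⟩⟩
    have hc : coupling f M N g E β α = t := by
      obtain ⟨h1, h2⟩ := (hiff β α _).1 (Classical.epsilon_spec hex)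
      exact hΦ.coupling_unique h1 ht h2
    rw [kernelT₁, if_pos hex, rPlus, hc, hpot]
    congr 1
    · rw [amplitude_eq hq hf t _ hm]; rfl
    · refine intervalIntegral.integral_congr fun x hx => ?_
      rw [uIcc_of_le (by norm_num)] at hx
      simp only [uPlus, hc, hpot, solution_eq hq hf t _ hx]
      rfl
  · exact if_neg fun ⟨t, ht⟩ => h t ((hiff β α t).1 ht).1 ((hiff β α t).1 ht).2

end

end PrueferOperator

end

theorem proposition4p1 (r f : ℝ → ℝ)
    (hr : PrueferOperator.IsCouplingDensity r) (hf : PrueferOperator.IsSingleSitePotential f)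
    (M : ℝ) (hM : 0 < M) (hrM : tsupport r ⊆ Set.Icc (-M) M)
    (g : PrueferOperator.Background) (E : ℝ) (N : ℕ+)
    (hN : 2 + ‖g‖ + M * (MeasureTheory.eLpNorm f ⊤ MeasureTheory.volume).toReal + |E|
      < ((N : ℕ) : ℝ) * Real.pi) :
    ∃ T₁ : MeasureTheory.Lp ℂ 2 (MeasureTheory.volume : MeasureTheory.Measure (PrueferOperator.Circle N))
        →L[ℂ] MeasureTheory.Lp ℂ 2 (MeasureTheory.volume : MeasureTheory.Measure (PrueferOperator.Circle N)),
      PrueferOperator.IsIntegralOperator MeasureTheory.volume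
        (PrueferOperator.kernelT₁ r f M N g E) T₁ ∧ ‖T₁‖ < 1 := by
  have hg' := PrueferOperator.isBddCoeff_background g E
  have hf' := PrueferOperator.isBddCoeff_singleSite hf
  obtain ⟨c, C, p, q, hc, -, hpq, hI, hb⟩ := hf.bounds
  have hpos := PrueferOperator.potEnergy_pos hg' hf' hc hpq hI fun x => (hb x).1
  have hΦ := PrueferOperator.isPhaseFlow (M := M) (N := N) hg' hf' hpos (by linarith)
  have := PrueferOperator.separableSpace_L2_circle N
  exact hΦ.norm_lt_one (PrueferOperator.isFlowKernel_kernelT₁ hg' hf' hΦ) hr hrM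
    fun J t₁ p H hJ ht hp h x =>
      PrueferOperator.density_eq_zero hg' hf' hpos hJ ht hp h x
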